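/- **Metrical task systems.** Let $(X,d)$ be a finite metric space with $|X|>1$. A (fractional) online algorithm maps each finite sequence of cost functions $c_1,\dots,c_t:X\to\mathbb R_{\ge 0}$, $t\ge 0$, to a probability distribution $\mu_t$ on $X$. Its service cost on $c=\langle c_t\rangle_{t\ge1}$ is $\sum_{t\ge1}\langle \mu_t,c_t\rangle$ and its movement cost is $\sum_{t\ge1}W^1_X(\mu_{t-1},\mu_t)$, where $W^1_X$ is the $L^1$-transportation cost of $(X,d)$. For $\rho_0\in X$ let $\mathrm{cost}^*(c)=\inf\sum_{t\ge1}[c_t(\rho_t)+d(\rho_{t-1},\rho_t)]$ over all sequences $\rho_1,\rho_2,\ldots$ in $X$. The algorithm is $\alpha$-competitive for service costs and $\alpha'$-competitive for movement costs if for every $\rho_0\in X$ there is $\beta>0$ such that, for all cost sequences $c$, its service cost is at most $\alpha\,\mathrm{cost}^*(c)+\beta$ and its movement cost is at most $\alpha'\,\mathrm{cost}^*(c)+\beta$. **Marked DAGs.** A DAG over $X$ is a finite directed acyclic graph $D=(V,A)$ with $X\subseteq V$, a single source $r$, and set of sinks $X$. A marked DAG $\hat D=(D,\omega,\theta)$ has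 in addition arc lengths $\omega_{uv}>0$ with $\omega_{uv}>\omega_{vw}$ whenever $uv,vw\in A$, and weights $\theta_{uv}>0$ with $\sum_{v:uv\in A}\theta_{uv}=1$ for $u\in V\setminus X$. Put $\eta_{uv}=1+\log(1/\theta_{uv})$ and $\delta_{uv}=\theta_{uv}/\eta_{uv}$. Let $\mathcal P_D$ be the set of directed paths from $r$ to a sink, and $\bar\gamma\in X$ the endpoint of $\gamma\in\mathcal P_D$. Let $\Delta_0(D)$ be the maximal number of arcs of a path in $\mathcal P_D$, and $\Delta_I(\hat D)=\max_{\gamma\in\mathcal P_D}\log(1/\prod_{uv\in\gamma}\theta_{uv})$. For distinct $\gamma_1,\gamma_2\in\mathcal P_D$ that first diverge at $u$, along arcs $uv_1\neq uv_2$, put $\mathrm{dist}_{\hat D}(\gamma_1,\gamma_2)=\max(\omega_{uv_1},\omega_{uv_2})$, and put $\mathrm{dist}_{\hat D}(\gamma,\gamma)=0$. A unit flow is a vector $F\in\mathbb R_{\ge0}^A$ that is conserved at all vertices other than $r$ and the sinks and has total outflow $1$ at $r$; it is a unit flow to $x\in X$ if its inflow at $x$ is $1$. For unit flows $F,F'$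 let $W^1_{\hat D}(F,F')$ be the infimum, over all probability distributions $\chi,\chi'$ on $\mathcal P_D$ that induce $F$ and $F'$, of the $L^1$-transportation cost between $\chi$ and $\chi'$ for $\mathrm{dist}_{\hat D}$. The marked DAG $\hat D$ is - $\tau$-geometric if $\omega_{uv}\ge\tau\,\omega_{vw}$ for all $uv,vw\in A$; - $\epsilon$-expanding if $\mathrm{dist}_{\hat D}(\gamma_1,\gamma_2)\ge\epsilon\, d(\bar\gamma_1,\bar\gamma_2)$ for all $\gamma_1,\gamma_2\in\mathcal P_D$; - $L$-Lipschitz if for every sequence $x_1,\dots,x_m\in X$ there are unit flows $F^{(i)}$ to $x_i$ with $\sum_{i=1}^{m-1}W^1_{\hat D}(F^{(i)},F^{(i+1)})\le L\sum_{i=1}^{m-1}d(x_i,x_{i+1})$. **Mirror descent dynamics.** Let $\mathcal Q_D$ be the set of $q\in\mathbb R_{\ge0}^A$ with $\sum_{v:uv\in A}q_{uv}=1$ for all $u\in V\setminus X$; each $q\in\mathcal Q_D$ induces the unique unit flow $F=\Lambda(q)$ with $F_{uv}=q_{uv}\sum_{w:uw\in A}F_{uw}$ for all $uv\in A$. Let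 $\kappa>0$ and let $c(t)\in\mathbb R_{\ge0}^X$, $t\ge0$, be a cost path. A trajectory is a locally absolutely continuous curve $q:[0,\infty)\to\mathcal Q_D$ such that for almost every $t$ there are numbers $\beta_u$ and multipliers $\alpha_{uv}\ge0$ with $\alpha_{uv}q_{uv}(t)=0$ for which $$\partial_t q_{uv}(t)=\kappa\,\frac{\eta_{uv}}{\omega_{uv}}\,\bigl(q_{uv}(t)+\delta_{uv}\bigr)\bigl(\beta_u-\hat c_{uv}\bigr)\quad(uv\in A),\qquad \sum_{v:uv\in A}\partial_t q_{uv}(t)=0\quad(u\in V\setminus X),$$ where $\hat c_{uv}=\hat c_v-\alpha_{uv}$, with $\hat c_x=c_x(t)$ for $x\in X$ and $\hat c_v=\sum_{w:vw\in A}q_{vw}(t)\,\hat c_w$ for $v\in V\setminus X$. These are the mirror descent dynamics for the multiscale entropy $\frac1\kappa\sum_{uv\in A}\frac{\omega_{uv}}{\eta_{uv}}(F_{uv}+\delta_{uv}F_u)\log\bigl(\frac{F_{uv}}{F_u}+\delta_{uv}\bigr)$ (where $F_u$ is the total flow through $u$), written in the variables $q_{uv}=F_{uv}/F_u$. Given $q_0\in\mathcal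 Q_D$, an online algorithm is a mirror descent algorithm started at $q_0$ if for every cost sequence $\langle c_t\rangle_{t\ge 1}$ there is a trajectory $q$ with $q(0)=q_0$ for the cost path equal to $c_t$ on $[t-1,t)$, $t=1,2,\dots$, such that for every integer $t\ge0$ the distribution $\mu_t$ gives each $x\in X$ the amount of the flow $\Lambda(q(t))$ that enters $x$. **Theorem.** There is a universal constant $C>0$ such that the following holds. Let $\hat D$ be a marked DAG over $X$ that is $\tau$-geometric for some $\tau\ge4$, $\epsilon$-expanding for some $\epsilon>0$, and $L$-Lipschitz with respect to $(X,d)$. Then for $\kappa=6L$ and every $q_0\in\mathcal Q_D$, a mirror descent algorithm started at $q_0$ exists, and every such algorithm is $1$-competitive for service costs and $C\,\frac{L}{\epsilon}\,(\Delta_0(D)+\Delta_I(\hat D))$-competitive for movement costs. -/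

import Mathlib

open scoped NNReal ENNReal
open MeasureTheory

noncomputable section

namespace MTS

/-! ## Transportation cost and metrical task systems -/

/-- The `L¹`-transportation cost between two (finitely supported, nonnegative) mass distributions
`μ`, `ν` on a finite set, for the ground distance `d`: the infimum of `∑ π i j * d i j` over all
couplings `π` of `μ` and `ν`. -/
def transportCost {ι : Type*} [Fintype ι] (d : ι → ι → ℝ) (μ ν : ι → ℝ) : ℝ :=
  sInf {s | ∃ π : ι → ι → ℝ, (∀ i j, 0 ≤ π i j) ∧ (∀ i, ∑ j, π i j = μ i) ∧
    (∀ j, ∑ i, π i j = ν j) ∧ s = ∑ i, ∑ j, π i j * d i j}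

/-- A cost sequence; the cost function that arrives in round `t + 1` is `c t`, for `t = 0, 1, …`. -/
abbrev CostSeq (X : Type*) := ℕ → X → ℝ≥0

/-- A (fractional) online algorithm: after each round `t` it plays a probability distribution
on `X` that is a function of the first `t` cost functions only. -/
abbrev OnlineAlgorithm (X : Type*) [Fintype X] :=
  (t : ℕ) → (Fin t → X → ℝ≥0) → stdSimplex ℝ X

namespace OnlineAlgorithm

variable {X : Type*} [Fintype X]

/-- The distribution played after the first `t` cost functions of `c` (initially for `t = 0`). -/
def state (alg : OnlineAlgorithm X) (c : CostSeq X) (t : ℕ) : X → ℝ :=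
  (alg t (fun i => c i)).1

/-- Total service cost: the cost function of a round is charged to the distribution
that is played after it has been revealed. -/
def serviceCost (alg : OnlineAlgorithm X) (c : CostSeq X) : ℝ≥0∞ :=
  ∑' t : ℕ, ENNReal.ofReal (∑ x, alg.state c (t + 1) x * (c t x : ℝ))

/-- Total movement cost, measured by the transportation distance of `(X, d)`. -/
def movementCost [MetricSpace X] (alg : OnlineAlgorithm X) (c : CostSeq X) : ℝ≥0∞ :=
  ∑' t : ℕ, ENNReal.ofReal (transportCost (dist : X → X → ℝ) (alg.state c t) (alg.state c (t + 1)))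

end OnlineAlgorithm

/-- The offline optimum for the cost sequence `c` with initial state `ρ₀`. -/
def offlineCost {X : Type*} [MetricSpace X] (ρ₀ : X) (c : CostSeq X) : ℝ≥0∞ :=
  ⨅ ρ : {ρ : ℕ → X // ρ 0 = ρ₀},
    ∑' t : ℕ, ((c t (ρ.1 (t + 1)) : ℝ≥0∞) + edist (ρ.1 t) (ρ.1 (t + 1)))

/-- `alg` is `a`-competitive for service costs and `a'`-competitive for movement costs:
for every initial state of the offline optimum there is an additive constant that works for all
cost sequences. -/
def IsCompetitive {X : Type*} [Fintype X] [MetricSpace X] (alg : OnlineAlgorithm X)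
    (a a' : ℝ≥0∞) : Prop :=
  ∀ ρ₀ : X, ∃ β : ℝ≥0, 0 < β ∧ ∀ c : CostSeq X,
    alg.serviceCost c ≤ a * offlineCost ρ₀ c + β ∧
    alg.movementCost c ≤ a' * offlineCost ρ₀ c + β

/-! ## DAGs over a finite set -/

/-- A directed acyclic graph over `X` with vertex set `V`: it has a single source `root`, and its
sinks are exactly the points of `X` (identified with vertices through `sink`). -/
structure DAGOver (X V : Type*) extends Digraph V where
  sink : X ↪ V
  root : V
  acyclic : ∀ v, ¬ Relation.TransGen Adj v v
  source_iff : ∀ v, (∀ u, ¬ Adj u v) ↔ v = root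
  sink_iff : ∀ v, (∀ w, ¬ Adj v w) ↔ v ∈ Set.range sink

namespace DAGOver

variable {X V : Type*}

/-- A directed path from the root to a sink, as its sequence of vertices. -/
@[ext]
structure RootPath (D : DAGOver X V) where
  verts : List V
  endpoint : X
  isChain : verts.IsChain D.Adj
  head_eq : verts.head? = some D.root
  last_eq : verts.getLast? = some (D.sink endpoint)

namespace RootPath

variable {D : DAGOver X V}

/-- The sequence of arcs of a path. -/
def arcs (γ : D.RootPath) : List (V × V) := γ.verts.zip γ.verts.tail

end RootPath

theorem RootPath.nodup {D : DAGOver X V} (γ : D.RootPath) : γ.verts.Nodup := by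
  have h1 : γ.verts.IsChain (Relation.TransGen D.Adj) :=
    γ.isChain.imp fun _ _ h => Relation.TransGen.single h
  have h2 := List.isChain_iff_pairwise.1 h1
  refine h2.imp ?_
  rintro a b h rfl
  exact D.acyclic a h

instance (D : DAGOver X V) [Finite V] : Finite D.RootPath := by
  classical
  have := Fintype.ofFinite V
  refine Finite.of_injective
    (fun γ : D.RootPath => (⟨γ.verts, γ.nodup⟩ : {l : List V // l.Nodup})) ?_
  intro γ γ' h
  have h1 : γ.verts = γ'.verts := congrArg Subtype.val h
  refine RootPath.ext h1 (D.sink.injective ?_)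
  have h2 := γ.last_eq
  rw [h1, γ'.last_eq] at h2
  exact (Option.some.inj h2).symm

instance (D : DAGOver X V) [Finite V] : Fintype D.RootPath := Fintype.ofFinite _

variable [Fintype V]

open scoped Classical in
/-- Total amount of `F` on the arcs leaving `u`. -/
def outflow (D : DAGOver X V) (F : V → V → ℝ) (u : V) : ℝ := ∑ v with D.Adj u v, F u v

open scoped Classical in
/-- Total amount of `F` on the arcs entering `v`. -/
def inflow (D : DAGOver X V) (F : V → V → ℝ) (v : V) : ℝ := ∑ u with D.Adj u v, F u v

/-- `F` is a unit flow. A vector indexed by the arcs is represented by a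
function on `V × V` that vanishes off the arcs. -/
structure IsUnitFlow (D : DAGOver X V) (F : V → V → ℝ) : Prop where
  support : ∀ u v, ¬ D.Adj u v → F u v = 0
  nonneg : ∀ u v, 0 ≤ F u v
  conservation : ∀ u, u ∉ Set.range D.sink → u ≠ D.root → D.outflow F u = D.inflow F u
  unit : D.outflow F D.root = 1

/-- `F` is a unit flow all of whose mass ends in the sink `x`. -/
def IsUnitFlowTo (D : DAGOver X V) (F : V → V → ℝ) (x : X) : Prop :=
  D.IsUnitFlow F ∧ D.inflow F (D.sink x) = 1

open scoped Classical in
/-- `χ` is a distribution of mass over the root-sink paths that induces the flow `F`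
(for a unit flow `F`, the total mass of `χ` is then `1`). -/
def IsPathDecomposition (D : DAGOver X V) (χ : D.RootPath → ℝ) (F : V → V → ℝ) : Prop :=
  (∀ γ, 0 ≤ χ γ) ∧ ∀ u v, F u v = ∑ γ : D.RootPath, if (u, v) ∈ γ.arcs then χ γ else 0

/-- `q` specifies a probability distribution on the arcs leaving each non-sink vertex. -/
structure IsTransition (D : DAGOver X V) (q : V → V → ℝ) : Prop where
  support : ∀ u v, ¬ D.Adj u v → q u v = 0
  nonneg : ∀ u v, 0 ≤ q u v
  sum_eq_one : ∀ u, u ∉ Set.range D.sink → D.outflow q u = 1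

/-- `F` is the unit flow which is split at every vertex according to `q`. -/
def IsInducedFlow (D : DAGOver X V) (q F : V → V → ℝ) : Prop :=
  D.IsUnitFlow F ∧ ∀ u v, D.Adj u v → F u v = D.outflow F u * q u v

/-- Combinatorial depth: the maximal number of arcs on a root-sink path. -/
def combDepth (D : DAGOver X V) : ℕ :=
  Finset.univ.sup fun γ : D.RootPath => γ.arcs.length

end DAGOver

/-! ## Marked DAGs -/

/-- A marked DAG over `X`: positive arc lengths `len` (that is, `ω`) which decrease along paths,
and positive weights `θ` which form a probability distribution on the arcs leaving each
non-sink vertex. Only the values on arcs matter. -/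
structure MarkedDAG (X V : Type*) [Fintype V] extends DAGOver X V where
  len : V → V → ℝ
  θ : V → V → ℝ
  len_pos : ∀ u v, Adj u v → 0 < len u v
  len_decreasing : ∀ u v w, Adj u v → Adj v w → len v w < len u v
  θ_pos : ∀ u v, Adj u v → 0 < θ u v
  θ_sum : ∀ u, u ∉ Set.range sink → toDAGOver.outflow θ u = 1

namespace MarkedDAG

variable {X V : Type*} [Fintype V]

def η (M : MarkedDAG X V) (u v : V) : ℝ := 1 + Real.log (1 / M.θ u v)

def δ (M : MarkedDAG X V) (u v : V) : ℝ := M.θ u v / M.η u v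

/-- Information depth: the maximum of `log (1 / θ(γ))` over the root-sink paths `γ`, where `θ(γ)`
is the product of `θ` over the arcs of `γ`. -/
def infoDepth (M : MarkedDAG X V) : ℝ :=
  ⨆ γ : M.RootPath, Real.log (1 / (γ.arcs.map fun e => M.θ e.1 e.2).prod)

def IsGeometric (M : MarkedDAG X V) (τ : ℝ) : Prop :=
  ∀ u v w, M.Adj u v → M.Adj v w → τ * M.len v w ≤ M.len u v

open scoped Classical in
/-- The larger of the two arc lengths at the first place where two vertex sequences with the same
first vertex diverge; `0` if there is no such place. -/
def divergence (len : V → V → ℝ) : List V → List V → ℝ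
  | u :: v :: l, u' :: v' :: l' =>
      if v = v' then divergence len (v :: l) (v' :: l') else max (len u v) (len u' v')
  | _, _ => 0

/-- The ultrametric on root-sink paths. -/
def pathDist (M : MarkedDAG X V) (γ γ' : M.RootPath) : ℝ :=
  divergence M.len γ.verts γ'.verts

/-- The `L¹`-transportation cost between unit flows, for the ultrametric on paths. A flow
can be a mixture of paths in several ways; the infimum is over all of them. -/
def flowDist (M : MarkedDAG X V) (F F' : V → V → ℝ) : ℝ :=
  sInf {s | ∃ χ χ' : M.RootPath → ℝ, M.IsPathDecomposition χ F ∧ M.IsPathDecomposition χ' F' ∧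
    s = transportCost M.pathDist χ χ'}

def IsExpanding [MetricSpace X] (M : MarkedDAG X V) (ε : ℝ) : Prop :=
  ∀ γ γ' : M.RootPath, ε * dist γ.endpoint γ'.endpoint ≤ M.pathDist γ γ'

/-- For every sequence `x 0, …, x m` of points there are unit flows to these points
whose total transportation cost is at most `L` times the length of the sequence. -/
def IsLipschitz [MetricSpace X] (M : MarkedDAG X V) (L : ℝ) : Prop :=
  ∀ (m : ℕ) (x : ℕ → X), ∃ F : ℕ → V → V → ℝ,
    (∀ i ≤ m, M.IsUnitFlowTo (F i) (x i)) ∧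
    ∑ i ∈ Finset.range m, M.flowDist (F i) (F (i + 1)) ≤
      L * ∑ i ∈ Finset.range m, dist (x i) (x (i + 1))

/-! ## Mirror descent dynamics -/

/-- `q'` is an admissible velocity of the mirror descent dynamics at the transition
probabilities `q`, for the cost vector `c`. Here `chat v` is the expected cost of
a particle at `v` that follows `q` to a sink; `β u` normalizes: it is the number that makes the
velocities at `u` add up to `0`; and `α` are the Lagrange multipliers of the constraints
`0 ≤ q u v`, so that the effective cost `chat v - α u v` of an arc can be lower than `chat v` only
where `q u v = 0`. -/
def IsVelocity (M : MarkedDAG X V) (κ : ℝ) (c : X → ℝ) (q q' : V → V → ℝ) : Prop :=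
  ∃ (chat β : V → ℝ) (α : V → V → ℝ),
    (∀ x, chat (M.sink x) = c x) ∧
    (∀ u, u ∉ Set.range M.sink → chat u = M.outflow (fun u v => q u v * chat v) u) ∧
    (∀ u v, M.Adj u v → 0 ≤ α u v ∧ α u v * q u v = 0) ∧
    (∀ u, M.outflow q' u = 0) ∧
    ∀ u v, M.Adj u v →
      q' u v = κ * (M.η u v / M.len u v) * (q u v + M.δ u v) * (β u - (chat v - α u v))

/-- `q : [0, ∞) → ℝ^A` is a trajectory of the mirror descent dynamics for the cost
path `c`: a locally absolutely continuous curve of transition probabilities that moves with an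
admissible velocity at almost every time. -/
structure IsTrajectory (M : MarkedDAG X V) (κ : ℝ) (c : ℝ → X → ℝ) (q : ℝ → V → V → ℝ) :
    Prop where
  transition : ∀ t, 0 ≤ t → M.IsTransition (q t)
  absCont : ∀ T, 0 < T → ∀ u v, AbsolutelyContinuousOnInterval (fun t => q t u v) 0 T
  velocity : ∀ᵐ t ∂(volume.restrict (Set.Ioi (0 : ℝ))), ∃ q' : V → V → ℝ,
    (∀ u v, HasDerivAt (fun s => q s u v) (q' u v) t) ∧ M.IsVelocity κ (c t) (q t) q'

/-- The cost path during which the cost function of each round is present for one unit of time. -/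
def costPath (c : CostSeq X) (s : ℝ) (x : X) : ℝ := c ⌊s⌋₊ x

/-- `alg` is the MTS algorithm specified by the mirror descent dynamics started in `q₀`:
for every cost sequence, the distribution it plays after round `t` is the amount of flow entering
each sink at time `t` of a trajectory of the dynamics. -/
def IsMirrorDescentAlgorithm [Fintype X] (M : MarkedDAG X V) (κ : ℝ) (q₀ : V → V → ℝ)
    (alg : OnlineAlgorithm X) : Prop :=
  ∀ c : CostSeq X, ∃ q : ℝ → V → V → ℝ, q 0 = q₀ ∧ M.IsTrajectory κ (costPath c) q ∧
    ∀ t : ℕ, ∃ F : V → V → ℝ, M.IsInducedFlow (q t) F ∧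
      ∀ x, alg.state c t x = M.inflow F (M.sink x)

end MarkedDAG

end MTS

end

open scoped NNReal ENNReal
open MeasureTheory

noncomputable section

namespace MTS

open scoped Classical

/-! ## Recursion over the vertices of a DAG -/

namespace DAGOver

variable {X V : Type*} (D : DAGOver X V)

/-! Both bounds rest on the Bregman divergence `divg F q` of the multiscale entropy, where `F` is a
unit flow to the current position of the offline player. While a cost is present, the divergence
changes at a rate of at most `κ` times (offline cost minus instantaneous service cost); this is
`IsVelocity.divg_deriv_le`. When the offline player moves, `F` is replaced by the next flow supplied
by the Lipschitz property. For fixed `q` the divergence is convex and homogeneous of degree one in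
`F`: it is the pairing of `F` with its own gradient and dominates the pairing with the gradient at
any other point. The choice of `η` and `δ` makes each gradient term comparable to an arc length, and
arc lengths decay geometrically, so the gradient sums of two paths differ by at most 6 times their
distance. Hence the divergence grows by at most `6 * flowDist` (`divg_sub_le_flowDist`), in total by
`6 * L` times the distance travelled offline; for `κ = 6 * L`, division by `κ` leaves the factor 1.
The algorithm pays at the end of each round, where the instantaneous cost is smallest
(`value_end_le`), so the time integral dominates the service cost.

For movement, Kantorovich duality (`transportCost_le_of_lipschitz`) reduces the task to the change
of the expectation of a 1-Lipschitz function. By expansion, `ε` times its rate is at most the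
expected sum of `len * |q'|` over the vertices that a particle visits. At each vertex this sum is
paid for by the derivative of a bounded potential and a multiple of the costs weighted by `η`
(`IsVelocity.movement_le`). Since `η` is `1 + log (1 / θ)`, its sum along a path is at most the
combinatorial plus the information depth, so the weighted costs are at most that depth times the
instantaneous service cost (`value_η_le`), whose integral the divergence controls again.

For existence, logarithmic coordinates `z` turn the dynamics into `z' = β - chat + α`, reflected at
`z = 0`. Explicit steps with truncation at 0 have uniformly bounded speed, and a limit along one
fixed ultrafilter is a trajectory (`isTrajectory_limit`). Because the ultrafilter is fixed, the
limit at an integer time depends only on the costs of earlier rounds, which makes it an online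
algorithm without any uniqueness of trajectories. -/

theorem wellFounded_child [Finite V] : WellFounded fun v u => D.Adj u v := by
  have : IsTrans V fun v u => Relation.TransGen D.Adj u v := ⟨fun _ _ _ h h' => h'.trans h⟩
  have : Std.Irrefl fun v u => Relation.TransGen D.Adj u v := ⟨D.acyclic⟩
  exact Subrelation.wf (fun h => Relation.TransGen.single h)
    (Finite.wellFounded_of_trans_of_irrefl fun v u => Relation.TransGen D.Adj u v)

theorem wellFounded_parent [Finite V] : WellFounded D.Adj := by
  have : IsTrans V (Relation.TransGen D.Adj) := ⟨fun _ _ _ h h' => h.trans h'⟩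
  have : Std.Irrefl (Relation.TransGen D.Adj) := ⟨D.acyclic⟩
  exact Subrelation.wf (fun h => Relation.TransGen.single h)
    (Finite.wellFounded_of_trans_of_irrefl (Relation.TransGen D.Adj))

theorem not_adj_sink (x : X) (v : V) : ¬ D.Adj (D.sink x) v :=
  (D.sink_iff _).2 ⟨x, rfl⟩ v

theorem not_sink_of_adj {u v : V} (h : D.Adj u v) : u ∉ Set.range D.sink := by
  rintro ⟨x, rfl⟩
  exact D.not_adj_sink x v h

theorem exists_adj {u : V} (h : u ∉ Set.range D.sink) : ∃ v, D.Adj u v := by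
  by_contra! hc
  exact h ((D.sink_iff u).1 hc)

theorem not_adj_root (u : V) : ¬ D.Adj u D.root := (D.source_iff _).2 rfl u

theorem exists_parent {v : V} (h : v ≠ D.root) : ∃ u, D.Adj u v := by
  by_contra! hc
  exact h ((D.source_iff v).1 hc)

theorem sink_induction [Finite V] {P : V → Prop} (sink : ∀ x, P (D.sink x))
    (step : ∀ u, u ∉ Set.range D.sink → (∀ v, D.Adj u v → P v) → P u) (u : V) : P u := by
  refine D.wellFounded_child.induction u fun u ih => ?_
  by_cases hu : u ∈ Set.range D.sink
  · obtain ⟨x, rfl⟩ := hu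
    exact sink x
  · exact step u hu ih

/-- The sinks are reachable from every vertex, and every vertex is reachable from the root. -/
theorem reachable_root [Finite V] (v : V) : Relation.ReflTransGen D.Adj D.root v := by
  refine D.wellFounded_parent.induction v fun v ih => ?_
  by_cases hv : v = D.root
  · rw [hv]
  · obtain ⟨u, hu⟩ := D.exists_parent hv
    exact (ih u hu).tail hu

theorem root_not_sink [Finite V] [Nontrivial X] : D.root ∉ Set.range D.sink := by
  rintro ⟨x, hx⟩
  obtain ⟨y, hy⟩ := exists_ne x
  rcases Relation.ReflTransGen.cases_head (D.reachable_root (D.sink y)) with h | ⟨v, h, -⟩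
  · exact hy (D.sink.injective (hx ▸ h)).symm
  · rw [← hx] at h
    exact D.not_adj_sink x v h

/-- The function on the vertices with values `b` at the sinks and `op u` applied to the values
at the children at any other vertex `u`. -/
def recurse [Finite V] (b : X → ℝ) (op : V → (V → ℝ) → ℝ) : V → ℝ :=
  D.wellFounded_child.fix fun u ih =>
    if hu : u ∈ Set.range D.sink then b hu.choose
    else op u fun v => if h : D.Adj u v then ih v h else 0

theorem recurse_sink [Finite V] (b : X → ℝ) (op : V → (V → ℝ) → ℝ) (x : X) :
    D.recurse b op (D.sink x) = b x := by
  rw [recurse, WellFounded.fix_eq]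
  have h : D.sink x ∈ Set.range D.sink := ⟨x, rfl⟩
  rw [dif_pos h, D.sink.injective h.choose_spec]

theorem recurse_of_not_sink [Finite V] (b : X → ℝ) (op : V → (V → ℝ) → ℝ) {u : V}
    (hu : u ∉ Set.range D.sink) :
    D.recurse b op u = op u fun v => if D.Adj u v then D.recurse b op v else 0 := by
  rw [recurse, WellFounded.fix_eq, dif_neg hu]
  rfl

variable [Fintype V]

/-- The children of a vertex. -/
def succs (u : V) : Finset V := {v | D.Adj u v}

@[simp]
theorem mem_succs {u v : V} : v ∈ D.succs u ↔ D.Adj u v := by simp [succs]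

theorem outflow_eq (F : V → V → ℝ) (u : V) : D.outflow F u = ∑ v ∈ D.succs u, F u v := rfl

@[simp]
theorem succs_sink (x : X) : D.succs (D.sink x) = ∅ := by
  ext v
  simp [D.not_adj_sink]

theorem outflow_eq_sum {F : V → V → ℝ} (hF : ∀ u v, ¬ D.Adj u v → F u v = 0) (u : V) :
    D.outflow F u = ∑ v, F u v := by
  rw [outflow_eq]
  refine Finset.sum_subset (Finset.subset_univ _) fun v _ hv => hF u v ?_
  simpa using hv

theorem inflow_eq_sum {F : V → V → ℝ} (hF : ∀ u v, ¬ D.Adj u v → F u v = 0) (v : V) :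
    D.inflow F v = ∑ u, F u v := by
  rw [inflow]
  refine Finset.sum_subset (Finset.subset_univ _) fun u _ hu => hF u v ?_
  simpa using hu

theorem outflow_sink (F : V → V → ℝ) (x : X) : D.outflow F (D.sink x) = 0 := by
  simp [outflow_eq]

theorem inflow_root (F : V → V → ℝ) : D.inflow F D.root = 0 := by
  rw [inflow]
  refine Finset.sum_eq_zero fun u hu => ?_
  exact absurd (by simpa using hu) (D.not_adj_root u)

/-- The expected total reward of a particle that moves along arcs with probabilities `q`, collects
`h u` at every inner vertex `u` that it visits and `b x` at the sink `x` where it ends. -/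
def value (q : V → V → ℝ) (h : V → ℝ) (b : X → ℝ) : V → ℝ :=
  D.recurse b fun u Y => h u + ∑ v ∈ D.succs u, q u v * Y v

variable {D} {q : V → V → ℝ} {h : V → ℝ} {b : X → ℝ}

@[simp]
theorem value_sink (x : X) : D.value q h b (D.sink x) = b x := D.recurse_sink _ _ x

theorem value_step {u : V} (hu : u ∉ Set.range D.sink) :
    D.value q h b u = h u + ∑ v ∈ D.succs u, q u v * D.value q h b v := by
  rw [value, D.recurse_of_not_sink _ _ hu]
  congr 1
  refine Finset.sum_congr rfl fun v hv => ?_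
  simp only [if_pos (D.mem_succs.1 hv)]

/-- Used to recognize functions given by the one-step equation, such as the `chat` in `IsVelocity`,
as values. -/
theorem value_unique {Y : V → ℝ} (hb : ∀ x, Y (D.sink x) = b x)
    (hY : ∀ u, u ∉ Set.range D.sink → Y u = h u + ∑ v ∈ D.succs u, q u v * Y v) (u : V) :
    Y u = D.value q h b u := by
  induction u using D.sink_induction with
  | sink x => rw [hb, value_sink]
  | step u hu ih =>
    rw [hY u hu, value_step hu]
    congr 1
    exact Finset.sum_congr rfl fun v hv => by rw [ih v (D.mem_succs.1 hv)]

theorem value_mono (hq : ∀ u v, 0 ≤ q u v) {h' : V → ℝ} {b' : X → ℝ}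
    (hh : ∀ u, u ∉ Set.range D.sink → h u ≤ h' u) (hb : ∀ x, b x ≤ b' x) (u : V) :
    D.value q h b u ≤ D.value q h' b' u := by
  induction u using D.sink_induction with
  | sink x => simpa using hb x
  | step u hu ih =>
    rw [value_step hu, value_step hu]
    gcongr with v hv
    · exact hh u hu
    · exact hq u v
    · exact ih v (D.mem_succs.1 hv)

/-- Comparison principle: a supersolution of the one-step equation dominates the value. The bounds
on the potential and on the `η`-weighted cost are obtained by exhibiting one. -/
theorem value_le_of_superharmonic (hq : ∀ u v, 0 ≤ q u v) {Y : V → ℝ}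
    (hb : ∀ x, b x ≤ Y (D.sink x))
    (hY : ∀ u, u ∉ Set.range D.sink → h u + ∑ v ∈ D.succs u, q u v * Y v ≤ Y u) (u : V) :
    D.value q h b u ≤ Y u := by
  induction u using D.sink_induction with
  | sink x => simpa using hb x
  | step u hu ih =>
    rw [value_step hu]
    refine le_trans ?_ (hY u hu)
    gcongr with v hv
    · exact hq u v
    · exact ih v (D.mem_succs.1 hv)

theorem value_nonneg (hq : ∀ u v, 0 ≤ q u v) (hh : ∀ u, u ∉ Set.range D.sink → 0 ≤ h u)
    (hb : ∀ x, 0 ≤ b x) (u : V) : 0 ≤ D.value q h b u := by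
  induction u using D.sink_induction with
  | sink x => simpa using hb x
  | step u hu ih =>
    rw [value_step hu]
    exact add_nonneg (hh u hu) (Finset.sum_nonneg fun v hv =>
      mul_nonneg (hq u v) (ih v (D.mem_succs.1 hv)))

theorem value_combine (s r : ℝ) (h' : V → ℝ) (b' : X → ℝ) (u : V) :
    D.value q (fun u => s * h u + r * h' u) (fun x => s * b x + r * b' x) u =
      s * D.value q h b u + r * D.value q h' b' u := by
  symm
  refine value_unique (Y := fun u => s * D.value q h b u + r * D.value q h' b' u)
    (fun x => by simp) (fun u hu => ?_) u
  rw [value_step hu, value_step (h := h') hu, mul_add, mul_add, Finset.mul_sum, Finset.mul_sum,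
    add_add_add_comm, ← Finset.sum_add_distrib]
  congr 1
  exact Finset.sum_congr rfl fun v _ => by ring

/-- By the product rule the derivative is again a value: each visited vertex contributes the change
of its own reward and the effect of the changing split on the values of its children. -/
theorem value_hasDerivAt {q : ℝ → V → V → ℝ} {q' : V → V → ℝ} {h : ℝ → V → ℝ} {h' : V → ℝ}
    {b : X → ℝ} {t : ℝ} (hq : ∀ u v, HasDerivAt (fun s => q s u v) (q' u v) t)
    (hh : ∀ u, u ∉ Set.range D.sink → HasDerivAt (fun s => h s u) (h' u) t) (u : V) :
    HasDerivAt (fun s => D.value (q s) (h s) b u)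
      (D.value (q t) (fun u => h' u + ∑ v ∈ D.succs u, q' u v * D.value (q t) (h t) b v) 0 u)
      t := by
  induction u using D.sink_induction with
  | sink x => simpa using hasDerivAt_const t (b x)
  | step u hu ih =>
    simp_rw [value_step hu]
    rw [add_assoc, ← Finset.sum_add_distrib]
    refine (hh u hu).add (HasDerivAt.fun_sum fun v hv => ?_)
    exact (hq u v).mul (ih v (D.mem_succs.1 hv))

theorem value_continuousAt {α : Type*} [TopologicalSpace α] {q : α → V → V → ℝ} {h : α → V → ℝ}
    {b : X → ℝ} {t : α} (hq : ∀ u v, ContinuousAt (fun s => q s u v) t)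
    (hh : ∀ u, ContinuousAt (fun s => h s u) t) (u : V) :
    ContinuousAt (fun s => D.value (q s) (h s) b u) t := by
  induction u using D.sink_induction with
  | sink x => simpa using continuousAt_const
  | step u hu ih =>
    simp_rw [value_step hu]
    exact (hh u).add (tendsto_finsetSum _ fun v hv => (hq u v).mul (ih v (D.mem_succs.1 hv)))

end DAGOver

/-! ## Absolutely continuous functions -/

theorem absolutelyContinuousOnInterval_const (c a b : ℝ) :
    AbsolutelyContinuousOnInterval (fun _ => c) a b :=
  (LipschitzWith.const c).lipschitzOnWith.absolutelyContinuousOnInterval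

theorem absolutelyContinuousOnInterval_sum {ι : Type*} (s : Finset ι) {f : ι → ℝ → ℝ} {a b : ℝ}
    (hf : ∀ i ∈ s, AbsolutelyContinuousOnInterval (f i) a b) :
    AbsolutelyContinuousOnInterval (fun t => ∑ i ∈ s, f i t) a b := by
  induction s using Finset.induction_on with
  | empty => simpa using absolutelyContinuousOnInterval_const 0 a b
  | insert i s hi ih =>
    simp_rw [Finset.sum_insert hi]
    exact (hf i (by simp)).add (ih fun j hj => hf j (by simp [hj]))

theorem _root_.LipschitzOnWith.comp_absolutelyContinuousOnInterval {g f : ℝ → ℝ} {K : ℝ≥0}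
    {s : Set ℝ} {a b : ℝ} (hg : LipschitzOnWith K g s) (hf : AbsolutelyContinuousOnInterval f a b)
    (hs : Set.MapsTo f (Set.uIcc a b) s) :
    AbsolutelyContinuousOnInterval (fun t => g (f t)) a b := by
  rw [absolutelyContinuousOnInterval_iff] at hf ⊢
  intro e he
  -- `K + 1` in place of `K` covers the case `K = 0`.
  obtain ⟨d, hd, h⟩ := hf (e / (K + 1)) (by positivity)
  refine ⟨d, hd, fun E hE hl => ?_⟩
  have h1 := h E hE hl
  calc ∑ i ∈ Finset.range E.1, dist (g (f (E.2 i).1)) (g (f (E.2 i).2))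
      ≤ ∑ i ∈ Finset.range E.1, (K + 1) * dist (f (E.2 i).1) (f (E.2 i).2) := by
        refine Finset.sum_le_sum fun i hi => ?_
        refine (hg.dist_le_mul _ (hs (hE.1 i hi).1) _ (hs (hE.1 i hi).2)).trans ?_
        gcongr
        linarith
    _ = (K + 1) * ∑ i ∈ Finset.range E.1, dist (f (E.2 i).1) (f (E.2 i).2) :=
        (Finset.mul_sum _ _ _).symm
    _ < (K + 1) * (e / (K + 1)) := by gcongr
    _ = e := by field_simp

/-- The increment of an absolutely continuous function with a.e. bounded derivative. -/
theorem _root_.AbsolutelyContinuousOnInterval.sub_le_of_ae_le {f f' : ℝ → ℝ} {a b m : ℝ}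
    (hab : a ≤ b) (hf : AbsolutelyContinuousOnInterval f a b)
    (h : ∀ᵐ t, t ∈ Set.Ioo a b → HasDerivAt f (f' t) t ∧ f' t ≤ m) :
    f b - f a ≤ m * (b - a) := by
  rw [← hf.integral_deriv_eq_sub]
  have h1 : ∫ t in a..b, deriv f t ≤ ∫ _ in a..b, m := by
    refine intervalIntegral.integral_mono_ae_restrict hab hf.intervalIntegrable_deriv
      intervalIntegrable_const ?_
    rw [← Measure.restrict_congr_set Ioo_ae_eq_Icc]
    rw [Filter.EventuallyLE, ae_restrict_iff' measurableSet_Ioo]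
    filter_upwards [h] with t ht hm
    rw [(ht hm).1.deriv]
    exact (ht hm).2
  refine h1.trans ?_
  simp [mul_comm]

namespace DAGOver

variable {X V : Type*} {D : DAGOver X V} [Fintype V]

theorem value_absolutelyContinuous {q : ℝ → V → V → ℝ} {h : ℝ → V → ℝ} {b : X → ℝ} {t₀ t₁ : ℝ}
    (hq : ∀ u v, AbsolutelyContinuousOnInterval (fun s => q s u v) t₀ t₁)
    (hh : ∀ u, AbsolutelyContinuousOnInterval (fun s => h s u) t₀ t₁) (u : V) :
    AbsolutelyContinuousOnInterval (fun s => D.value (q s) (h s) b u) t₀ t₁ := by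
  induction u using D.sink_induction with
  | sink x => simpa using absolutelyContinuousOnInterval_const (b x) t₀ t₁
  | step u hu ih =>
    simp_rw [value_step hu]
    exact (hh u).add (absolutelyContinuousOnInterval_sum _ fun v hv =>
      (hq u v).mul (ih v (D.mem_succs.1 hv)))

end DAGOver

/-! ## Paths and flows -/

/-- The sum of the weights `G` over the consecutive pairs of a list. -/
def pathSum {V : Type*} (G : V → V → ℝ) : List V → ℝ
  | u :: v :: l => G u v + pathSum G (v :: l)
  | _ => 0

@[simp]
theorem pathSum_nil {V : Type*} (G : V → V → ℝ) : pathSum G [] = 0 := by simp [pathSum]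

@[simp]
theorem pathSum_singleton {V : Type*} (G : V → V → ℝ) (u : V) : pathSum G [u] = 0 := by
  simp [pathSum]

@[simp]
theorem pathSum_cons_cons {V : Type*} (G : V → V → ℝ) (u v : V) (l : List V) :
    pathSum G (u :: v :: l) = G u v + pathSum G (v :: l) := by rw [pathSum]

theorem sum_map_zip_tail {V : Type*} (G : V → V → ℝ) (l : List V) :
    ((l.zip l.tail).map fun e => G e.1 e.2).sum = pathSum G l := by
  induction l with
  | nil => simp
  | cons u l ih =>
    cases l with
    | nil => simp
    | cons v l => simpa using ih

theorem pathSum_sub {V : Type*} (R : V → ℝ) (l : List V) (u w : V)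
    (hu : l.head? = some u) (hw : l.getLast? = some w) :
    pathSum (fun u v => R u - R v) l = R u - R w := by
  induction l generalizing u with
  | nil => simp at hu
  | cons a l ih =>
    cases l with
    | nil => simp_all
    | cons b l =>
      rw [pathSum_cons_cons, ih b (by simp) (by simpa using hw)]
      simp at hu
      rw [hu]
      ring

/-- The sum of the products of two vectors indexed by pairs of vertices. -/
def pairing {V : Type*} [Fintype V] (G F : V → V → ℝ) : ℝ := ∑ u, ∑ v, G u v * F u v

namespace DAGOver

variable {X V : Type*} {D : DAGOver X V}

namespace RootPath

theorem sum_map_arcs (γ : D.RootPath) (G : V → V → ℝ) :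
    (γ.arcs.map fun e => G e.1 e.2).sum = pathSum G γ.verts := sum_map_zip_tail G γ.verts

theorem nodup_arcs (γ : D.RootPath) : γ.arcs.Nodup := by
  refine List.Nodup.of_map Prod.snd ?_
  rw [arcs, List.map_snd_zip (by simp)]
  exact γ.nodup.tail

theorem pathSum_eq_sum [Fintype V] (γ : D.RootPath) (G : V → V → ℝ) :
    pathSum G γ.verts = ∑ u, ∑ v, if (u, v) ∈ γ.arcs then G u v else 0 := by
  rw [← sum_map_arcs, ← List.sum_toFinset _ γ.nodup_arcs]
  have h := Finset.sum_product' Finset.univ Finset.univ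
    (fun u v => if (u, v) ∈ γ.arcs then G u v else 0)
  rw [← h, Finset.univ_product_univ, ← Finset.sum_filter]
  refine Finset.sum_congr ?_ fun _ _ => rfl
  ext e
  simp

theorem pathSum_sub (γ : D.RootPath) (R : V → ℝ) :
    pathSum (fun u v => R u - R v) γ.verts = R D.root - R (D.sink γ.endpoint) :=
  MTS.pathSum_sub R _ _ _ γ.head_eq γ.last_eq

theorem adj_of_mem_arcs (γ : D.RootPath) {u v : V} (h : (u, v) ∈ γ.arcs) : D.Adj u v := by
  have key : ∀ l : List V, l.IsChain D.Adj → (u, v) ∈ l.zip l.tail → D.Adj u v := by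
    intro l
    induction l with
    | nil => simp
    | cons a l ih =>
      cases l with
      | nil => simp
      | cons b l =>
        intro hc hm
        rw [List.isChain_cons_cons] at hc
        simp only [List.tail_cons, List.zip_cons_cons, List.mem_cons, Prod.mk.injEq] at hm
        rcases hm with ⟨rfl, rfl⟩ | hm
        · exact hc.1
        · exact ih hc.2 (by simpa using hm)
  exact key _ γ.isChain h

end RootPath

variable [Fintype V]

variable (D) in
/-- Longest paths: a potential that certifies the maximal weight of a path. -/
theorem exists_longest_path (G : V → V → ℝ) : ∃ R : V → ℝ, (∀ x, R (D.sink x) = 0) ∧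
    (∀ u v, D.Adj u v → G u v + R v ≤ R u) ∧
    ∀ u, ∃ (l : List V) (x : X), l.IsChain D.Adj ∧ l.head? = some u ∧
      l.getLast? = some (D.sink x) ∧ pathSum G l = R u := by
  let op : V → (V → ℝ) → ℝ := fun u Y =>
    if h : (D.succs u).Nonempty then (D.succs u).sup' h fun v => G u v + Y v else 0
  have hs : ∀ u (hu : u ∉ Set.range D.sink), (D.succs u).Nonempty := fun u hu => by
    obtain ⟨v, hv⟩ := D.exists_adj hu
    exact ⟨v, by simpa using hv⟩
  have hstep : ∀ u (hu : u ∉ Set.range D.sink), D.recurse 0 op u =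
      (D.succs u).sup' (hs u hu) fun v => G u v + D.recurse 0 op v := fun u hu => by
    rw [D.recurse_of_not_sink _ _ hu]
    simp only [op, dif_pos (hs u hu)]
    refine Finset.sup'_congr _ rfl fun v hv => ?_
    rw [if_pos (D.mem_succs.1 hv)]
  refine ⟨D.recurse 0 op, fun x => D.recurse_sink _ _ x, fun u v huv => ?_, fun u => ?_⟩
  · rw [hstep u (D.not_sink_of_adj huv)]
    exact Finset.le_sup' (fun v => G u v + D.recurse 0 op v) (by simpa using huv)
  · induction u using D.sink_induction with
    | sink x => exact ⟨[D.sink x], x, by simp, by simp, by simp, by simp [D.recurse_sink]⟩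
    | step u hu ih =>
      obtain ⟨v, hv, he⟩ := Finset.exists_mem_eq_sup' (hs u hu) fun v => G u v + D.recurse 0 op v
      obtain ⟨l, x, hc, hh, hl, hsum⟩ := ih v (D.mem_succs.1 hv)
      obtain ⟨l, rfl⟩ : ∃ l', l = v :: l' := by
        cases l with
        | nil => simp at hh
        | cons a l => simp at hh; exact ⟨l, by rw [hh]⟩
      refine ⟨u :: v :: l, x, ?_, by simp, by simpa using hl, ?_⟩
      · exact List.isChain_cons_cons.2 ⟨D.mem_succs.1 hv, hc⟩
      · rw [pathSum_cons_cons, hsum, hstep u hu, he]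

theorem exists_rootPath_pathSum (G : V → V → ℝ) : ∃ R : V → ℝ, (∀ x, R (D.sink x) = 0) ∧
    (∀ u v, D.Adj u v → G u v + R v ≤ R u) ∧
    ∃ γ : D.RootPath, pathSum G γ.verts = R D.root := by
  obtain ⟨R, h1, h2, h3⟩ := D.exists_longest_path G
  obtain ⟨l, x, hc, hh, hl, hs⟩ := h3 D.root
  exact ⟨R, h1, h2, ⟨l, x, hc, hh, hl⟩, hs⟩

/-! ### Unit flows -/

namespace IsUnitFlow

variable {F : V → V → ℝ}

theorem root_not_sink (hF : D.IsUnitFlow F) : D.root ∉ Set.range D.sink := by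
  rintro ⟨x, hx⟩
  have := hF.unit
  rw [← hx, outflow_sink] at this
  exact zero_ne_one this

/-- Summation by parts. -/
theorem pairing_sub [Fintype X] (hF : D.IsUnitFlow F) (R : V → ℝ) :
    pairing (fun u v => R u - R v) F =
      R D.root - ∑ x, R (D.sink x) * D.inflow F (D.sink x) := by
  have h1 : pairing (fun u v => R u - R v) F =
      ∑ u, R u * (D.outflow F u - D.inflow F u) := by
    simp_rw [pairing, sub_mul, mul_sub, Finset.sum_sub_distrib]
    congr 1
    · simp_rw [D.outflow_eq_sum hF.support, Finset.mul_sum]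
    · rw [Finset.sum_comm]
      simp_rw [D.inflow_eq_sum hF.support, Finset.mul_sum]
  have h2 : ∀ u, R u * (D.outflow F u - D.inflow F u) = (if u = D.root then R u else 0) -
      if u ∈ Finset.univ.map D.sink then R u * D.inflow F u else 0 := by
    intro u
    by_cases hu : u = D.root
    · have hr : D.root ∉ Finset.univ.map D.sink := by
        simpa using hF.root_not_sink
      rw [hu, if_pos rfl, if_neg hr, hF.unit, D.inflow_root]
      ring
    · rw [if_neg hu]
      by_cases hs : u ∈ Set.range D.sink
      · obtain ⟨x, rfl⟩ := hs
        rw [D.outflow_sink, if_pos (by simp)]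
        ring
      · rw [if_neg (by simpa using hs), hF.conservation u hs hu]
        ring
  rw [h1]
  simp_rw [h2]
  rw [Finset.sum_sub_distrib]
  congr 1
  · simp
  · rw [Finset.sum_ite_mem, Finset.univ_inter, Finset.sum_map]

theorem sum_inflow_sink [Fintype X] (hF : D.IsUnitFlow F) :
    ∑ x, D.inflow F (D.sink x) = 1 := by
  have h := hF.pairing_sub fun _ => 1
  simp [pairing] at h
  linarith

theorem inflow_nonneg (hF : D.IsUnitFlow F) (v : V) : 0 ≤ D.inflow F v :=
  Finset.sum_nonneg fun u _ => hF.nonneg u v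

theorem outflow_nonneg (hF : D.IsUnitFlow F) (v : V) : 0 ≤ D.outflow F v :=
  Finset.sum_nonneg fun u _ => hF.nonneg v u

theorem le_outflow (hF : D.IsUnitFlow F) (u v : V) : F u v ≤ D.outflow F u := by
  rw [D.outflow_eq_sum hF.support]
  exact Finset.single_le_sum (fun v _ => hF.nonneg u v) (Finset.mem_univ v)

end IsUnitFlow

/-- The inflows of the sinks are nonnegative and add up to 1, so every sink other than `x` receives
nothing. -/
theorem IsUnitFlowTo.pairing_sub [Fintype X] {F : V → V → ℝ} {x : X} (hF : D.IsUnitFlowTo F x)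
    (R : V → ℝ) : pairing (fun u v => R u - R v) F = R D.root - R (D.sink x) := by
  have h0 : ∀ y, y ≠ x → D.inflow F (D.sink y) = 0 := by
    have h := hF.1.sum_inflow_sink
    rw [← Finset.add_sum_erase _ _ (Finset.mem_univ x), hF.2] at h
    have h1 : ∑ y ∈ Finset.univ.erase x, D.inflow F (D.sink y) = 0 := by linarith
    intro y hy
    exact (Finset.sum_eq_zero_iff_of_nonneg fun y _ => hF.1.inflow_nonneg _).1 h1 y (by simp [hy])
  rw [hF.1.pairing_sub, Finset.sum_eq_single x (fun y _ hy => by simp [h0 y hy]) (by simp), hF.2,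
    mul_one]

theorem IsTransition.sum_succs {q : V → V → ℝ} (hq : D.IsTransition q) {u : V}
    (hu : u ∉ Set.range D.sink) : ∑ v ∈ D.succs u, q u v = 1 := hq.sum_eq_one u hu

/-- The value is harmonic for `q`, so its differences along arcs pair to zero with the induced flow,
and summation by parts leaves only the boundary terms. This turns expectations under the played
distribution into values at the root. -/
theorem IsInducedFlow.sum_mul_inflow [Fintype X] {q F : V → V → ℝ} (hF : D.IsInducedFlow q F)
    (f : X → ℝ) : ∑ x, f x * D.inflow F (D.sink x) = D.value q 0 f D.root := by
  have h := hF.1.pairing_sub (D.value q 0 f)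
  have h0 : pairing (fun u v => D.value q 0 f u - D.value q 0 f v) F = 0 := by
    simp_rw [pairing]
    refine Finset.sum_eq_zero fun u _ => ?_
    by_cases hu : u ∈ Set.range D.sink
    · obtain ⟨x, rfl⟩ := hu
      exact Finset.sum_eq_zero fun v _ => by rw [hF.1.support _ _ (D.not_adj_sink x v), mul_zero]
    · have h1 : ∀ v, (D.value q 0 f u - D.value q 0 f v) * F u v =
          D.value q 0 f u * F u v - D.value q 0 f v * F u v := fun v => by ring
      simp_rw [h1]
      rw [Finset.sum_sub_distrib, ← Finset.mul_sum, ← D.outflow_eq_sum hF.1.support,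
        value_step hu, Pi.zero_apply, zero_add, sub_eq_zero]
      rw [← Finset.sum_subset (Finset.subset_univ (D.succs u)), Finset.sum_mul]
      · refine Finset.sum_congr rfl fun v hv => ?_
        rw [hF.2 u v (D.mem_succs.1 hv)]
        ring
      · intro v _ hv
        rw [hF.1.support u v (by simpa using hv), mul_zero]
  simp_rw [value_sink] at h
  linarith

/-- Every transition induces a unit flow. -/
theorem IsTransition.exists_isInducedFlow [Nontrivial X] {q : V → V → ℝ} (hq : D.IsTransition q) :
    ∃ F, D.IsInducedFlow q F := by
  let m : V → ℝ := D.wellFounded_parent.fix fun v ih =>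
    if v = D.root then 1 else ∑ u, if h : D.Adj u v then ih u h * q u v else 0
  have hm : ∀ v, m v = if v = D.root then 1 else ∑ u, if D.Adj u v then m u * q u v else 0 := by
    intro v
    simp only [m]
    rw [WellFounded.fix_eq]
    rfl
  have hm0 : ∀ v, 0 ≤ m v := fun v => by
    refine D.wellFounded_parent.induction (C := fun v => 0 ≤ m v) v fun v ih => ?_
    rw [hm v]
    split_ifs
    · exact zero_le_one
    · refine Finset.sum_nonneg fun u _ => ?_
      split_ifs with h
      · exact mul_nonneg (ih u h) (hq.nonneg u v)
      · exact le_rfl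
  have hs : ∀ u v, ¬ D.Adj u v → m u * q u v = 0 := fun u v h => by rw [hq.support u v h, mul_zero]
  have hout : ∀ u, u ∉ Set.range D.sink → D.outflow (fun u v => m u * q u v) u = m u := by
    intro u hu
    rw [outflow_eq, ← Finset.mul_sum, hq.sum_succs hu, mul_one]
  refine ⟨fun u v => m u * q u v, ⟨hs, fun u v => mul_nonneg (hm0 u) (hq.nonneg u v), ?_, ?_⟩, ?_⟩
  · intro u hu hr
    rw [hout u hu, D.inflow_eq_sum hs, hm u, if_neg hr]
    refine Finset.sum_congr rfl fun w _ => ?_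
    split_ifs with h
    · rfl
    · rw [hs w u h]
  · rw [hout _ D.root_not_sink, hm, if_pos rfl]
  · intro u v h
    rw [hout u (D.not_sink_of_adj h)]

/-! ### Decompositions into paths -/

namespace IsPathDecomposition

variable {χ : D.RootPath → ℝ} {F : V → V → ℝ}

theorem pairing_eq (h : D.IsPathDecomposition χ F) (G : V → V → ℝ) :
    pairing G F = ∑ γ, χ γ * pathSum G γ.verts := by
  simp_rw [RootPath.pathSum_eq_sum, pairing, h.2, Finset.mul_sum]
  rw [Finset.sum_comm (s := (Finset.univ : Finset D.RootPath))]
  refine Finset.sum_congr rfl fun u _ => ?_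
  rw [Finset.sum_comm]
  refine Finset.sum_congr rfl fun γ _ => Finset.sum_congr rfl fun v _ => ?_
  split_ifs <;> ring

theorem sum_eq_one [Fintype X] (h : D.IsPathDecomposition χ F) (hF : D.IsUnitFlow F) :
    ∑ γ, χ γ = 1 := by
  -- These weights telescope to 1 along every path from the root to a sink.
  have h1 := h.pairing_eq fun u v => (if u = D.root then 1 else 0) - if v = D.root then 1 else 0
  rw [hF.pairing_sub fun u => if u = D.root then 1 else 0] at h1
  simp_rw [RootPath.pathSum_sub _ fun u => if u = D.root then (1 : ℝ) else 0] at h1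
  have h2 : ∀ x, D.sink x ≠ D.root := fun x hx => hF.root_not_sink ⟨x, hx⟩
  simpa [h2] using h1.symm

end IsPathDecomposition

/-- The flow lies in the convex hull of the path indicators: otherwise a linear functional would be
larger at `F` than at every path, but the potential of the longest path shows that no unit flow
exceeds the weight of that path. -/
theorem IsUnitFlow.exists_isPathDecomposition [Fintype X] {F : V → V → ℝ} (hF : D.IsUnitFlow F) :
    ∃ χ, D.IsPathDecomposition χ F := by
  let I : D.RootPath → V → V → ℝ := fun γ u v => if (u, v) ∈ γ.arcs then 1 else 0
  let T : (D.RootPath → ℝ) →ₗ[ℝ] V → V → ℝ := ∑ γ, (LinearMap.proj γ).smulRight (I γ)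
  have hT : ∀ χ, T χ = ∑ γ, χ γ • I γ := fun χ => by simp [T]
  have hmem : F ∈ T '' stdSimplex ℝ D.RootPath := by
    by_contra hn
    have hc : IsClosed (T '' stdSimplex ℝ D.RootPath) :=
      ((isCompact_stdSimplex ℝ D.RootPath).image T.continuous_of_finiteDimensional).isClosed
    obtain ⟨f, s, h1, h2⟩ := geometric_hahn_banach_closed_point
      ((convex_stdSimplex ℝ D.RootPath).linear_image T) hc hn
    let G : V → V → ℝ := fun u v => f (Pi.single u (Pi.single v 1))
    have hf : ∀ E : V → V → ℝ, f E = pairing G E := by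
      intro E
      have : E = ∑ u, ∑ v, E u v • Pi.single u (Pi.single v 1) := by
        ext a b
        simp [Finset.sum_apply, Pi.single_apply, Finset.sum_ite_eq, apply_ite,
          ite_apply]
      conv_lhs => rw [this]
      simp [map_sum, pairing, G, mul_comm]
    obtain ⟨R, hR0, hR, γ, hγ⟩ := D.exists_rootPath_pathSum G
    have h3 : f (I γ) = R D.root := by
      rw [hf, ← hγ, γ.pathSum_eq_sum]
      simp [pairing, I]
    have h4 : f F ≤ R D.root := by
      have := hF.pairing_sub R
      simp only [hR0, zero_mul, Finset.sum_const_zero, sub_zero] at this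
      rw [hf, ← this]
      refine Finset.sum_le_sum fun u _ => Finset.sum_le_sum fun v _ => ?_
      by_cases huv : D.Adj u v
      · exact mul_le_mul_of_nonneg_right (by linarith [hR u v huv]) (hF.nonneg u v)
      · rw [hF.support u v huv, mul_zero, mul_zero]
    have h5 := h1 (I γ) ⟨Pi.single γ 1, single_mem_stdSimplex ℝ γ, by
      rw [hT, Finset.sum_eq_single γ] <;> simp +contextual⟩
    linarith
  obtain ⟨χ, hχ, rfl⟩ := hmem
  refine ⟨χ, hχ.1, fun u v => ?_⟩
  simp [hT, I, Finset.sum_apply]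

end DAGOver

namespace MarkedDAG

variable {X V : Type*} [Fintype V] {M : MarkedDAG X V}

/-- Duality for the transportation distance of flows. -/
theorem pairing_sub_le_flowDist [Fintype X] {F F' G : V → V → ℝ} {K : ℝ} (hK : 0 < K)
    (hF : M.IsUnitFlow F) (hF' : M.IsUnitFlow F')
    (hG : ∀ γ γ' : M.RootPath, pathSum G γ'.verts - pathSum G γ.verts ≤ K * M.pathDist γ γ') :
    pairing G F' - pairing G F ≤ K * M.flowDist F F' := by
  rw [← div_le_iff₀' hK]
  obtain ⟨χ, hχ⟩ := hF.exists_isPathDecomposition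
  obtain ⟨χ', hχ'⟩ := hF'.exists_isPathDecomposition
  refine le_csInf ⟨_, χ, χ', hχ, hχ', rfl⟩ ?_
  rintro s ⟨χ, χ', hχ, hχ', rfl⟩
  -- The product coupling only shows that the infimum is over a nonempty set.
  refine le_csInf ⟨_, fun γ γ' => χ γ * χ' γ', fun γ γ' => mul_nonneg (hχ.1 γ) (hχ'.1 γ'),
    fun γ => ?_, fun γ' => ?_, rfl⟩ ?_
  · rw [← Finset.mul_sum, hχ'.sum_eq_one hF', mul_one]
  · rw [← Finset.sum_mul, hχ.sum_eq_one hF, one_mul]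
  rintro s ⟨π, h0, h1, h2, rfl⟩
  rw [div_le_iff₀' hK, hχ.pairing_eq, hχ'.pairing_eq]
  simp_rw [← h1, ← h2, Finset.sum_mul]
  rw [Finset.sum_comm (f := fun γ' γ => π γ γ' * pathSum G γ'.verts), ← Finset.sum_sub_distrib,
    Finset.mul_sum]
  refine Finset.sum_le_sum fun γ _ => ?_
  rw [← Finset.sum_sub_distrib, Finset.mul_sum]
  refine Finset.sum_le_sum fun γ' _ => ?_
  have := mul_le_mul_of_nonneg_left (hG γ γ') (h0 γ γ')
  linarith

end MarkedDAG

/-! ## Kantorovich duality -/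

theorem clm_apply_eq_sum {X : Type*} [Fintype X] (f : (X → ℝ) →L[ℝ] ℝ) (a : X → ℝ) :
    f a = ∑ x, f (Pi.single x 1) * a x := by
  have : a = ∑ x, a x • Pi.single x 1 := by
    ext b
    simp [Finset.sum_apply, Pi.single_apply]
  conv_lhs => rw [this]
  simp [map_sum, mul_comm]

section Duality

variable {X : Type*} [Fintype X] [MetricSpace X] {μ ν : X → ℝ}

theorem transportCost_nonneg : 0 ≤ transportCost (dist : X → X → ℝ) μ ν := by
  refine Real.sInf_nonneg ?_
  rintro s ⟨π, h0, -, -, rfl⟩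
  exact Finset.sum_nonneg fun x _ => Finset.sum_nonneg fun y _ => mul_nonneg (h0 x y) dist_nonneg

/-- The marginals and the cost of a coupling, as a linear map. -/
def couplingMap (X : Type*) [Fintype X] [MetricSpace X] :
    (X × X → ℝ) →ₗ[ℝ] (X → ℝ) × (X → ℝ) × ℝ where
  toFun π := (fun x => ∑ y, π (x, y), fun y => ∑ x, π (x, y), ∑ x, ∑ y, π (x, y) * dist x y)
  map_add' π π' := by
    ext <;> simp [Finset.sum_add_distrib, add_mul]
  map_smul' c π := by
    ext <;> simp [Finset.mul_sum, mul_assoc]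

/-- At these vertices of the simplex of couplings, a separating functional yields the constraints of
the dual problem. -/
theorem couplingMap_single (x y : X) :
    couplingMap X (Pi.single (x, y) 1) = (Pi.single x 1, Pi.single y 1, dist x y) := by
  have h : ∀ a b, (Pi.single (x, y) 1 : X × X → ℝ) (a, b) =
      (if a = x then 1 else 0) * (if b = y then 1 else 0) := fun a b => by
    simp only [Pi.single_apply, Prod.mk.injEq]
    split_ifs <;> simp_all
  simp only [couplingMap, LinearMap.coe_mk, AddHom.coe_mk, h, Prod.mk.injEq]
  refine ⟨?_, ?_, ?_⟩
  · ext a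
    simp [Pi.single_apply]
  · ext a
    simp [Pi.single_apply]
  · simp

/-- A pair of dual potentials can be improved to a single Lipschitz potential. -/
theorem exists_lipschitz_potential [Nonempty X] {φ ψ : X → ℝ} {l : ℝ} (hl : 0 ≤ l)
    (h : ∀ x y, φ x + ψ y ≤ l * dist x y) :
    ∃ f : X → ℝ, (∀ x y, f x - f y ≤ l * dist x y) ∧ ∀ x, φ x ≤ f x ∧ f x ≤ -ψ x := by
  -- The infimal convolution of `-ψ` with `l * dist`.
  refine ⟨fun x => Finset.univ.inf' Finset.univ_nonempty fun y => l * dist x y - ψ y,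
    fun x y => ?_, fun x => ⟨?_, ?_⟩⟩
  · obtain ⟨z, -, hz⟩ := Finset.exists_mem_eq_inf' (s := (Finset.univ : Finset X))
      Finset.univ_nonempty fun z => l * dist y z - ψ z
    have h1 := Finset.inf'_le (fun z => l * dist x z - ψ z) (Finset.mem_univ z)
    have h2 := mul_le_mul_of_nonneg_left (dist_triangle x y z) hl
    dsimp only
    rw [hz]
    linarith
  · refine Finset.le_inf' _ _ fun y _ => ?_
    linarith [h x y]
  · refine (Finset.inf'_le _ (Finset.mem_univ x)).trans ?_
    simp

/-- Kantorovich duality: an upper bound on the transportation cost from Lipschitz functions. -/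
theorem transportCost_le_of_lipschitz [Nonempty X] (hμ : μ ∈ stdSimplex ℝ X)
    (hν : ν ∈ stdSimplex ℝ X) {B : ℝ}
    (h : ∀ f : X → ℝ, (∀ x y, f x - f y ≤ dist x y) → ∑ x, f x * μ x - ∑ x, f x * ν x ≤ B) :
    transportCost (dist : X → X → ℝ) μ ν ≤ B := by
  by_contra! hB
  -- If the bound failed, the marginals and costs of couplings would miss the closed set of triples
  -- with marginals `μ`, `ν` and cost at most `B`. A functional separating the two gives dual
  -- potentials that violate `h`.
  have hdisj : Disjoint (couplingMap X '' stdSimplex ℝ (X × X))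
      ({μ} ×ˢ {ν} ×ˢ Set.Iic B) := by
    rw [Set.disjoint_left]
    rintro _ ⟨π, hπ, rfl⟩ ⟨h1, h2, h3⟩
    refine absurd hB (not_lt.2 (le_trans ?_ h3))
    refine csInf_le ⟨0, ?_⟩ ⟨fun x y => π (x, y), fun x y => hπ.1 _, ?_, ?_, rfl⟩
    · rintro s ⟨π, h0, -, -, rfl⟩
      exact Finset.sum_nonneg fun x _ => Finset.sum_nonneg fun y _ =>
        mul_nonneg (h0 x y) dist_nonneg
    · exact fun x => congrFun h1 x
    · exact fun y => congrFun h2 y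
  obtain ⟨F, u, v, h1, huv, h2⟩ := geometric_hahn_banach_compact_closed
    ((convex_stdSimplex ℝ (X × X)).linear_image (couplingMap X))
    ((isCompact_stdSimplex ℝ (X × X)).image
      (couplingMap X).continuous_of_finiteDimensional)
    ((convex_singleton μ).prod ((convex_singleton ν).prod (convex_Iic B)))
    (isClosed_singleton.prod (isClosed_singleton.prod isClosed_Iic)) hdisj
  let F₁ : (X → ℝ) →L[ℝ] ℝ := F.comp (ContinuousLinearMap.inl ℝ _ _)
  let F₂ : (X → ℝ) →L[ℝ] ℝ := F.comp ((ContinuousLinearMap.inr ℝ _ _).comp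
    (ContinuousLinearMap.inl ℝ _ _))
  let l : ℝ := -F (0, 0, 1)
  have hF : ∀ a b s, F (a, b, s) = F₁ a + F₂ b - l * s := by
    intro a b s
    have h3 : (a, b, s) = (a, 0, 0) + (0, b, 0) + s • ((0, 0, 1) : (X → ℝ) × (X → ℝ) × ℝ) := by
      simp
    have h4 : F₁ a = F (a, 0, 0) := rfl
    have h5 : F₂ b = F (0, b, 0) := rfl
    rw [h3, map_add, map_add, map_smul, h4, h5, smul_eq_mul]
    simp only [l]
    ring
  have hv : ∀ s ≤ B, v < F₁ μ + F₂ ν - l * s := fun s hs => by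
    rw [← hF]
    exact h2 _ ⟨rfl, rfl, hs⟩
  -- The second set contains arbitrarily negative costs, so the functional must not increase with
  -- the cost.
  have hl : 0 ≤ l := by
    by_contra! hl
    have h3 := hv (min B ((F₁ μ + F₂ ν - v) / l)) (min_le_left _ _)
    have h4 : l * ((F₁ μ + F₂ ν - v) / l) ≤ l * min B ((F₁ μ + F₂ ν - v) / l) :=
      mul_le_mul_of_nonpos_left (min_le_right _ _) hl.le
    rw [mul_div_cancel₀ _ hl.ne] at h4
    linarith
  have hu : ∀ x y, F₁ (Pi.single x 1) - u + F₂ (Pi.single y 1) ≤ l * dist x y := fun x y => by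
    have h3 := h1 _ ⟨_, single_mem_stdSimplex ℝ (x, y), rfl⟩
    rw [couplingMap_single, hF] at h3
    linarith
  obtain ⟨f, hf, hφ⟩ := exists_lipschitz_potential hl hu
  have h5 : ∑ x, f x * μ x - ∑ x, f x * ν x ≤ l * B := by
    -- For `l = 0` rescaling is impossible, but then `f` is constant and both sides vanish.
    rcases hl.eq_or_lt with h0 | h0
    · have hc : ∀ x y, f x = f y := fun x y => by
        have h3 := hf x y
        have h4 := hf y x
        rw [← h0, zero_mul] at h3 h4
        linarith
      obtain ⟨z⟩ := ‹Nonempty X›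
      simp_rw [fun x => hc x z, ← Finset.mul_sum, hμ.2, hν.2, ← h0]
      simp
    · have h3 := h (fun x => f x / l) fun x y => by
        rw [← sub_div, div_le_iff₀' h0]
        exact hf x y
      simp_rw [div_mul_eq_mul_div, ← Finset.sum_div] at h3
      rwa [← sub_div, div_le_iff₀' h0] at h3
  have h6 : F₁ μ - u ≤ ∑ x, f x * μ x := by
    have : F₁ μ - u = ∑ x, (F₁ (Pi.single x 1) - u) * μ x := by
      rw [clm_apply_eq_sum F₁ μ]
      simp_rw [sub_mul, Finset.sum_sub_distrib, ← Finset.mul_sum, hμ.2, mul_one]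
    rw [this]
    exact Finset.sum_le_sum fun x _ => mul_le_mul_of_nonneg_right (hφ x).1 (hμ.1 x)
  have h7 : F₂ ν ≤ -∑ x, f x * ν x := by
    rw [clm_apply_eq_sum F₂ ν, ← Finset.sum_neg_distrib]
    refine Finset.sum_le_sum fun x _ => ?_
    rw [← neg_mul]
    exact mul_le_mul_of_nonneg_right (by linarith [(hφ x).2]) (hν.1 x)
  linarith [hv B le_rfl]

end Duality

/-! ## The Bregman divergence of the multiscale entropy -/

namespace MarkedDAG

theorem divergence_comm {V : Type*} (len : V → V → ℝ) (l l' : List V) :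
    divergence len l l' = divergence len l' l := by
  induction l generalizing l' with
  | nil => cases l' <;> simp [divergence]
  | cons u l ih =>
    obtain _ | ⟨u', l'⟩ := l'
    · simp [divergence]
    obtain _ | ⟨v, l⟩ := l <;> obtain _ | ⟨v', l'⟩ := l'
    · simp [divergence]
    · simp [divergence]
    · simp [divergence]
    · rw [divergence, divergence, ih, max_comm]
      simp only [eq_comm]

variable {X V : Type*} [Fintype V] {M : MarkedDAG X V}

theorem sum_θ {u : V} (hu : u ∉ Set.range M.sink) : ∑ v ∈ M.succs u, M.θ u v = 1 := M.θ_sum u hu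

theorem θ_le_one {u v : V} (h : M.Adj u v) : M.θ u v ≤ 1 := by
  rw [← M.sum_θ (M.not_sink_of_adj h)]
  exact Finset.single_le_sum (f := fun v => M.θ u v)
    (fun v hv => (M.θ_pos u v (M.mem_succs.1 hv)).le) (M.mem_succs.2 h)

theorem log_one_div_θ_nonneg {u v : V} (h : M.Adj u v) : 0 ≤ Real.log (1 / M.θ u v) :=
  Real.log_nonneg (one_le_one_div (M.θ_pos u v h) (θ_le_one h))

theorem one_le_η {u v : V} (h : M.Adj u v) : 1 ≤ M.η u v := by
  rw [η]
  linarith [log_one_div_θ_nonneg h]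

theorem η_pos {u v : V} (h : M.Adj u v) : 0 < M.η u v := zero_lt_one.trans_le (one_le_η h)

theorem δ_pos {u v : V} (h : M.Adj u v) : 0 < M.δ u v := div_pos (M.θ_pos u v h) (η_pos h)

theorem η_mul_δ {u v : V} (h : M.Adj u v) : M.η u v * M.δ u v = M.θ u v := by
  rw [δ, mul_div_cancel₀ _ (η_pos h).ne']

theorem δ_le_θ {u v : V} (h : M.Adj u v) : M.δ u v ≤ M.θ u v :=
  div_le_self (M.θ_pos u v h).le (one_le_η h)

theorem δ_le_one {u v : V} (h : M.Adj u v) : M.δ u v ≤ 1 := (δ_le_θ h).trans (θ_le_one h)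

theorem sum_δ_le_one (u : V) : ∑ v ∈ M.succs u, M.δ u v ≤ 1 := by
  by_cases hu : u ∈ Set.range M.sink
  · obtain ⟨x, rfl⟩ := hu
    simp
  · rw [← sum_θ hu]
    exact Finset.sum_le_sum fun v hv => δ_le_θ (M.mem_succs.1 hv)

theorem IsGeometric.mono {τ τ' : ℝ} (h : M.IsGeometric τ) (hτ : τ' ≤ τ) : M.IsGeometric τ' :=
  fun u v w huv hvw => (mul_le_mul_of_nonneg_right hτ (M.len_pos v w hvw).le).trans (h u v w huv hvw)

/-- The shifted logarithms vary by a multiple of `η`. -/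
theorem log_one_add_div_le {u v : V} (h : M.Adj u v) :
    Real.log ((1 + M.δ u v) / M.δ u v) ≤ 3 / 2 * M.η u v := by
  have hδ := δ_pos h
  have hη := η_pos h
  have hθ := M.θ_pos u v h
  -- With `log (η / 2) ≤ η / 2 - 1` and `log (1 / θ) = η - 1`, the logarithm of this product is at
  -- most `3 / 2 * η + 2 * log 2 - 2`, and `log 2 < 1`.
  have h1 : (1 + M.δ u v) / M.δ u v ≤ 2 * 2 * (M.η u v / 2) * (1 / M.θ u v) := by
    have : 2 * 2 * (M.η u v / 2) * (1 / M.θ u v) = 2 / M.δ u v := by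
      rw [δ]
      field_simp
    rw [this]
    gcongr
    linarith [δ_le_one h]
  have h2 := Real.log_le_log (by positivity) h1
  rw [Real.log_mul (by positivity) (by positivity), Real.log_mul (by positivity) (by positivity),
    Real.log_mul (by norm_num) (by norm_num)] at h2
  have h3 := Real.log_le_sub_one_of_pos (half_pos hη)
  have h4 : Real.log (1 / M.θ u v) = M.η u v - 1 := by rw [η]; ring
  have h5 := Real.log_two_lt_d9
  linarith

/-- The logarithm of the ratio of two shifted transition probabilities. -/
def logRatio (M : MarkedDAG X V) (p q : V → V → ℝ) (u v : V) : ℝ :=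
  Real.log ((p u v + M.δ u v) / (q u v + M.δ u v))

theorem logRatio_swap (p q : V → V → ℝ) (u v : V) :
    M.logRatio q p u v = -M.logRatio p q u v := by
  rw [logRatio, logRatio, ← Real.log_inv, inv_div]

theorem logRatio_le {p q : V → V → ℝ} {u v : V} (h : M.Adj u v) (hp : 0 ≤ p u v)
    (hp1 : p u v ≤ 1) (hq : 0 ≤ q u v) : M.logRatio p q u v ≤ 3 / 2 * M.η u v := by
  have hδ := δ_pos h
  refine le_trans ?_ (log_one_add_div_le h)
  refine Real.log_le_log (by positivity) ?_
  gcongr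
  linarith

theorem abs_logRatio_le {p q : V → V → ℝ} {u v : V} (h : M.Adj u v) (hp : 0 ≤ p u v)
    (hp1 : p u v ≤ 1) (hq : 0 ≤ q u v) (hq1 : q u v ≤ 1) :
    |M.logRatio p q u v| ≤ 3 / 2 * M.η u v := by
  rw [abs_le]
  refine ⟨?_, logRatio_le h hp hp1 hq⟩
  have := logRatio_le (q := p) h hq hq1 hp
  rw [logRatio_swap] at this
  linarith

/-- The linear part of the gradient of the divergence that is shared by the arcs leaving `u`. -/
def gradShift (M : MarkedDAG X V) (p q : V → V → ℝ) (u : V) : ℝ :=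
  ∑ w ∈ M.succs u, M.len u w / M.η u w * (M.δ u w * M.logRatio p q u w - p u w + q u w)

/-- The gradient of the divergence in the direction of the flow. -/
def grad (M : MarkedDAG X V) (p q : V → V → ℝ) (u v : V) : ℝ :=
  M.len u v / M.η u v * M.logRatio p q u v + M.gradShift p q u

/-- The Bregman divergence of the flow `F` from the flow with transition probabilities `q`. -/
def divg (M : MarkedDAG X V) (F q : V → V → ℝ) : ℝ :=
  ∑ u, ∑ v ∈ M.succs u, M.len u v / M.η u v *
    ((F u v + M.δ u v * M.outflow F u) * M.logRatio (fun u v => F u v / M.outflow F u) q u v -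
      F u v + q u v * M.outflow F u)

theorem pairing_grad {F : V → V → ℝ} (hF : M.IsUnitFlow F) (p q : V → V → ℝ) :
    pairing (M.grad p q) F = ∑ u, ∑ v ∈ M.succs u, M.len u v / M.η u v *
      ((F u v + M.δ u v * M.outflow F u) * M.logRatio p q u v -
        p u v * M.outflow F u + q u v * M.outflow F u) := by
  refine Finset.sum_congr rfl fun u _ => ?_
  rw [← Finset.sum_subset (Finset.subset_univ (M.succs u)) fun v _ hv => by
    rw [hF.support u v (by simpa using hv), mul_zero]]
  simp_rw [grad, add_mul, Finset.sum_add_distrib, ← Finset.mul_sum]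
  rw [← M.outflow_eq, gradShift, Finset.sum_mul, ← Finset.sum_add_distrib]
  refine Finset.sum_congr rfl fun v _ => ?_
  ring

/-- Euler's identity for a function that is homogeneous of degree one in the flow. At vertices
without flow the quotient is 0 by convention and is multiplied by 0. -/
theorem divg_eq_pairing {F : V → V → ℝ} (hF : M.IsUnitFlow F) (q : V → V → ℝ) :
    M.divg F q = pairing (M.grad (fun u v => F u v / M.outflow F u) q) F := by
  rw [pairing_grad hF, divg]
  refine Finset.sum_congr rfl fun u _ => Finset.sum_congr rfl fun v _ => ?_
  have : F u v / M.outflow F u * M.outflow F u = F u v := by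
    rcases eq_or_ne (M.outflow F u) 0 with h | h
    · have h1 := hF.le_outflow u v
      have h2 := hF.nonneg u v
      rw [h] at h1
      rw [h, mul_zero]
      linarith
    · exact div_mul_cancel₀ _ h
  rw [this]

/-- Convexity: a tangent plane of a function homogeneous of degree one passes through the origin and
lies below the graph. On each arc it is `log x ≤ x - 1` for the ratio of the shifted probabilities.
-/
theorem pairing_grad_le_divg {F p q : V → V → ℝ} (hF : M.IsUnitFlow F) (hp : ∀ u v, 0 ≤ p u v)
    (hq : ∀ u v, 0 ≤ q u v) : pairing (M.grad p q) F ≤ M.divg F q := by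
  rw [pairing_grad hF, divg]
  refine Finset.sum_le_sum fun u _ => Finset.sum_le_sum fun v hv => ?_
  have huv := M.mem_succs.1 hv
  have hδ := δ_pos huv
  have hp0 := hp u v
  have hq0 := hq u v
  have h1 := hF.le_outflow u v
  have h2 := hF.nonneg u v
  refine mul_le_mul_of_nonneg_left ?_ (div_nonneg (M.len_pos u v huv).le (η_pos huv).le)
  rcases (hF.outflow_nonneg u).eq_or_lt with h | h
  · have : F u v = 0 := by linarith
    rw [← h, this]
    simp
  · have hr : 0 ≤ F u v / M.outflow F u := div_nonneg h2 h.le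
    have h3 : M.logRatio p q u v = M.logRatio (fun u v => F u v / M.outflow F u) q u v +
        Real.log ((p u v + M.δ u v) / (F u v / M.outflow F u + M.δ u v)) := by
      rw [logRatio, logRatio, ← Real.log_mul (by positivity) (by positivity)]
      congr 1
      field_simp
    have h4 := Real.log_le_sub_one_of_pos
      (show 0 < (p u v + M.δ u v) / (F u v / M.outflow F u + M.δ u v) by positivity)
    have h5 : F u v + M.δ u v * M.outflow F u =
        M.outflow F u * (F u v / M.outflow F u + M.δ u v) := by
      field_simp
    have h6 := mul_le_mul_of_nonneg_left h4
      (show 0 ≤ M.outflow F u * (F u v / M.outflow F u + M.δ u v) by positivity)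
    have h7 : M.outflow F u * (F u v / M.outflow F u + M.δ u v) *
        ((p u v + M.δ u v) / (F u v / M.outflow F u + M.δ u v) - 1) =
        M.outflow F u * p u v - F u v := by
      field_simp
      ring
    rw [h7, ← h5] at h6
    rw [h3]
    linarith

theorem divg_nonneg {F q : V → V → ℝ} (hF : M.IsUnitFlow F) (hq : ∀ u v, 0 ≤ q u v) :
    0 ≤ M.divg F q := by
  refine le_trans (le_of_eq ?_) (pairing_grad_le_divg hF hq hq)
  rw [pairing_grad hF]
  symm
  refine Finset.sum_eq_zero fun u _ => Finset.sum_eq_zero fun v hv => ?_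
  have hδ := δ_pos (M.mem_succs.1 hv)
  have hq0 := hq u v
  rw [logRatio, div_self (by positivity), Real.log_one]
  ring

/-! ### Size of the gradient along paths -/

section Bounds

variable {p q : V → V → ℝ} (hp : ∀ u v, 0 ≤ p u v) (hp1 : ∀ u, ∑ v ∈ M.succs u, p u v ≤ 1)
  (hq : ∀ u v, 0 ≤ q u v) (hq1 : ∀ u, ∑ v ∈ M.succs u, q u v ≤ 1)

theorem le_one_of_sum_le_one (hp : ∀ u v, 0 ≤ p u v) (hp1 : ∀ u, ∑ v ∈ M.succs u, p u v ≤ 1)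
    {u v : V} (h : M.Adj u v) : p u v ≤ 1 :=
  (Finset.single_le_sum (f := fun v => p u v) (fun v _ => hp u v) (M.mem_succs.2 h)).trans (hp1 u)

include hp hp1 hq hq1

theorem abs_logTerm_le {u v : V} (h : M.Adj u v) :
    |M.len u v / M.η u v * M.logRatio p q u v| ≤ 3 / 2 * M.len u v := by
  have h1 := abs_logRatio_le h (hp u v) (le_one_of_sum_le_one hp hp1 h) (hq u v)
    (le_one_of_sum_le_one hq hq1 h)
  have hη := η_pos h
  have hl := M.len_pos u v h
  rw [abs_mul, abs_of_pos (div_pos hl hη)]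
  calc M.len u v / M.η u v * |M.logRatio p q u v|
      ≤ M.len u v / M.η u v * (3 / 2 * M.η u v) := by gcongr
    _ = 3 / 2 * M.len u v := by field_simp

/-- The logarithms contribute `3 / 2 * W` because the `δ` add up to at most 1. The linear terms
contribute `W` in either direction, since `p` and `q` have opposite signs and each adds up to at
most 1. -/
theorem abs_gradShift_le {u : V} {W : ℝ} (hW : ∀ v, M.Adj u v → M.len u v ≤ W) (hW0 : 0 ≤ W) :
    |M.gradShift p q u| ≤ 5 / 2 * W := by
  have key : ∀ v ∈ M.succs u,
      |M.len u v / M.η u v * M.logRatio p q u v| * M.δ u v ≤ 3 / 2 * W * M.δ u v := fun v hv => by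
    have h := M.mem_succs.1 hv
    refine mul_le_mul_of_nonneg_right ?_ (δ_pos h).le
    linarith [abs_logTerm_le hp hp1 hq hq1 h, hW v h]
  have hlen : ∀ v ∈ M.succs u, 0 ≤ M.len u v / M.η u v ∧ M.len u v / M.η u v ≤ W :=
    fun v hv => by
      have h := M.mem_succs.1 hv
      exact ⟨div_nonneg (M.len_pos u v h).le (η_pos h).le,
        (div_le_self (M.len_pos u v h).le (one_le_η h)).trans (hW v h)⟩
  have hδ : ∑ v ∈ M.succs u, 3 / 2 * W * M.δ u v ≤ 3 / 2 * W := by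
    rw [← Finset.mul_sum]
    have := mul_le_mul_of_nonneg_left (M.sum_δ_le_one u) (show 0 ≤ 3 / 2 * W by positivity)
    linarith
  have hup : M.gradShift p q u ≤ ∑ v ∈ M.succs u, (3 / 2 * W * M.δ u v + W * q u v) := by
    refine Finset.sum_le_sum fun v hv => ?_
    have h1 := key v hv
    have h2 := (abs_le.1 (le_refl |M.len u v / M.η u v * M.logRatio p q u v|)).2
    have h3 := mul_le_mul_of_nonneg_right h2 (δ_pos (M.mem_succs.1 hv)).le
    have h4 := mul_le_mul_of_nonneg_right (hlen v hv).2 (hq u v)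
    have h5 := mul_nonneg (hlen v hv).1 (hp u v)
    linarith
  have hlo : ∑ v ∈ M.succs u, -(3 / 2 * W * M.δ u v + W * p u v) ≤ M.gradShift p q u := by
    refine Finset.sum_le_sum fun v hv => ?_
    have h1 := key v hv
    have h2 := (abs_le.1 (le_refl |M.len u v / M.η u v * M.logRatio p q u v|)).1
    have h3 := mul_le_mul_of_nonneg_right h2 (δ_pos (M.mem_succs.1 hv)).le
    have h4 := mul_le_mul_of_nonneg_right (hlen v hv).2 (hp u v)
    have h5 := mul_nonneg (hlen v hv).1 (hq u v)
    linarith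
  rw [Finset.sum_neg_distrib] at hlo
  rw [Finset.sum_add_distrib, ← Finset.mul_sum _ _ W] at hup hlo
  have h1 := mul_le_mul_of_nonneg_left (hp1 u) hW0
  have h2 := mul_le_mul_of_nonneg_left (hq1 u) hW0
  rw [abs_le]
  constructor <;> linarith

theorem abs_grad_le {u v : V} (h : M.Adj u v) {W : ℝ} (hW : ∀ v, M.Adj u v → M.len u v ≤ W) :
    |M.grad p q u v| ≤ 4 * W := by
  have h0 : 0 ≤ W := (M.len_pos u v h).le.trans (hW v h)
  have h1 := abs_add_le (M.len u v / M.η u v * M.logRatio p q u v) (M.gradShift p q u)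
  have h2 := abs_logTerm_le hp hp1 hq hq1 h
  have h3 := abs_gradShift_le hp hp1 hq hq1 hW h0
  have h4 := hW v h
  rw [grad]
  linarith

variable (hM : M.IsGeometric 4)
include hM

/-- Arc lengths shrink by a factor of 4, so the sum is at most `4 * W * (1 + 1/4 + 1/16 + ...)`. -/
theorem abs_pathSum_grad_le {l : List V} {v : V} {W : ℝ} (hl : (v :: l).IsChain M.Adj)
    (hW : ∀ w, M.Adj v w → M.len v w ≤ W) (hW0 : 0 ≤ W) :
    |pathSum (M.grad p q) (v :: l)| ≤ 16 / 3 * W := by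
  induction l generalizing v W with
  | nil =>
    rw [pathSum_singleton, abs_zero]
    positivity
  | cons w l ih =>
    rw [List.isChain_cons_cons] at hl
    rw [pathSum_cons_cons]
    have h1 := ih (W := W / 4) hl.2 (fun w' hw' => by linarith [hM v w w' hl.1 hw', hW w hl.1])
      (by positivity)
    have h2 := abs_grad_le hp hp1 hq hq1 hl.1 hW
    have h3 := abs_add_le (M.grad p q v w) (pathSum (M.grad p q) (w :: l))
    linarith

/-- Before the paths diverge the terms agree, and at the divergence `gradShift` cancels because it
depends on the tail only. What is left are two logarithmic terms of `3/2` and two remainders of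
`16/3 * 1/4` times the larger arc length, together `17/3`. -/
theorem pathSum_grad_sub_le_divergence {l l' : List V} {u : V} {x x' : X}
    (hl : l.IsChain M.Adj) (hl' : l'.IsChain M.Adj) (hu : l.head? = some u)
    (hu' : l'.head? = some u) (hx : l.getLast? = some (M.sink x))
    (hx' : l'.getLast? = some (M.sink x')) :
    pathSum (M.grad p q) l - pathSum (M.grad p q) l' ≤ 6 * divergence M.len l l' := by
  induction l generalizing u l' with
  | nil => simp at hu
  | cons a l ih =>
    obtain _ | ⟨a', l'⟩ := l'
    · simp at hu'
    simp only [List.head?_cons, Option.some.injEq] at hu hu'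
    subst hu hu'
    obtain _ | ⟨v, l⟩ := l <;> obtain _ | ⟨v', l'⟩ := l'
    · simp [divergence]
    · simp only [List.getLast?_singleton, Option.some.injEq] at hx
      rw [List.isChain_cons_cons, hx] at hl'
      exact absurd hl'.1 (M.not_adj_sink _ _)
    · simp only [List.getLast?_singleton, Option.some.injEq] at hx'
      rw [List.isChain_cons_cons, hx'] at hl
      exact absurd hl.1 (M.not_adj_sink _ _)
    · rw [List.isChain_cons_cons] at hl hl'
      rw [divergence, pathSum_cons_cons, pathSum_cons_cons]
      split_ifs with hv
      · subst hv
        have := ih hl.2 hl'.2 rfl rfl (by simpa using hx) (by simpa using hx')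
        linarith
      · have h1 := abs_pathSum_grad_le hp hp1 hq hq1 hM (W := M.len a' v / 4) hl.2
          (fun w hw => by linarith [hM a' v w hl.1 hw]) (by linarith [M.len_pos _ _ hl.1])
        have h2 := abs_pathSum_grad_le hp hp1 hq hq1 hM (W := M.len a' v' / 4) hl'.2
          (fun w hw => by linarith [hM a' v' w hl'.1 hw]) (by linarith [M.len_pos _ _ hl'.1])
        have h3 := abs_logTerm_le hp hp1 hq hq1 hl.1
        have h4 := abs_logTerm_le hp hp1 hq hq1 hl'.1
        rw [abs_le] at h1 h2 h3 h4
        have h5 := le_max_left (M.len a' v) (M.len a' v')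
        have h6 := le_max_right (M.len a' v) (M.len a' v')
        have h7 := M.len_pos _ _ hl.1
        rw [grad, grad]
        linarith

end Bounds

theorem sum_div_outflow_le (F : V → V → ℝ) (u : V) :
    ∑ v ∈ M.succs u, F u v / M.outflow F u ≤ 1 := by
  rw [← Finset.sum_div, ← M.outflow_eq]
  exact div_self_le_one _

theorem transition_sum_le {q : V → V → ℝ} (hq : M.IsTransition q) (u : V) :
    ∑ v ∈ M.succs u, q u v ≤ 1 := by
  by_cases hu : u ∈ Set.range M.sink
  · obtain ⟨x, rfl⟩ := hu
    simp
  · exact (hq.sum_succs hu).le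

/-- The divergence is Lipschitz in the flow. -/
theorem divg_sub_le_flowDist [Fintype X] (hM : M.IsGeometric 4) {F F' q : V → V → ℝ}
    (hF : M.IsUnitFlow F) (hF' : M.IsUnitFlow F') (hq : M.IsTransition q) :
    M.divg F' q - M.divg F q ≤ 6 * M.flowDist F F' := by
  have hp : ∀ u v, 0 ≤ F' u v / M.outflow F' u := fun u v =>
    div_nonneg (hF'.nonneg u v) (hF'.outflow_nonneg u)
  -- Both divergences are compared with the tangent plane at `F'`, which is exact at `F'` and a
  -- lower bound at `F`.
  have h1 := pairing_grad_le_divg hF hp hq.nonneg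
  rw [divg_eq_pairing hF']
  refine (sub_le_sub_left h1 _).trans (pairing_sub_le_flowDist (by norm_num) hF hF' fun γ γ' => ?_)
  rw [pathDist, divergence_comm]
  exact pathSum_grad_sub_le_divergence hp (sum_div_outflow_le F') hq.nonneg
      (transition_sum_le hq) hM γ'.isChain γ.isChain γ'.head_eq γ.head_eq γ'.last_eq γ.last_eq

/-- The divergences of all unit flows from a given point are bounded. -/
theorem exists_divg_le [Fintype X] {q : V → V → ℝ} (hq : M.IsTransition q) :
    ∃ B, ∀ F, M.IsUnitFlow F → M.divg F q ≤ B := by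
  let W : ℝ := ∑ u, ∑ v, |M.len u v|
  have hW : ∀ u v, M.len u v ≤ W := fun u v =>
    (le_abs_self _).trans <| (Finset.single_le_sum (f := fun v => |M.len u v|)
      (fun v _ => abs_nonneg _) (Finset.mem_univ v)).trans <|
      Finset.single_le_sum (f := fun u => ∑ v, |M.len u v|)
        (fun u _ => Finset.sum_nonneg fun v _ => abs_nonneg _) (Finset.mem_univ u)
  refine ⟨∑ _u : V, ∑ _v : V, 4 * W, fun F hF => ?_⟩
  have hp : ∀ u v, 0 ≤ F u v / M.outflow F u := fun u v =>
    div_nonneg (hF.nonneg u v) (hF.outflow_nonneg u)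
  have hW0 : 0 ≤ W := Finset.sum_nonneg fun u _ => Finset.sum_nonneg fun v _ => abs_nonneg _
  rw [divg_eq_pairing hF]
  refine Finset.sum_le_sum fun u _ => Finset.sum_le_sum fun v _ => ?_
  by_cases h : M.Adj u v
  · have h1 := abs_grad_le hp (sum_div_outflow_le F) hq.nonneg (transition_sum_le hq) h
      (W := W) fun v _ => hW u v
    have h2 : F u v ≤ 1 := by
      obtain ⟨χ, hχ⟩ := hF.exists_isPathDecomposition
      rw [← hχ.sum_eq_one hF, hχ.2 u v]
      refine Finset.sum_le_sum fun γ _ => ?_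
      split_ifs
      · exact le_rfl
      · exact hχ.1 γ
    calc M.grad (fun u v => F u v / M.outflow F u) q u v * F u v ≤ 4 * W * F u v :=
          mul_le_mul_of_nonneg_right ((le_abs_self _).trans h1) (hF.nonneg u v)
      _ ≤ 4 * W * 1 := by
          have := hF.nonneg u v
          gcongr
      _ = 4 * W := mul_one _
  · rw [hF.support u v h, mul_zero]
    positivity

end MarkedDAG

/-! ## Instantaneous estimates for the mirror descent dynamics -/

/-- If the masses `a` add up to `0`, then they can be transported at a cost of `w i` per unit
of mass leaving or entering `i`. -/
theorem sum_mul_le_of_sub_le {ι : Type*} {s : Finset ι} {a w g : ι → ℝ} (ha : ∑ i ∈ s, a i = 0)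
    (hw : ∀ i ∈ s, 0 ≤ w i) (hg : ∀ i ∈ s, ∀ j ∈ s, i ≠ j → g i - g j ≤ w i + w j) :
    ∑ i ∈ s, a i * g i ≤ ∑ i ∈ s, w i * |a i| := by
  rcases s.eq_empty_or_nonempty with rfl | hs
  · simp
  -- The intervals `[g i - w i, g i + w i]` meet pairwise, hence have a common point. Subtracting it
  -- from `g` is free because the masses add up to 0.
  obtain ⟨m, hm⟩ : ∃ m, ∀ i ∈ s, |g i - m| ≤ w i := by
    obtain ⟨i, hi, h⟩ := Finset.exists_mem_eq_sup' hs fun i => g i - w i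
    refine ⟨s.sup' hs fun i => g i - w i, fun j hj => abs_le.2 ⟨?_, ?_⟩⟩
    · rw [h]
      rcases eq_or_ne i j with rfl | hij
      · linarith [hw i hi]
      · linarith [hg i hi j hj hij]
    · linarith [Finset.le_sup' (fun i => g i - w i) hj]
  calc ∑ i ∈ s, a i * g i = ∑ i ∈ s, a i * (g i - m) := by
        simp_rw [mul_sub, Finset.sum_sub_distrib, ← Finset.sum_mul, ha, zero_mul, sub_zero]
    _ ≤ ∑ i ∈ s, w i * |a i| := by
        refine Finset.sum_le_sum fun i hi => (le_abs_self _).trans ?_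
        rw [abs_mul, mul_comm]
        exact mul_le_mul_of_nonneg_right (hm i hi) (abs_nonneg _)

namespace DAGOver

variable {X V : Type*} [Fintype V] {D : DAGOver X V} {q : V → V → ℝ}

theorem value_le_of_reachable (hq : D.IsTransition q) {f : X → ℝ} {C : ℝ} {v : V}
    (h : ∀ x, Relation.ReflTransGen D.Adj v (D.sink x) → f x ≤ C) : D.value q 0 f v ≤ C := by
  induction v using D.sink_induction with
  | sink x => simpa using h x Relation.ReflTransGen.refl
  | step u hu ih =>
    rw [value_step hu, Pi.zero_apply, zero_add]
    calc ∑ v ∈ D.succs u, q u v * D.value q 0 f v ≤ ∑ v ∈ D.succs u, q u v * C := by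
          refine Finset.sum_le_sum fun v hv => mul_le_mul_of_nonneg_left ?_ (hq.nonneg u v)
          have huv := D.mem_succs.1 hv
          exact ih v huv fun x hx => h x (Relation.ReflTransGen.head huv hx)
      _ = C := by rw [← Finset.sum_mul, hq.sum_succs hu, one_mul]

theorem value_mul {h : V → ℝ} {b : X → ℝ} (s : ℝ) (u : V) :
    D.value q (s • h) (fun x => s * b x) u = s * D.value q h b u := by
  symm
  refine value_unique (Y := fun u => s * D.value q h b u) (fun x => by simp) (fun u hu => ?_) u
  rw [value_step hu, mul_add, Finset.mul_sum]
  congr 1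
  exact Finset.sum_congr rfl fun v _ => by ring

theorem value_neg (f : X → ℝ) (v : V) : D.value q 0 (fun x => -f x) v = -D.value q 0 f v := by
  simpa using value_mul (D := D) (q := q) (h := 0) (b := f) (-1) v

theorem le_value_of_reachable (hq : D.IsTransition q) {f : X → ℝ} {C : ℝ} {v : V}
    (h : ∀ x, Relation.ReflTransGen D.Adj v (D.sink x) → C ≤ f x) : C ≤ D.value q 0 f v := by
  have := value_le_of_reachable (f := fun x => -f x) (C := -C) hq fun x hx => neg_le_neg (h x hx)
  rw [value_neg] at this
  linarith

end DAGOver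

/-! ### Expansion and expectations of Lipschitz functions -/

namespace MarkedDAG

theorem divergence_append {V : Type*} {len : V → V → ℝ} (p : List V) {u v v' : V} {l l' : List V}
    (hv : v ≠ v') : divergence len (p ++ u :: v :: l) (p ++ u :: v' :: l') =
      max (len u v) (len u v') := by
  induction p with
  | nil => simp [divergence, hv]
  | cons a p ih =>
    cases p with
    | nil => simpa [divergence] using ih
    | cons b p => simpa [divergence] using ih

variable {X V : Type*} [Fintype V] {M : MarkedDAG X V}

/-- One common path from the root to `u` is continued through `v` to `x` and through `v'` to `x'`;
the two root paths first diverge at `u`. -/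
theorem IsExpanding.mul_dist_le_max [MetricSpace X] {ε : ℝ} (hM : M.IsExpanding ε) {u v v' : V}
    (h : M.Adj u v) (h' : M.Adj u v') (hv : v ≠ v') {x x' : X}
    (hx : Relation.ReflTransGen M.Adj v (M.sink x))
    (hx' : Relation.ReflTransGen M.Adj v' (M.sink x')) :
    ε * dist x x' ≤ max (M.len u v) (M.len u v') := by
  obtain ⟨p, hp, hpu⟩ := List.exists_isChain_cons_of_relationReflTransGen (M.reachable_root u)
  obtain ⟨l, hl, hlx⟩ := List.exists_isChain_cons_of_relationReflTransGen hx
  obtain ⟨l', hl', hlx'⟩ := List.exists_isChain_cons_of_relationReflTransGen hx'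
  have hpl : (M.root :: p).getLast? = some u := by
    rw [List.getLast?_eq_some_getLast (by simp), hpu]
  have hpd : M.root :: p = (M.root :: p).dropLast ++ [u] := by
    conv_lhs => rw [← List.dropLast_append_getLast (l := M.root :: p) (by simp), hpu]
  let mk : ∀ (w : V) (m : List V) (y : X), M.Adj u w → (w :: m).IsChain M.Adj →
      (w :: m).getLast (by simp) = M.sink y → M.RootPath := fun w m y h1 h2 h3 =>
    { verts := (M.root :: p) ++ w :: m
      endpoint := y
      isChain := by
        refine List.isChain_append.2 ⟨hp, h2, fun a ha b hb => ?_⟩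
        rw [hpl, Option.mem_some_iff] at ha
        rw [List.head?_cons, Option.mem_some_iff] at hb
        rwa [← ha, ← hb]
      head_eq := by simp
      last_eq := by
        rw [List.getLast?_append_of_ne_nil _ (by simp),
          List.getLast?_eq_some_getLast (by simp), h3] }
  have key := hM (mk v l x h hl hlx) (mk v' l' x' h' hl' hlx')
  refine key.trans (le_of_eq ?_)
  simp only [pathDist, mk]
  rw [hpd, List.append_assoc, List.append_assoc]
  exact divergence_append _ hv

/-- The two values are averages of `f` over sinks below `v` and below `v'`, and any two such sinks
are within `max / ε` of each other. The maximum is relaxed to a sum to fit `sum_mul_le_of_sub_le`.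
-/
theorem value_sub_le [MetricSpace X] {ε : ℝ} (hε : 0 < ε) (hM : M.IsExpanding ε) {q : V → V → ℝ}
    (hq : M.IsTransition q) {f : X → ℝ} (hf : ∀ x y, f x - f y ≤ dist x y) {u v v' : V}
    (h : M.Adj u v) (h' : M.Adj u v') (hv : v ≠ v') :
    ε * M.value q 0 f v - ε * M.value q 0 f v' ≤ M.len u v + M.len u v' := by
  have key : M.value q 0 f v - max (M.len u v) (M.len u v') / ε ≤ M.value q 0 f v' := by
    refine DAGOver.le_value_of_reachable hq fun x' hx' => ?_
    rw [sub_le_iff_le_add]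
    refine DAGOver.value_le_of_reachable hq fun x hx => ?_
    have h1 := hM.mul_dist_le_max h h' hv hx hx'
    rw [← le_div_iff₀' hε] at h1
    linarith [hf x x']
  have h2 : max (M.len u v) (M.len u v') ≤ M.len u v + M.len u v' :=
    max_le (by linarith [M.len_pos u v' h']) (by linarith [M.len_pos u v h])
  have h3 := mul_le_mul_of_nonneg_left key hε.le
  rw [mul_sub, mul_div_cancel₀ _ hε.ne'] at h3
  linarith

/-! ### Depth -/

/-- The expected cost, weighted by `η` along the path of the particle, is at most the total depth
times the expected cost. -/
theorem value_η_le [Fintype X] {q : V → V → ℝ} (hq : ∀ u v, 0 ≤ q u v) {c : X → ℝ}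
    (hc : ∀ x, 0 ≤ c x) :
    M.value q (fun u => ∑ v ∈ M.succs u, M.η u v * q u v * M.value q 0 c v) 0 M.root ≤
      ((M.combDepth : ℝ) + M.infoDepth) * M.value q 0 c M.root := by
  have hchat : ∀ u, 0 ≤ M.value q 0 c u :=
    DAGOver.value_nonneg hq (fun _ _ => le_rfl) hc
  -- `R u` is the largest `η`-weight of a path from `u` to a sink; at the root it is at most the
  -- total depth.
  obtain ⟨R, hR0, hR, γ, hγ⟩ := M.exists_rootPath_pathSum M.η
  have h1 : R M.root ≤ (M.combDepth : ℝ) + M.infoDepth := by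
    have harcs : ∀ e ∈ γ.arcs, M.Adj e.1 e.2 := fun e he => γ.adj_of_mem_arcs he
    have key : ∀ l : List (V × V), (∀ e ∈ l, M.Adj e.1 e.2) →
        (l.map fun e => M.η e.1 e.2).sum =
          l.length + Real.log (1 / (l.map fun e => M.θ e.1 e.2).prod) ∧
        0 < (l.map fun e => M.θ e.1 e.2).prod := by
      intro l
      induction l with
      | nil => simp
      | cons e l ih =>
        intro hl
        obtain ⟨h2, h3⟩ := ih fun e' he' => hl e' (by simp [he'])
        have h4 := M.θ_pos _ _ (hl e (by simp))
        refine ⟨?_, by simpa using mul_pos h4 h3⟩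
        rw [List.map_cons, List.sum_cons, h2, List.map_cons, List.prod_cons, one_div, one_div,
          mul_inv, Real.log_mul (inv_ne_zero h4.ne') (inv_ne_zero h3.ne'), η, one_div,
          List.length_cons]
        push_cast
        ring
    rw [← hγ, ← γ.sum_map_arcs M.η, (key _ harcs).1]
    have h2 : (γ.arcs.length : ℝ) ≤ M.combDepth := by
      exact_mod_cast Finset.le_sup (f := fun γ : M.RootPath => γ.arcs.length) (Finset.mem_univ γ)
    have h3 : Real.log (1 / (γ.arcs.map fun e => M.θ e.1 e.2).prod) ≤ M.infoDepth :=
      le_ciSup (f := fun γ : M.RootPath =>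
        Real.log (1 / (γ.arcs.map fun e => M.θ e.1 e.2).prod)) (Set.finite_range _).bddAbove γ
    linarith
  refine le_trans ?_ (mul_le_mul_of_nonneg_right h1 (hchat _))
  -- `R` times the expected cost is a supersolution because `η u v + R v ≤ R u`.
  refine DAGOver.value_le_of_superharmonic (Y := fun u => R u * M.value q 0 c u) hq
    (fun x => by simp [hR0]) (fun u hu => ?_) M.root
  rw [DAGOver.value_step (h := 0) hu, Pi.zero_apply, zero_add, Finset.mul_sum,
    ← Finset.sum_add_distrib]
  refine Finset.sum_le_sum fun v hv => ?_
  have := mul_le_mul_of_nonneg_right (hR u v (M.mem_succs.1 hv))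
    (mul_nonneg (hq u v) (hchat v))
  linarith

theorem infoDepth_nonneg : 0 ≤ M.infoDepth := by
  refine Real.iSup_nonneg fun γ => Real.log_nonneg ?_
  have key : ∀ l : List (V × V), (∀ e ∈ l, M.Adj e.1 e.2) →
      0 < (l.map fun e => M.θ e.1 e.2).prod ∧ (l.map fun e => M.θ e.1 e.2).prod ≤ 1 := by
    intro l
    induction l with
    | nil => simp
    | cons e l ih =>
      intro hl
      obtain ⟨h2, h3⟩ := ih fun e' he' => hl e' (by simp [he'])
      have h4 := hl e (by simp)
      rw [List.map_cons, List.prod_cons]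
      exact ⟨mul_pos (M.θ_pos _ _ h4) h2, mul_le_one₀ (θ_le_one h4) h2.le h3⟩
  obtain ⟨h1, h2⟩ := key γ.arcs fun e he => γ.adj_of_mem_arcs he
  exact one_le_one_div h1 h2

/-- Makes the movement ratio positive, as `tsum_ofReal_le_offlineCost` requires. -/
theorem combDepth_pos [Nontrivial X] : 0 < M.combDepth := by
  obtain ⟨R, hR0, hR, γ, hγ⟩ := M.exists_rootPath_pathSum fun _ _ => 1
  refine lt_of_lt_of_le ?_
    (Finset.le_sup (f := fun γ : M.RootPath => γ.arcs.length) (Finset.mem_univ γ))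
  by_contra! h0
  have h1 : γ.arcs = [] := List.length_eq_zero_iff.1 (Nat.le_zero.1 h0)
  have h2 := γ.head_eq
  have h3 := γ.last_eq
  rw [DAGOver.RootPath.arcs] at h1
  rcases h : γ.verts with _ | ⟨a, _ | ⟨b, l⟩⟩
  · simp [h] at h2
  · simp only [h, List.head?_cons, List.getLast?_singleton, Option.some.injEq] at h2 h3
    exact M.root_not_sink ⟨γ.endpoint, by rw [← h3, h2]⟩
  · simp [h] at h1

/-! ### The potential for movement costs -/

/-- The maximal length of an arc leaving `u`. -/
def maxLen (M : MarkedDAG X V) (u : V) : ℝ :=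
  Finset.univ.sup' ⟨u, Finset.mem_univ u⟩ fun v => if M.Adj u v then M.len u v else 0

theorem len_le_maxLen {u v : V} (h : M.Adj u v) : M.len u v ≤ M.maxLen u := by
  have := Finset.le_sup' (fun v => if M.Adj u v then M.len u v else 0) (Finset.mem_univ v)
  rwa [if_pos h] at this

theorem maxLen_nonneg (u : V) : 0 ≤ M.maxLen u := by
  have := Finset.le_sup' (fun v => if M.Adj u v then M.len u v else 0) (Finset.mem_univ u)
  rwa [if_neg fun h => M.acyclic u (Relation.TransGen.single h)] at this

theorem IsGeometric.maxLen_le (hM : M.IsGeometric 4) {u v : V} (h : M.Adj u v) :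
    M.maxLen v ≤ M.len u v / 4 := by
  refine Finset.sup'_le _ _ fun w _ => ?_
  split_ifs with hw
  · linarith [hM u v w h hw]
  · linarith [M.len_pos u v h]

/-- The local movement potential at `u`. -/
def localPotential (M : MarkedDAG X V) (q : V → V → ℝ) (u : V) : ℝ :=
  ∑ v ∈ M.succs u,
    M.len u v * (8 * q u v - 14 * M.δ u v * Real.log ((q u v + M.δ u v) / M.δ u v)) +
  7 * M.maxLen u

/-- The movement potential. -/
def potential (M : MarkedDAG X V) (q : V → V → ℝ) : V → ℝ := M.value q (M.localPotential q) 0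

/-- The estimate `log y ≤ y / 2` gives `14 * δ * log ≤ 7 * q + 7 * δ`, so an arc contributes at
least `-7 * len * δ`, which the summand `7 * maxLen` compensates. The upper bound is `8 + 7`. -/
theorem localPotential_mem {q : V → V → ℝ} (hq : M.IsTransition q) (u : V) :
    0 ≤ M.localPotential q u ∧ M.localPotential q u ≤ 15 * M.maxLen u := by
  have hW := M.maxLen_nonneg u
  have key : ∀ v ∈ M.succs u, -(7 * M.maxLen u * M.δ u v) ≤
      M.len u v * (8 * q u v - 14 * M.δ u v * Real.log ((q u v + M.δ u v) / M.δ u v)) ∧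
      M.len u v * (8 * q u v - 14 * M.δ u v * Real.log ((q u v + M.δ u v) / M.δ u v)) ≤
        8 * M.maxLen u * q u v := by
    intro v hv
    have h := M.mem_succs.1 hv
    have hδ := δ_pos h
    have hl := M.len_pos u v h
    have hlW := len_le_maxLen h
    have hq0 := hq.nonneg u v
    have h1 : 1 ≤ (q u v + M.δ u v) / M.δ u v := by
      rw [le_div_iff₀ hδ]
      linarith
    have h2 : 0 ≤ M.δ u v * Real.log ((q u v + M.δ u v) / M.δ u v) :=
      mul_nonneg hδ.le (Real.log_nonneg h1)
    have h3 : M.δ u v * Real.log ((q u v + M.δ u v) / M.δ u v) ≤ (q u v + M.δ u v) / 2 := by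
      -- The tangent of the logarithm at 2: `log y ≤ log 2 + y / 2 - 1`.
      have h4 := Real.log_le_sub_one_of_pos
        (show 0 < (q u v + M.δ u v) / M.δ u v / 2 by positivity)
      rw [Real.log_div (by positivity) (by norm_num)] at h4
      have h5 := Real.log_two_lt_d9
      have h6 := mul_le_mul_of_nonneg_left (show Real.log ((q u v + M.δ u v) / M.δ u v) ≤
        (q u v + M.δ u v) / M.δ u v / 2 by linarith) hδ.le
      refine h6.trans (le_of_eq ?_)
      field_simp
    constructor
    · have h4 := mul_le_mul_of_nonneg_left (show -(7 * M.δ u v) ≤ 8 * q u v -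
        14 * M.δ u v * Real.log ((q u v + M.δ u v) / M.δ u v) by linarith) hl.le
      have h5 := mul_le_mul_of_nonneg_right hlW hδ.le
      linarith
    · have h4 := mul_le_mul_of_nonneg_left (show 8 * q u v -
        14 * M.δ u v * Real.log ((q u v + M.δ u v) / M.δ u v) ≤ 8 * q u v by linarith) hl.le
      have h5 := mul_le_mul_of_nonneg_right hlW hq0
      linarith
  have hlo := Finset.sum_le_sum fun v hv => (key v hv).1
  have hup := Finset.sum_le_sum fun v hv => (key v hv).2
  rw [Finset.sum_neg_distrib, ← Finset.mul_sum] at hlo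
  rw [← Finset.mul_sum] at hup
  have h1 := mul_le_mul_of_nonneg_left (M.sum_δ_le_one u) (show 0 ≤ 7 * M.maxLen u by positivity)
  have h2 := mul_le_mul_of_nonneg_left (transition_sum_le hq u)
    (show 0 ≤ 8 * M.maxLen u by positivity)
  rw [localPotential]
  constructor <;> linarith

theorem potential_nonneg {q : V → V → ℝ} (hq : M.IsTransition q) (u : V) :
    0 ≤ M.potential q u :=
  DAGOver.value_nonneg hq.nonneg (fun u _ => (localPotential_mem hq u).1) (fun _ => le_rfl) u

/-- The vertex itself contributes at most `15 * maxLen u`, its children at most `20 * maxLen u / 4`.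
-/
theorem potential_le (hM : M.IsGeometric 4) {q : V → V → ℝ} (hq : M.IsTransition q) (u : V) :
    M.potential q u ≤ 20 * M.maxLen u := by
  refine DAGOver.value_le_of_superharmonic (Y := fun u => 20 * M.maxLen u) hq.nonneg
    (fun x => by simpa using M.maxLen_nonneg _) (fun u _ => ?_) u
  have h1 : ∑ v ∈ M.succs u, q u v * (20 * M.maxLen v) ≤
      ∑ v ∈ M.succs u, q u v * (5 * M.maxLen u) := by
    refine Finset.sum_le_sum fun v hv => mul_le_mul_of_nonneg_left ?_ (hq.nonneg u v)
    have h := M.mem_succs.1 hv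
    linarith [hM.maxLen_le h, len_le_maxLen h]
  rw [← Finset.sum_mul] at h1
  have h2 := mul_le_mul_of_nonneg_right (transition_sum_le hq u)
    (show 0 ≤ 5 * M.maxLen u by linarith [M.maxLen_nonneg u])
  linarith [(localPotential_mem hq u).2]

/-- The constant 5 is the coefficient of the outgoing mass in `IsVelocity.movement_le`: mass leaving
an arc loses at most this much potential below it. -/
theorem potential_le_len (hM : M.IsGeometric 4) {q : V → V → ℝ} (hq : M.IsTransition q) {u v : V}
    (h : M.Adj u v) : M.potential q v ≤ 5 * M.len u v := by
  linarith [potential_le hM hq v, hM.maxLen_le h]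

/-! ### Velocities -/

section Velocity

variable {κ : ℝ} {c : X → ℝ} {q q' : V → V → ℝ}

theorem IsVelocity.spec (h : M.IsVelocity κ c q q') : ∃ (β : V → ℝ) (α : V → V → ℝ),
    (∀ u v, M.Adj u v → 0 ≤ α u v ∧ α u v * q u v = 0) ∧
    (∀ u, ∑ v ∈ M.succs u, q' u v = 0) ∧
    ∀ u v, M.Adj u v → q' u v = κ * (M.η u v / M.len u v) * (q u v + M.δ u v) *
      (β u - (M.value q 0 c v - α u v)) := by
  obtain ⟨chat, β, α, h1, h2, h3, h4, h5⟩ := h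
  have : chat = M.value q 0 c := by
    funext u
    refine DAGOver.value_unique h1 (fun u hu => ?_) u
    rw [h2 u hu, Pi.zero_apply, zero_add]
    rfl
  subst this
  exact ⟨β, α, h3, h4, h5⟩

/-- The derivative of the divergence from the flow `F` along the dynamics. -/
theorem IsVelocity.divg_deriv_le [Fintype X] (h : M.IsVelocity κ c q q') (hκ : 0 < κ)
    (hq : M.IsTransition q) {F : V → V → ℝ} {x : X} (hF : M.IsUnitFlowTo F x) :
    ∑ u, ∑ v ∈ M.succs u, M.len u v / M.η u v *
      (q' u v * M.outflow F u - (F u v + M.δ u v * M.outflow F u) * (q' u v / (q u v + M.δ u v))) ≤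
      κ * (c x - M.value q 0 c M.root) := by
  obtain ⟨β, α, hα, -, hq'⟩ := h.spec
  have hp := hF.pairing_sub (M.value q 0 c)
  rw [DAGOver.value_sink] at hp
  have hgoal : κ * (c x - M.value q 0 c M.root) =
      ∑ u, ∑ v ∈ M.succs u, κ * ((M.value q 0 c v - M.value q 0 c u) * F u v) := by
    rw [show c x - M.value q 0 c M.root = -(M.value q 0 c M.root - c x) by ring, ← hp, pairing,
      ← Finset.sum_neg_distrib, Finset.mul_sum]
    refine Finset.sum_congr rfl fun u _ => ?_
    rw [← Finset.sum_subset (Finset.subset_univ (M.succs u)) fun v _ hv => by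
      rw [hF.1.support u v (by simpa using hv), mul_zero], ← Finset.sum_neg_distrib,
      Finset.mul_sum]
    exact Finset.sum_congr rfl fun v _ => by ring
  rw [hgoal]
  refine Finset.sum_le_sum fun u _ => ?_
  by_cases hu : u ∈ Set.range M.sink
  · obtain ⟨y, rfl⟩ := hu
    simp
  have hterm : ∀ v ∈ M.succs u, M.len u v / M.η u v * (q' u v * M.outflow F u -
      (F u v + M.δ u v * M.outflow F u) * (q' u v / (q u v + M.δ u v))) ≤
      κ * (β u * (M.outflow F u * q u v - F u v)) +
      (κ * (F u v * M.value q 0 c v) - κ * M.outflow F u * (q u v * M.value q 0 c v)) := by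
    intro v hv
    have ha := M.mem_succs.1 hv
    have hη := η_pos ha
    have hl := M.len_pos u v ha
    have hδ := δ_pos ha
    have hq0 := hq.nonneg u v
    -- The factor `q + δ` of the velocity cancels the denominator that comes from the logarithm.
    have e1 : M.len u v / M.η u v * (q' u v * M.outflow F u -
        (F u v + M.δ u v * M.outflow F u) * (q' u v / (q u v + M.δ u v))) =
        κ * (β u - (M.value q 0 c v - α u v)) * (M.outflow F u * q u v - F u v) := by
      rw [hq' u v ha]
      field_simp
      ring
    -- By complementary slackness the multipliers enter only through `-κ * α * F`, which has the
    -- favourable sign.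
    have e2 := mul_nonneg (mul_nonneg hκ.le (hα u v ha).1) (hF.1.nonneg u v)
    have e3 := (hα u v ha).2
    rw [e1]
    have e4 : κ * α u v * (M.outflow F u * q u v - F u v) =
        κ * M.outflow F u * (α u v * q u v) - κ * α u v * F u v := by ring
    rw [e3] at e4
    linarith
  refine (Finset.sum_le_sum hterm).trans (le_of_eq ?_)
  have e5 : ∑ v ∈ M.succs u, q u v = 1 := hq.sum_succs hu
  have e6 : ∑ v ∈ M.succs u, F u v = M.outflow F u := rfl
  have e7 : ∑ v ∈ M.succs u, q u v * M.value q 0 c v = M.value q 0 c u := by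
    rw [DAGOver.value_step (u := u) hu, Pi.zero_apply, zero_add]
  rw [Finset.sum_add_distrib, ← Finset.mul_sum, ← Finset.mul_sum, Finset.sum_sub_distrib,
    ← Finset.mul_sum, e5, e6, Finset.sum_sub_distrib, ← Finset.mul_sum, ← Finset.mul_sum, e7,
    ← Finset.mul_sum]
  simp_rw [sub_mul]
  rw [Finset.sum_sub_distrib, ← Finset.mul_sum, e6]
  simp_rw [mul_comm (F u _)]
  ring

variable (h : M.IsVelocity κ c q q') (hκ : 0 < κ) (hq : M.IsTransition q)
  (hz : ∀ u v, q u v = 0 → q' u v = 0)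
include h hκ hq hz

/-- On the support of `q`, the dynamics is driven by the differences of the expected costs
and their weighted mean `β`. -/
theorem IsVelocity.reduced : ∃ (β : V → ℝ) (r : V → V → ℝ),
    (∀ u v, M.Adj u v → q' u v = -(κ * (M.η u v / M.len u v) * (q u v + M.δ u v) * r u v)) ∧
    (∀ u, ∑ v ∈ M.succs u, q' u v = 0) ∧
    (∀ u v, M.Adj u v → q u v = 0 → r u v = 0) ∧
    ∀ u v, M.Adj u v → q u v ≠ 0 → r u v = M.value q 0 c v - β u := by
  obtain ⟨β, α, hα, hs, hq'⟩ := h.spec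
  refine ⟨β, fun u v => M.value q 0 c v - α u v - β u, fun u v ha => ?_, hs, fun u v ha h0 => ?_,
    fun u v ha h0 => ?_⟩
  · rw [hq' u v ha]
    ring
  · have h1 := hq' u v ha
    rw [hz u v h0] at h1
    have h2 : 0 < κ * (M.η u v / M.len u v) * (q u v + M.δ u v) := by
      have := η_pos ha
      have := M.len_pos u v ha
      have := δ_pos ha
      have := hq.nonneg u v
      positivity
    have h3 := (mul_eq_zero.1 h1.symm).resolve_left h2.ne'
    linarith
  · have := (mul_eq_zero.1 (hα u v ha).2).resolve_right h0
    simp only [this]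
    ring

/-- Mass flows from arcs costlier than `β u` to cheaper ones: `q'` and `r` have opposite signs, and
`β u` may be subtracted because the velocities add up to 0. -/
theorem IsVelocity.sum_mul_value_nonpos (u : V) :
    ∑ v ∈ M.succs u, q' u v * M.value q 0 c v ≤ 0 := by
  obtain ⟨β, r, hr, hs, hr0, hr1⟩ := h.reduced hκ hq hz
  calc ∑ v ∈ M.succs u, q' u v * M.value q 0 c v
      ≤ ∑ v ∈ M.succs u, q' u v * β u := by
        refine Finset.sum_le_sum fun v hv => ?_
        have ha := M.mem_succs.1 hv
        by_cases h0 : q u v = 0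
        · rw [hz u v h0, zero_mul, zero_mul]
        · have hη := η_pos ha
          have hl := M.len_pos u v ha
          have hδ := δ_pos ha
          have hq0 := hq.nonneg u v
          have h1 := hr u v ha
          have h2 : q' u v * r u v ≤ 0 := by
            have : 0 ≤ κ * (M.η u v / M.len u v) * (q u v + M.δ u v) * (r u v * r u v) :=
              mul_nonneg (by positivity) (mul_self_nonneg _)
            rw [h1]
            linarith
          rw [hr1 u v ha h0] at h2
          linarith
    _ = 0 := by rw [← Finset.sum_mul, hs u, zero_mul]

/-- The rate of movement out of `u` is bounded by the change of the movement potential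
and the service costs. -/
theorem IsVelocity.movement_le (hc : ∀ x, 0 ≤ c x) {u : V} (hu : u ∉ Set.range M.sink) :
    ∑ v ∈ M.succs u, M.len u v * |q' u v| + 5 * ∑ v ∈ M.succs u, M.len u v * max (-q' u v) 0 ≤
      ∑ v ∈ M.succs u,
        M.len u v * (8 * q' u v - 14 * M.δ u v * (q' u v / (q u v + M.δ u v))) +
      14 * κ * ∑ v ∈ M.succs u, M.η u v * q u v * M.value q 0 c v := by
  obtain ⟨β, r, hr, hs, hr0, hr1⟩ := h.reduced hκ hq hz
  have hchat : ∀ u, 0 ≤ M.value q 0 c u :=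
    DAGOver.value_nonneg hq.nonneg (fun _ _ => le_rfl) hc
  -- If `β u` were negative, every arc in the support of `q` would lose mass.
  have hβ : 0 ≤ β u := by
    by_contra! hneg
    obtain ⟨v, hv, hpos⟩ : ∃ v ∈ M.succs u, 0 < q u v := by
      by_contra! hcon
      have h1 := hq.sum_succs hu
      have h2 := Finset.sum_nonpos hcon
      linarith
    have hterm : ∀ w ∈ M.succs u, q' u w ≤ 0 := fun w hw => by
      have ha := M.mem_succs.1 hw
      by_cases h0 : q u w = 0
      · exact (hz u w h0).le
      · have hη := η_pos ha
        have hl := M.len_pos u w ha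
        have hδ := δ_pos ha
        have hq0 := hq.nonneg u w
        rw [hr u w ha, hr1 u w ha h0, neg_nonpos]
        have : 0 ≤ M.value q 0 c w - β u := by linarith [hchat w]
        positivity
    have h0 := (Finset.sum_eq_zero_iff_of_nonpos hterm).1 (hs u) v hv
    have ha := M.mem_succs.1 hv
    have hη := η_pos ha
    have hl := M.len_pos u v ha
    have hδ := δ_pos ha
    have : 0 < M.value q 0 c v - β u := by linarith [hchat v]
    rw [hr u v ha, hr1 u v ha hpos.ne', neg_eq_zero] at h0
    have : 0 < κ * (M.η u v / M.len u v) * (q u v + M.δ u v) * (M.value q 0 c v - β u) := by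
      positivity
    linarith
  -- The extra term with `θ - q` disappears on summation, since both are probability distributions
  -- on the arcs leaving `u`.
  have key : ∀ v ∈ M.succs u, M.len u v * |q' u v| + 5 * (M.len u v * max (-q' u v) 0) ≤
      M.len u v * (8 * q' u v - 14 * M.δ u v * (q' u v / (q u v + M.δ u v))) +
      14 * κ * (M.η u v * q u v * M.value q 0 c v) +
      7 * κ * β u * (M.θ u v - q u v) := by
    intro v hv
    have ha := M.mem_succs.1 hv
    have hη := η_pos ha
    have hη1 := one_le_η ha
    have hl := M.len_pos u v ha
    have hδ := δ_pos ha
    have hθ := M.θ_pos u v ha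
    have hq0 := hq.nonneg u v
    have hηδ := η_mul_δ ha
    have e1 : M.len u v * q' u v = -(κ * (M.η u v * q u v + M.θ u v) * r u v) := by
      rw [hr u v ha, ← hηδ]
      field_simp
    have e2 : M.len u v * (M.δ u v * (q' u v / (q u v + M.δ u v))) = -(κ * M.θ u v * r u v) := by
      rw [hr u v ha, ← hηδ]
      field_simp
    -- Since `|a| = a + 2 * max (-a) 0`, the coefficient of the outgoing mass becomes `2 + 5 = 7`.
    -- This fixes the constants `8 = 1 + 7` and `14 = 2 * 7` of the potential.
    have e3 : M.len u v * |q' u v| + 5 * (M.len u v * max (-q' u v) 0) =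
        M.len u v * q' u v + 7 * (max (-(M.len u v * q' u v)) 0) := by
      rcases le_total (q' u v) 0 with hn | hn
      · rw [abs_of_nonpos hn, max_eq_left (by linarith), max_eq_left]
        · ring
        · linarith [mul_nonneg hl.le (neg_nonneg.2 hn)]
      · rw [abs_of_nonneg hn, max_eq_right (by linarith), max_eq_right]
        · ring
        · linarith [mul_nonneg hl.le hn]
    have e4 : M.len u v * (8 * q' u v - 14 * M.δ u v * (q' u v / (q u v + M.δ u v))) =
        M.len u v * q' u v - κ * 7 * ((M.η u v * q u v + M.θ u v) * r u v) +
          14 * κ * (M.θ u v * r u v) := by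
      linear_combination 7 * e1 - 14 * e2
    have e5 : max (-(M.len u v * q' u v)) 0 = κ * ((M.η u v * q u v + M.θ u v) * max (r u v) 0) := by
      have h0 : 0 ≤ M.η u v * q u v + M.θ u v := by positivity
      rw [e1, mul_max_of_nonneg _ _ h0, mul_max_of_nonneg _ _ hκ.le, mul_zero, mul_zero]
      congr 1
      ring
    -- For `r > 0` the sides without the last two terms differ by `2 * η * q * r`. In both cases
    -- what remains is nonnegative because `β ≥ 0` and `η ≥ 1`.
    have e6 : (M.η u v * q u v + M.θ u v) * max (r u v) 0 ≤
        (M.θ u v - M.η u v * q u v) * r u v + 2 * (M.η u v * q u v * M.value q 0 c v) +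
          β u * (M.θ u v - q u v) := by
      have h1 := mul_nonneg hβ hθ.le
      by_cases h0 : q u v = 0
      · rw [hr0 u v ha h0, h0]
        simpa using h1
      · rw [hr1 u v ha h0]
        have hcv := hchat v
        have h2 : 0 ≤ M.η u v * q u v := by positivity
        have h3 := mul_nonneg h2 hcv
        have h4 := mul_nonneg hθ.le hcv
        have h5 := mul_nonneg h2 hβ
        have h6 := mul_nonneg hβ (mul_nonneg (sub_nonneg.2 hη1) hq0)
        rcases le_total (M.value q 0 c v - β u) 0 with hn | hn
        · rw [max_eq_right hn]
          linarith
        · rw [max_eq_left hn]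
          linarith
    rw [e3, e4, e5]
    have e7 := mul_le_mul_of_nonneg_left e6 hκ.le
    linarith
  have hsum := Finset.sum_le_sum key
  rw [Finset.sum_add_distrib, Finset.sum_add_distrib, Finset.sum_add_distrib, ← Finset.mul_sum,
    ← Finset.mul_sum, ← Finset.mul_sum, Finset.sum_sub_distrib, sum_θ hu, hq.sum_succs hu,
    sub_self, mul_zero, add_zero] at hsum
  exact hsum

/-- The change of the expectation of a Lipschitz function at `u`. -/
theorem IsVelocity.test_le [MetricSpace X] (hc : ∀ x, 0 ≤ c x) (hM : M.IsGeometric 4) {ε : ℝ}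
    (hε : 0 < ε) (hMε : M.IsExpanding ε) {f : X → ℝ} (hf : ∀ x y, f x - f y ≤ dist x y) {u : V}
    (hu : u ∉ Set.range M.sink) :
    ∑ v ∈ M.succs u, q' u v * (ε * M.value q 0 f v) ≤
      (∑ v ∈ M.succs u,
        M.len u v * (8 * q' u v - 14 * M.δ u v * (q' u v / (q u v + M.δ u v))) +
        ∑ v ∈ M.succs u, q' u v * M.potential q v) +
      14 * κ * ∑ v ∈ M.succs u, M.η u v * q u v * M.value q 0 c v := by
  obtain ⟨β, r, hr, hs, hr0, hr1⟩ := h.reduced hκ hq hz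
  have h1 := h.movement_le hκ hq hz hc hu
  -- By expansion, mass can be rerouted among the children at cost `len` per unit leaving or
  -- entering an arc.
  have h2 : ∑ v ∈ M.succs u, q' u v * (ε * M.value q 0 f v) ≤
      ∑ v ∈ M.succs u, M.len u v * |q' u v| :=
    sum_mul_le_of_sub_le (hs u) (fun v hv => (M.len_pos u v (M.mem_succs.1 hv)).le)
      fun v hv v' hv' hne => value_sub_le hε hMε hq hf (M.mem_succs.1 hv) (M.mem_succs.1 hv') hne
  have h3 : ∑ v ∈ M.succs u, -(5 * (M.len u v * max (-q' u v) 0)) ≤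
      ∑ v ∈ M.succs u, q' u v * M.potential q v := by
    refine Finset.sum_le_sum fun v hv => ?_
    have h4 := potential_le_len hM hq (M.mem_succs.1 hv)
    have h5 := potential_nonneg hq v
    rcases le_total (q' u v) 0 with hn | hn
    · rw [max_eq_left (by linarith)]
      have := mul_le_mul_of_nonneg_left h4 (neg_nonneg.2 hn)
      linarith
    · rw [max_eq_right (by linarith)]
      have := mul_nonneg hn h5
      linarith
  rw [Finset.sum_neg_distrib, ← Finset.mul_sum] at h3
  linarith

end Velocity

end MarkedDAG

/-! ## Estimates along trajectories -/

theorem _root_.AbsolutelyContinuousOnInterval.congr {f g : ℝ → ℝ} {a b : ℝ}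
    (hf : AbsolutelyContinuousOnInterval f a b) (h : Set.EqOn f g (Set.uIcc a b)) :
    AbsolutelyContinuousOnInterval g a b := by
  rw [absolutelyContinuousOnInterval_iff] at hf ⊢
  intro e he
  obtain ⟨d, hd, h1⟩ := hf e he
  refine ⟨d, hd, fun E hE hl => ?_⟩
  refine lt_of_eq_of_lt (Finset.sum_congr rfl fun i hi => ?_) (h1 E hE hl)
  rw [← h (hE.1 i hi).1, ← h (hE.1 i hi).2]

/-- On `[0, ∞)` the shifted logarithm is Lipschitz with constant `1 / d`. The shift by `δ` thus
keeps the divergence and the potential regular where `q = 0`. -/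
theorem _root_.AbsolutelyContinuousOnInterval.log_add {f : ℝ → ℝ} {a b d : ℝ} (hd : 0 < d)
    (hf : AbsolutelyContinuousOnInterval f a b) (h0 : ∀ t ∈ Set.uIcc a b, 0 ≤ f t) :
    AbsolutelyContinuousOnInterval (fun t => Real.log (f t + d)) a b := by
  have key : ∀ x y : ℝ, 0 ≤ x → 0 ≤ y → Real.log (x + d) - Real.log (y + d) ≤ |x - y| / d := by
    intro x y hx hy
    rw [← Real.log_div (by positivity) (by positivity)]
    refine (Real.log_le_sub_one_of_pos (by positivity)).trans ?_
    have h1 : (x + d) / (y + d) - 1 = (x - y) / (y + d) := by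
      field_simp
      ring
    rw [h1]
    refine (div_le_div_of_nonneg_right (le_abs_self _) (by positivity)).trans ?_
    exact div_le_div_of_nonneg_left (abs_nonneg _) hd (by linarith)
  have hL : LipschitzOnWith (Real.toNNReal (1 / d)) (fun x => Real.log (x + d)) (Set.Ici 0) := by
    refine LipschitzOnWith.of_dist_le_mul fun x hx y hy => ?_
    rw [Real.coe_toNNReal _ (by positivity), Real.dist_eq, Real.dist_eq, abs_le]
    have h1 := key x y hx hy
    have h2 := key y x hy hx
    rw [abs_sub_comm] at h2
    constructor <;> linarith [show 1 / d * |x - y| = |x - y| / d by ring]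
  exact hL.comp_absolutelyContinuousOnInterval hf h0

namespace MarkedDAG

variable {X V : Type*} [Fintype V] {M : MarkedDAG X V}

theorem hasDerivAt_divg {F : V → V → ℝ} (hF : M.IsUnitFlow F) {q : ℝ → V → V → ℝ}
    {q' : V → V → ℝ} {t : ℝ} (hq : M.IsTransition (q t))
    (hd : ∀ u v, HasDerivAt (fun s => q s u v) (q' u v) t) :
    HasDerivAt (fun s => M.divg F (q s)) (∑ u, ∑ v ∈ M.succs u, M.len u v / M.η u v *
      (q' u v * M.outflow F u -
        (F u v + M.δ u v * M.outflow F u) * (q' u v / (q t u v + M.δ u v)))) t := by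
  refine HasDerivAt.fun_sum fun u _ => HasDerivAt.fun_sum fun v hv => ?_
  have hδ := δ_pos (M.mem_succs.1 hv)
  have hq0 := hq.nonneg u v
  have hp : 0 < F u v / M.outflow F u + M.δ u v :=
    add_pos_of_nonneg_of_pos (div_nonneg (hF.nonneg u v) (hF.outflow_nonneg u)) hδ
  have h1 : HasDerivAt (fun s => M.logRatio (fun u v => F u v / M.outflow F u) (q s) u v)
      (-(q' u v / (q t u v + M.δ u v))) t := by
    have h2 := (((hd u v).add_const (M.δ u v)).log (add_pos_of_nonneg_of_pos hq0 hδ).ne').const_sub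
      (Real.log (F u v / M.outflow F u + M.δ u v))
    have h3 : Filter.Eventually (fun s => 0 < q s u v + M.δ u v) (nhds t) :=
      ((hd u v).continuousAt.add continuousAt_const).eventually
        (lt_mem_nhds (add_pos_of_nonneg_of_pos hq0 hδ))
    refine h2.congr_of_eventuallyEq ?_
    filter_upwards [h3] with s hs
    exact Real.log_div hp.ne' hs.ne'
  have h4 := (((h1.const_mul (F u v + M.δ u v * M.outflow F u)).sub_const (F u v)).add
    ((hd u v).mul_const (M.outflow F u))).const_mul (M.len u v / M.η u v)
  convert! h4 using 1
  ring

theorem hasDerivAt_localPotential {q : ℝ → V → V → ℝ} {q' : V → V → ℝ} {t : ℝ}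
    (hq : M.IsTransition (q t)) (hd : ∀ u v, HasDerivAt (fun s => q s u v) (q' u v) t) (u : V) :
    HasDerivAt (fun s => M.localPotential (q s) u) (∑ v ∈ M.succs u,
      M.len u v * (8 * q' u v - 14 * M.δ u v * (q' u v / (q t u v + M.δ u v)))) t := by
  refine (HasDerivAt.fun_sum fun v hv => ?_).add_const _
  have hδ := δ_pos (M.mem_succs.1 hv)
  have hq0 := hq.nonneg u v
  have h1 := (((hd u v).add_const (M.δ u v)).div_const (M.δ u v)).log (by positivity)
  have h2 := (((hd u v).const_mul 8).sub (h1.const_mul (14 * M.δ u v))).const_mul (M.len u v)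
  convert! h2 using 1
  field_simp

theorem absolutelyContinuous_value {q : ℝ → V → V → ℝ} {a b : ℝ}
    (hac : ∀ u v, AbsolutelyContinuousOnInterval (fun t => q t u v) a b) (f : X → ℝ) (u : V) :
    AbsolutelyContinuousOnInterval (fun s => M.value (q s) 0 f u) a b :=
  DAGOver.value_absolutelyContinuous (h := fun _ => 0) hac
    (fun _ => absolutelyContinuousOnInterval_const 0 a b) u

section AC

variable {q : ℝ → V → V → ℝ} {a b : ℝ} (hq : ∀ t ∈ Set.uIcc a b, M.IsTransition (q t))
  (hac : ∀ u v, AbsolutelyContinuousOnInterval (fun t => q t u v) a b)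
include hq hac

theorem absolutelyContinuous_divg {F : V → V → ℝ} (hF : M.IsUnitFlow F) :
    AbsolutelyContinuousOnInterval (fun s => M.divg F (q s)) a b := by
  refine absolutelyContinuousOnInterval_sum _ fun u _ =>
    absolutelyContinuousOnInterval_sum _ fun v hv => ?_
  have hδ := δ_pos (M.mem_succs.1 hv)
  have hp : 0 < F u v / M.outflow F u + M.δ u v :=
    add_pos_of_nonneg_of_pos (div_nonneg (hF.nonneg u v) (hF.outflow_nonneg u)) hδ
  have h1 := (hac u v).log_add hδ fun t ht => (hq t ht).nonneg u v
  have h2 : AbsolutelyContinuousOnInterval (fun s => M.len u v / M.η u v *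
      ((F u v + M.δ u v * M.outflow F u) * (Real.log (F u v / M.outflow F u + M.δ u v) -
        Real.log (q s u v + M.δ u v)) - F u v + M.outflow F u * q s u v)) a b :=
    (((((absolutelyContinuousOnInterval_const _ a b).sub h1).const_mul _).sub
      (absolutelyContinuousOnInterval_const _ a b)).add ((hac u v).const_mul _)).const_mul _
  have h3 : Set.EqOn (fun s => M.len u v / M.η u v *
      ((F u v + M.δ u v * M.outflow F u) * (Real.log (F u v / M.outflow F u + M.δ u v) -
        Real.log (q s u v + M.δ u v)) - F u v + M.outflow F u * q s u v))
      (fun s => M.len u v / M.η u v * ((F u v + M.δ u v * M.outflow F u) *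
        M.logRatio (fun u v => F u v / M.outflow F u) (q s) u v -
          F u v + q s u v * M.outflow F u)) (Set.uIcc a b) := by
    intro s hs
    have hq0 := (hq s hs).nonneg u v
    dsimp only
    rw [logRatio, Real.log_div hp.ne' (by positivity), mul_comm (M.outflow F u) (q s u v)]
  exact h2.congr h3

theorem absolutelyContinuous_localPotential (u : V) :
    AbsolutelyContinuousOnInterval (fun s => M.localPotential (q s) u) a b := by
  refine (absolutelyContinuousOnInterval_sum _ fun v hv => ?_).add
    (absolutelyContinuousOnInterval_const _ a b)
  have hδ := δ_pos (M.mem_succs.1 hv)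
  have h1 := ((hac u v).const_mul (1 / M.δ u v)).log_add zero_lt_one fun t ht =>
    mul_nonneg (by positivity) ((hq t ht).nonneg u v)
  have h2 : ∀ s, (q s u v + M.δ u v) / M.δ u v = 1 / M.δ u v * q s u v + 1 := fun s => by
    field_simp
  simp_rw [h2]
  exact (((hac u v).const_mul 8).sub (h1.const_mul _)).const_mul _

theorem absolutelyContinuous_potential (u : V) :
    AbsolutelyContinuousOnInterval (fun s => M.potential (q s) u) a b :=
  DAGOver.value_absolutelyContinuous hac (absolutelyContinuous_localPotential hq hac) u

end AC

/-! ### Integrated estimates over one round -/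

namespace IsTrajectory

variable {κ : ℝ} {c : ℝ → X → ℝ} {q : ℝ → V → V → ℝ}

/-- Where `q` vanishes at a positive time it has a local minimum, so its derivative is 0 there. -/
theorem ae_velocity (h : M.IsTrajectory κ c q) : ∀ᵐ t, t ∈ Set.Ioi (0 : ℝ) → ∃ q' : V → V → ℝ,
    (∀ u v, HasDerivAt (fun s => q s u v) (q' u v) t) ∧ M.IsVelocity κ (c t) (q t) q' ∧
    ∀ u v, q t u v = 0 → q' u v = 0 := by
  have h1 := h.velocity
  rw [ae_restrict_iff' measurableSet_Ioi] at h1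
  filter_upwards [h1] with t ht ht0
  obtain ⟨q', hd, hv⟩ := ht ht0
  refine ⟨q', hd, hv, fun u v h0 => ?_⟩
  refine IsLocalMin.hasDerivAt_eq_zero ?_ (hd u v)
  filter_upwards [lt_mem_nhds (show (0 : ℝ) < t from ht0)] with s hs
  rw [h0]
  exact (h.transition s hs.le).nonneg u v

variable {cs : CostSeq X} (h : M.IsTrajectory κ (costPath cs) q) (hκ : 0 < κ) (k : ℕ)
include h

theorem ae_velocity_round : ∀ᵐ t, t ∈ Set.Ioo (k : ℝ) (k + 1) → ∃ q' : V → V → ℝ,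
    (∀ u v, HasDerivAt (fun s => q s u v) (q' u v) t) ∧
    M.IsVelocity κ (fun x => (cs k x : ℝ)) (q t) q' ∧ M.IsTransition (q t) ∧
    ∀ u v, q t u v = 0 → q' u v = 0 := by
  filter_upwards [h.ae_velocity] with t ht hk
  have h0 : 0 < t := (Nat.cast_nonneg k).trans_lt hk.1
  obtain ⟨q', h1, h2, h3⟩ := ht h0
  have h4 : costPath cs t = fun x => (cs k x : ℝ) := by
    funext x
    rw [costPath, (Nat.floor_eq_iff h0.le).2 ⟨hk.1.le, hk.2⟩]
  rw [h4] at h2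
  exact ⟨q', h1, h2, h.transition t h0.le, h3⟩

theorem transition_of_mem {s : ℝ} (hs : (k : ℝ) ≤ s) {t : ℝ} (ht : t ∈ Set.uIcc s (k + 1))
    (hs' : s ≤ k + 1) : M.IsTransition (q t) := by
  rw [Set.uIcc_of_le hs'] at ht
  exact h.transition t (((Nat.cast_nonneg k).trans hs).trans ht.1)

theorem absCont_round {s : ℝ} (hs : (k : ℝ) ≤ s) (hs' : s ≤ k + 1) (u v : V) :
    AbsolutelyContinuousOnInterval (fun t => q t u v) s (k + 1) := by
  refine (h.absCont (k + 1) (by positivity) u v).mono ?_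
  rw [Set.uIcc_of_le hs', Set.uIcc_of_le (by positivity)]
  exact Set.Icc_subset_Icc ((Nat.cast_nonneg k).trans hs) le_rfl

include hκ

/-- The instantaneous service cost is nonincreasing during a round. -/
theorem value_end_le {s : ℝ} (hs : (k : ℝ) ≤ s) (hs' : s ≤ k + 1) (u : V) :
    M.value (q (k + 1)) 0 (fun x => (cs k x : ℝ)) u ≤
      M.value (q s) 0 (fun x => (cs k x : ℝ)) u := by
  have hac := absolutelyContinuous_value (M := M) (h.absCont_round k hs hs') (fun x => (cs k x : ℝ)) u
  have h1 := h.ae_velocity_round k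
  -- The velocity is made a function of all times, as the integration lemma asks for a derivative
  -- defined everywhere.
  choose! q' hq' using fun t (ht : t ∈ Set.Ioo (k : ℝ) (k + 1) ∧ ∃ q' : V → V → ℝ,
    (∀ u v, HasDerivAt (fun s => q s u v) (q' u v) t) ∧
    M.IsVelocity κ (fun x => (cs k x : ℝ)) (q t) q' ∧ M.IsTransition (q t) ∧
    ∀ u v, q t u v = 0 → q' u v = 0) => ht.2
  have key := hac.sub_le_of_ae_le hs' (m := 0) (f' := fun t => M.value (q t)
    (fun u => 0 + ∑ v ∈ M.succs u, q' t u v * M.value (q t) 0 (fun x => (cs k x : ℝ)) v) 0 u) ?_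
  · linarith
  · filter_upwards [h1] with t ht hst
    have htk : t ∈ Set.Ioo (k : ℝ) (k + 1) := ⟨hs.trans_lt hst.1, hst.2⟩
    obtain ⟨hd, hv, htr, hz⟩ := hq' t ⟨htk, ht htk⟩
    refine ⟨DAGOver.value_hasDerivAt (h := fun _ => 0) hd (fun _ _ => hasDerivAt_const t 0) u, ?_⟩
    refine DAGOver.value_le_of_superharmonic (Y := 0) htr.nonneg (fun x => le_rfl)
      (fun u hu => ?_) u
    simpa using hv.sum_mul_value_nonpos hκ htr hz u

/-- The estimate for the derivative of the divergence is integrated over the round, with the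
instantaneous cost replaced by its smaller value at the end. -/
theorem service_le [Fintype X] {F : V → V → ℝ} {x : X} (hF : M.IsUnitFlowTo F x) :
    M.value (q (k + 1)) 0 (fun x => (cs k x : ℝ)) M.root ≤
      cs k x - (M.divg F (q (k + 1)) - M.divg F (q k)) / κ := by
  have hk : (k : ℝ) ≤ k + 1 := by linarith
  have hac := absolutelyContinuous_divg (fun t ht => h.transition_of_mem k le_rfl ht hk)
    (h.absCont_round k le_rfl hk) hF.1
  have h1 := h.ae_velocity_round k
  choose! q' hq' using fun t (ht : t ∈ Set.Ioo (k : ℝ) (k + 1) ∧ ∃ q' : V → V → ℝ,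
    (∀ u v, HasDerivAt (fun s => q s u v) (q' u v) t) ∧
    M.IsVelocity κ (fun x => (cs k x : ℝ)) (q t) q' ∧ M.IsTransition (q t) ∧
    ∀ u v, q t u v = 0 → q' u v = 0) => ht.2
  have key := hac.sub_le_of_ae_le hk
    (m := κ * (cs k x - M.value (q (k + 1)) 0 (fun x => (cs k x : ℝ)) M.root))
    (f' := fun t => ∑ u, ∑ v ∈ M.succs u, M.len u v / M.η u v * (q' t u v * M.outflow F u -
        (F u v + M.δ u v * M.outflow F u) * (q' t u v / (q t u v + M.δ u v)))) ?_
  · have h2 : (M.divg F (q (k + 1)) - M.divg F (q k)) / κ ≤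
        cs k x - M.value (q (k + 1)) 0 (fun x => (cs k x : ℝ)) M.root := by
      rw [div_le_iff₀' hκ]
      linarith
    linarith
  · filter_upwards [h1] with t ht htk
    obtain ⟨hd, hv, htr, hz⟩ := hq' t ⟨htk, ht htk⟩
    refine ⟨hasDerivAt_divg hF.1 htr hd, (hv.divg_deriv_le hκ htr hF).trans ?_⟩
    have := h.value_end_le hκ k htk.1.le htk.2.le M.root
    gcongr

/-- The integrated quantity is `ε` times the expectation of `f`, minus the movement potential, plus
`14 * R` times the divergence. The divergence absorbs the service cost, so no comparison between the
cost during the round and at its end is needed. -/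
theorem movement_le [Fintype X] [MetricSpace X] (hM : M.IsGeometric 4) {ε : ℝ}
    (hε : 0 < ε) (hMε : M.IsExpanding ε) {f : X → ℝ} (hf : ∀ x y, f x - f y ≤ dist x y)
    {F : V → V → ℝ} {x : X} (hF : M.IsUnitFlowTo F x) :
    ε * (M.value (q (k + 1)) 0 f M.root - M.value (q k) 0 f M.root) ≤
      M.potential (q (k + 1)) M.root - M.potential (q k) M.root +
      14 * ((M.combDepth : ℝ) + M.infoDepth) *
        (κ * cs k x - (M.divg F (q (k + 1)) - M.divg F (q k))) := by
  have hk : (k : ℝ) ≤ k + 1 := by linarith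
  have htr : ∀ t ∈ Set.uIcc (k : ℝ) (k + 1), M.IsTransition (q t) :=
    fun t ht => h.transition_of_mem k le_rfl ht hk
  have hq := h.absCont_round k le_rfl hk
  set R : ℝ := (M.combDepth : ℝ) + M.infoDepth with hR
  have hR0 : 0 ≤ R := add_nonneg (Nat.cast_nonneg _) infoDepth_nonneg
  have hac := (((absolutelyContinuous_value (M := M) hq f M.root).const_mul ε).sub
    (absolutelyContinuous_potential htr hq M.root)).add
    ((absolutelyContinuous_divg htr hq hF.1).const_mul (14 * R))
  have h1 := h.ae_velocity_round k
  choose! q' hq' using fun t (ht : t ∈ Set.Ioo (k : ℝ) (k + 1) ∧ ∃ q' : V → V → ℝ,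
    (∀ u v, HasDerivAt (fun s => q s u v) (q' u v) t) ∧
    M.IsVelocity κ (fun x => (cs k x : ℝ)) (q t) q' ∧ M.IsTransition (q t) ∧
    ∀ u v, q t u v = 0 → q' u v = 0) => ht.2
  have key := hac.sub_le_of_ae_le hk (m := 14 * R * (κ * cs k x))
    (f' := fun t => ε * M.value (q t)
        (fun u => 0 + ∑ v ∈ M.succs u, q' t u v * M.value (q t) 0 f v) 0 M.root -
      M.value (q t) (fun u => ∑ v ∈ M.succs u,
          M.len u v * (8 * q' t u v - 14 * M.δ u v * (q' t u v / (q t u v + M.δ u v))) +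
        ∑ v ∈ M.succs u, q' t u v * M.potential (q t) v) 0 M.root +
      14 * R * (∑ u, ∑ v ∈ M.succs u, M.len u v / M.η u v * (q' t u v * M.outflow F u -
        (F u v + M.δ u v * M.outflow F u) * (q' t u v / (q t u v + M.δ u v))))) ?_
  · simp only [Pi.add_apply, Pi.sub_apply] at key
    linarith
  · filter_upwards [h1] with t ht htk
    obtain ⟨hd, hv, htr, hz⟩ := hq' t ⟨htk, ht htk⟩
    refine ⟨(((DAGOver.value_hasDerivAt (h := fun _ => 0) hd
      (fun _ _ => hasDerivAt_const t 0) M.root).const_mul ε).sub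
      (DAGOver.value_hasDerivAt hd (fun u _ => hasDerivAt_localPotential htr hd u) M.root)).add
      ((hasDerivAt_divg hF.1 htr hd).const_mul (14 * R)), ?_⟩
    have hc : ∀ x, 0 ≤ (fun x => (cs k x : ℝ)) x := fun x => (cs k x).coe_nonneg
    have h2 := mul_le_mul_of_nonneg_left (hv.divg_deriv_le hκ htr hF)
      (show 0 ≤ 14 * R by positivity)
    have h3 := mul_le_mul_of_nonneg_left (M.value_η_le htr.nonneg hc)
      (show 0 ≤ 14 * κ by positivity)
    rw [← hR] at h3
    have h4 := DAGOver.value_mono (D := M.toDAGOver) (q := q t)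
      (h := ε • fun u => 0 + ∑ v ∈ M.succs u, q' t u v * M.value (q t) 0 f v)
      (h' := fun u => 1 * (∑ v ∈ M.succs u,
          M.len u v * (8 * q' t u v - 14 * M.δ u v * (q' t u v / (q t u v + M.δ u v))) +
        ∑ v ∈ M.succs u, q' t u v * M.potential (q t) v) + 14 * κ * ∑ v ∈ M.succs u,
          M.η u v * q t u v * M.value (q t) 0 (fun x => (cs k x : ℝ)) v)
      (b := fun x => ε * (0 : X → ℝ) x) (b' := fun x => 1 * (0 : X → ℝ) x + 14 * κ * (0 : X → ℝ) x)
      htr.nonneg (fun u hu => ?_) (fun x => by simp) M.root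
    · rw [DAGOver.value_mul, DAGOver.value_combine] at h4
      linarith
    · have h5 := hv.test_le hκ htr hz hc hM hε hMε hf hu
      simp only [Pi.smul_apply, smul_eq_mul, zero_add, one_mul]
      rw [Finset.mul_sum]
      refine le_trans (le_of_eq ?_) h5
      exact Finset.sum_congr rfl fun v _ => by ring

end IsTrajectory

end MarkedDAG

/-! ## Competitiveness -/

/-- Bounds on all finite horizons, for every offline strategy, give a bound by the offline
optimum. -/
theorem tsum_ofReal_le_offlineCost {X : Type*} [MetricSpace X] {ρ₀ : X} {c : CostSeq X} {g : ℕ → ℝ}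
    {a b : ℝ} (ha : 0 < a) (hg : ∀ t, 0 ≤ g t)
    (h : ∀ ρ : ℕ → X, ρ 0 = ρ₀ → ∀ T : ℕ, ∑ t ∈ Finset.range T, g t ≤
      a * ∑ t ∈ Finset.range T, ((c t (ρ (t + 1)) : ℝ) + dist (ρ t) (ρ (t + 1))) + b) :
    ∑' t, ENNReal.ofReal (g t) ≤ ENNReal.ofReal a * offlineCost ρ₀ c + ENNReal.ofReal b := by
  rw [offlineCost, ENNReal.mul_iInf_of_ne (by simpa using ha) ENNReal.ofReal_ne_top,
    ENNReal.iInf_add]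
  refine le_iInf fun ⟨ρ, hρ⟩ => ?_
  rw [ENNReal.tsum_eq_iSup_nat]
  refine iSup_le fun T => ?_
  rw [← ENNReal.ofReal_sum_of_nonneg fun t _ => hg t]
  refine (ENNReal.ofReal_le_ofReal (h ρ hρ T)).trans (ENNReal.ofReal_add_le.trans ?_)
  rw [ENNReal.ofReal_mul ha.le, ENNReal.ofReal_sum_of_nonneg fun t _ => by positivity]
  gcongr
  refine le_trans (le_of_eq ?_) (ENNReal.sum_le_tsum (Finset.range T))
  refine Finset.sum_congr rfl fun t _ => ?_
  rw [ENNReal.ofReal_add (by positivity) dist_nonneg, edist_dist, ENNReal.ofReal_coe_nnreal]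

namespace MarkedDAG

variable {X V : Type*} [Fintype X] [MetricSpace X] [Fintype V] {M : MarkedDAG X V}

/-- The Lipschitz constant of an expanding DAG is at least the expansion. -/
theorem IsLipschitz.expansion_le [Nontrivial X] {ε L : ℝ} (hε : 0 < ε) (hMε : M.IsExpanding ε)
    (hL : M.IsLipschitz L) : ε ≤ L := by
  obtain ⟨x, y, hxy⟩ := exists_pair_ne X
  obtain ⟨F, hF, hsum⟩ := hL 1 fun i => if i = 0 then x else y
  have hF0 := hF 0 (by norm_num)
  have hF1 := hF 1 le_rfl
  simp only [if_pos, one_ne_zero, if_false] at hF0 hF1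
  simp only [Finset.range_one, Finset.sum_singleton, if_pos, zero_add, one_ne_zero, if_false]
    at hsum
  -- The Lipschitz function `-ε * dist x` on the sinks, extended by 0, is the test function: it
  -- bounds `flowDist` from below by `ε * dist x y`.
  let R : V → ℝ := Function.extend M.sink (fun z => -(ε * dist x z)) 0
  have hR : ∀ z, R (M.sink z) = -(ε * dist x z) := fun z => M.sink.injective.extend_apply _ _ z
  have key := pairing_sub_le_flowDist (G := fun u v => R u - R v) zero_lt_one hF0.1 hF1.1
    fun γ γ' => by
      rw [γ.pathSum_sub, γ'.pathSum_sub, hR, hR, one_mul]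
      refine le_trans ?_ (hMε γ γ')
      have h1 := dist_triangle x γ.endpoint γ'.endpoint
      have h2 := mul_le_mul_of_nonneg_left h1 hε.le
      linarith
  rw [hF0.pairing_sub, hF1.pairing_sub, hR, hR, dist_self] at key
  have h3 : 0 < dist x y := dist_pos.2 hxy
  have h4 : ε * dist x y ≤ L * dist x y := by linarith
  exact le_of_mul_le_mul_right h4 h3

variable {κ L : ℝ} {c : CostSeq X} {q : ℝ → V → V → ℝ}

/-- Summation of the divergences along a path of flows to the positions of the offline player. -/
theorem IsTrajectory.exists_flows (h : M.IsTrajectory κ (costPath c) q) (hM : M.IsGeometric 4)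
    (hL : M.IsLipschitz L) {B : ℝ} (hB : ∀ F, M.IsUnitFlow F → M.divg F (q 0) ≤ B) (ρ : ℕ → X)
    (T : ℕ) : ∃ F : ℕ → V → V → ℝ, (∀ i ≤ T, M.IsUnitFlowTo (F i) (ρ i)) ∧
      -∑ k ∈ Finset.range T, (M.divg (F (k + 1)) (q (k + 1)) - M.divg (F (k + 1)) (q k)) ≤
        B + 6 * L * ∑ k ∈ Finset.range T, dist (ρ k) (ρ (k + 1)) := by
  obtain ⟨F, hF, hsum⟩ := hL T ρ
  refine ⟨F, hF, ?_⟩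
  have h1 : ∑ k ∈ Finset.range T, (M.divg (F (k + 1)) (q k) - M.divg (F k) (q k)) ≤
      6 * ∑ k ∈ Finset.range T, M.flowDist (F k) (F (k + 1)) := by
    rw [Finset.mul_sum]
    refine Finset.sum_le_sum fun k hk => ?_
    have hk' := Finset.mem_range.1 hk
    exact divg_sub_le_flowDist hM (hF k hk'.le).1 (hF (k + 1) hk').1
      (h.transition k (Nat.cast_nonneg k))
  -- The divergences telescope; the initial one is at most `B` and the final one is nonnegative.
  have h2 := Finset.sum_range_sub (fun k => M.divg (F k) (q k)) T
  have h3 := hB (F 0) (hF 0 (Nat.zero_le T)).1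
  have h4 := M.divg_nonneg (hF T le_rfl).1 (h.transition T (Nat.cast_nonneg T)).nonneg
  rw [Finset.sum_sub_distrib] at h1 h2 ⊢
  push_cast at h2
  linarith

theorem IsMirrorDescentAlgorithm.isCompetitive [Nontrivial X] {ε : ℝ} (hM : M.IsGeometric 4)
    (hε : 0 < ε) (hMε : M.IsExpanding ε) (hL : M.IsLipschitz L) {q₀ : V → V → ℝ}
    (hq₀ : M.IsTransition q₀) {alg : OnlineAlgorithm X}
    (halg : M.IsMirrorDescentAlgorithm (6 * L) q₀ alg) :
    IsCompetitive alg 1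
      (ENNReal.ofReal (84 * (L / ε * ((M.combDepth : ℝ) + M.infoDepth)))) := by
  have hL0 : 0 < L := hε.trans_le (hL.expansion_le hε hMε)
  have hκ : 0 < 6 * L := by positivity
  obtain ⟨B, hB⟩ := exists_divg_le hq₀
  set R : ℝ := (M.combDepth : ℝ) + M.infoDepth with hR
  have hR0 : 0 < R := add_pos_of_pos_of_nonneg (Nat.cast_pos.2 M.combDepth_pos) infoDepth_nonneg
  let b₁ : ℝ := B / (6 * L)
  -- The final movement potential is at most `20 * maxLen` at the root, and `B` bounds the initial
  -- divergence. Neither depends on the costs.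
  let b₂ : ℝ := (20 * M.maxLen M.root + 14 * R * B) / ε
  intro ρ₀
  refine ⟨b₁.toNNReal + b₂.toNNReal + 1, by positivity, fun c => ?_⟩
  obtain ⟨q, hq, htr, hst⟩ := halg c
  have hstate : ∀ (f : X → ℝ) (t : ℕ), ∑ x, f x * alg.state c t x =
      M.value (q t) 0 f M.root := fun f t => by
    obtain ⟨F, hF, hx⟩ := hst t
    simp_rw [hx]
    exact hF.sum_mul_inflow f
  have hbeta : ∀ b, b = b₁ ∨ b = b₂ →
      ENNReal.ofReal b ≤ ((b₁.toNNReal + b₂.toNNReal + 1 : ℝ≥0) : ℝ≥0∞) := by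
    intro b hb
    rw [ENNReal.ofReal]
    refine ENNReal.coe_le_coe.2 ?_
    rcases hb with rfl | rfl
    · exact (le_add_of_nonneg_right (zero_le)).trans (le_add_of_nonneg_right (zero_le))
    · exact (le_add_of_nonneg_left (zero_le)).trans (le_add_of_nonneg_right (zero_le))
  rw [← hq] at hB
  constructor
  · rw [← ENNReal.ofReal_one]
    refine (tsum_ofReal_le_offlineCost (b := b₁) zero_lt_one (fun t => ?_) fun ρ _ T => ?_).trans
      (add_le_add le_rfl (hbeta _ (Or.inl rfl)))
    · exact Finset.sum_nonneg fun x _ => mul_nonneg ((alg _ _).2.1 x) (c t x).coe_nonneg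
    · obtain ⟨F, hF, hsum⟩ := htr.exists_flows hM hL hB ρ T
      have h1 : ∑ t ∈ Finset.range T, ∑ x, alg.state c (t + 1) x * (c t x : ℝ) ≤
          ∑ t ∈ Finset.range T, (c t (ρ (t + 1)) -
            (M.divg (F (t + 1)) (q (t + 1)) - M.divg (F (t + 1)) (q t)) / (6 * L)) := by
        refine Finset.sum_le_sum fun t ht => ?_
        have h2 := htr.service_le hκ t (hF (t + 1) (Finset.mem_range.1 ht))
        have h3 := hstate (fun x => (c t x : ℝ)) (t + 1)
        push_cast at h3
        rw [← h3] at h2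
        simp_rw [mul_comm (alg.state c (t + 1) _)]
        exact h2
      rw [Finset.sum_sub_distrib, ← Finset.sum_div] at h1
      have h4 := div_le_div_of_nonneg_right hsum hκ.le
      rw [add_div, mul_div_cancel_left₀ _ hκ.ne', neg_div] at h4
      rw [Finset.sum_add_distrib]
      simp only [b₁]
      linarith
  · refine (tsum_ofReal_le_offlineCost (b := b₂) (by positivity) (fun t => transportCost_nonneg)
      fun ρ _ T => ?_).trans (add_le_add le_rfl (hbeta _ (Or.inr rfl)))
    obtain ⟨F, hF, hsum⟩ := htr.exists_flows hM hL hB ρ T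
    have h1 : ∑ t ∈ Finset.range T,
        transportCost (dist : X → X → ℝ) (alg.state c t) (alg.state c (t + 1)) ≤
        ∑ t ∈ Finset.range T, ((M.potential (q (t + 1)) M.root - M.potential (q t) M.root) +
          14 * R * (6 * L * c t (ρ (t + 1)) -
            (M.divg (F (t + 1)) (q (t + 1)) - M.divg (F (t + 1)) (q t)))) / ε := by
      refine Finset.sum_le_sum fun t ht => ?_
      refine transportCost_le_of_lipschitz (alg t _).2 (alg (t + 1) _).2 fun f hf => ?_
      -- The dual bound concerns the decrease of the expectation of `f`, hence `-f`.
      have h2 := htr.movement_le hκ t hM hε hMε (f := fun x => -f x)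
        (fun x y => by linarith [hf y x, dist_comm x y]) (hF (t + 1) (Finset.mem_range.1 ht))
      have h3 := hstate f (t + 1)
      push_cast at h3
      change ∑ x, f x * alg.state c t x - ∑ x, f x * alg.state c (t + 1) x ≤ _
      rw [hstate f t, h3, le_div_iff₀' hε]
      rw [DAGOver.value_neg, DAGOver.value_neg] at h2
      linarith
    have h5 := Finset.sum_range_sub (fun t => M.potential (q t) M.root) T
    have h6 := potential_le hM (htr.transition T (Nat.cast_nonneg T)) M.root
    have h7 := potential_nonneg (htr.transition (0 : ℕ) (Nat.cast_nonneg 0)) M.root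
    push_cast at h5
    refine h1.trans ?_
    rw [← Finset.sum_div, Finset.sum_add_distrib, h5, ← Finset.mul_sum, Finset.sum_sub_distrib,
      ← Finset.mul_sum, Finset.sum_add_distrib]
    have h8 : 84 * (L / ε * R) * (∑ t ∈ Finset.range T, (c t (ρ (t + 1)) : ℝ) +
        ∑ t ∈ Finset.range T, dist (ρ t) (ρ (t + 1))) + b₂ =
        (84 * L * R * (∑ t ∈ Finset.range T, (c t (ρ (t + 1)) : ℝ) +
        ∑ t ∈ Finset.range T, dist (ρ t) (ρ (t + 1))) +
          (20 * M.maxLen M.root + 14 * R * B)) / ε := by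
      simp only [b₂]
      field_simp
    rw [h8]
    refine div_le_div_of_nonneg_right ?_ hε.le
    have h9 := mul_le_mul_of_nonneg_left hsum (show 0 ≤ 14 * R by positivity)
    push_cast at h7
    linarith

end MarkedDAG

section

open scoped Topology
open Filter

/-! ## Limits of step functions along an ultrafilter -/

section StepFunctions

/-- The limit, along a fixed nonprincipal ultrafilter, of the step functions that take the
value `x n j` on the time interval `[j / (n + 1), (j + 1) / (n + 1))`. -/
def stepLimit (x : ℕ → ℕ → ℝ) (t : ℝ) : ℝ :=
  limUnder (hyperfilter ℕ : Filter ℕ) fun n => x n ⌊t * ((n : ℝ) + 1)⌋₊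

/-- The sequences `x n` have the same initial value, and on bounded time intervals the step
functions have uniformly bounded rates of change. -/
structure IsEquiLipschitz (x : ℕ → ℕ → ℝ) : Prop where
  zero_eq : ∀ n, x n 0 = x 0 0
  bound : ∀ m : ℕ, ∃ C : ℝ, 0 ≤ C ∧ ∀ n j : ℕ, j < (n + 1) * m →
    |x n (j + 1) - x n j| ≤ C / ((n : ℝ) + 1)

/-- Pairs of a fine mesh `1 / (n + 1)` and an index `j` of a grid point close to `t`. -/
def gridFilter (t : ℝ) : Filter (ℕ × ℕ) :=
  ((hyperfilter ℕ : Filter ℕ) ×ˢ ⊤) ⊓ comap (fun p => (p.2 : ℝ) / ((p.1 : ℝ) + 1)) (𝓝 t)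

theorem tendsto_one_div_hyperfilter :
    Tendsto (fun n : ℕ => 1 / ((n : ℝ) + 1)) (hyperfilter ℕ) (𝓝 0) :=
  tendsto_one_div_add_atTop_nhds_zero_nat.mono_left Nat.hyperfilter_le_atTop

theorem tendsto_floor_div_hyperfilter {t : ℝ} (ht : 0 ≤ t) :
    Tendsto (fun n : ℕ => (⌊t * ((n : ℝ) + 1)⌋₊ : ℝ) / ((n : ℝ) + 1)) (hyperfilter ℕ) (𝓝 t) := by
  have h1 : Tendsto (fun n : ℕ => (n : ℝ) + 1) (hyperfilter ℕ) atTop :=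
    (tendsto_atTop_add_const_right _ _ tendsto_natCast_atTop_atTop).mono_left
      Nat.hyperfilter_le_atTop
  exact (tendsto_nat_floor_mul_div_atTop ht).comp h1

theorem gridFilter_tendsto_fst (t : ℝ) : Tendsto Prod.fst (gridFilter t) (hyperfilter ℕ) :=
  tendsto_fst.mono_left inf_le_left

theorem gridFilter_tendsto_time (t : ℝ) :
    Tendsto (fun p : ℕ × ℕ => (p.2 : ℝ) / ((p.1 : ℝ) + 1)) (gridFilter t) (𝓝 t) :=
  tendsto_comap.mono_left inf_le_right

/-- Holding along `gridFilter t` means holding at all grid points near `t` simultaneously, which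
lets increments be summed. -/
theorem eventually_gridFilter {t : ℝ} {P : ℕ × ℕ → Prop} (h : ∀ᶠ p in gridFilter t, P p) :
    ∃ r > 0, ∀ᶠ n : ℕ in (hyperfilter ℕ : Filter ℕ), ∀ j : ℕ,
      |(j : ℝ) / ((n : ℝ) + 1) - t| < r → P (n, j) := by
  obtain ⟨s, hs, s', hs', hP⟩ := mem_inf_iff_superset.1 h
  obtain ⟨w, hw, hws⟩ := hs'
  obtain ⟨r, hr, hrw⟩ := Metric.mem_nhds_iff.1 hw
  refine ⟨r, hr, ?_⟩
  filter_upwards [mem_prod_top.1 hs] with n hn j hj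
  exact hP ⟨hn j, hws (hrw hj)⟩

theorem gridFilter_tendsto_succ (t : ℝ) :
    Tendsto (fun p : ℕ × ℕ => (p.1, p.2 + 1)) (gridFilter t) (gridFilter t) := by
  refine tendsto_inf.2 ⟨?_, tendsto_comap_iff.2 ?_⟩
  · exact (gridFilter_tendsto_fst t).prodMk tendsto_top
  · have h1 := (gridFilter_tendsto_time t).add
      (tendsto_one_div_hyperfilter.comp (gridFilter_tendsto_fst t))
    rw [add_zero] at h1
    refine h1.congr fun p => ?_
    simp only [Function.comp]
    push_cast
    ring

/-- Summation of the increments of a sequence. -/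
theorem abs_sub_sub_le_of_steps {x : ℕ → ℝ} {a e : ℝ} {i k : ℕ} (hik : i ≤ k)
    (h : ∀ j, i ≤ j → j < k → |x (j + 1) - x j - a| ≤ e) :
    |x k - x i - (k - i : ℝ) * a| ≤ (k - i : ℝ) * e := by
  induction k, hik using Nat.le_induction with
  | base => simp
  | succ k hik ih =>
    have h1 := ih fun j hj hjk => h j hj (hjk.trans (Nat.lt_succ_self k))
    have h2 := h k hik (Nat.lt_succ_self k)
    rw [abs_le] at h1 h2 ⊢
    push_cast
    constructor <;> linarith

theorem floor_mul_le {t : ℝ} {m n : ℕ} (ht : t ≤ m) : ⌊t * ((n : ℝ) + 1)⌋₊ ≤ (n + 1) * m := by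
  refine Nat.floor_le_of_le ?_
  push_cast
  nlinarith [Nat.cast_nonneg (α := ℝ) n]

namespace IsEquiLipschitz

variable {x : ℕ → ℕ → ℝ}

theorem exists_abs_sub_le (hx : IsEquiLipschitz x) (m : ℕ) : ∃ C : ℝ, 0 ≤ C ∧
    ∀ n i k : ℕ, i ≤ (n + 1) * m → k ≤ (n + 1) * m →
      |x n k - x n i| ≤ C * |(k : ℝ) / ((n : ℝ) + 1) - (i : ℝ) / ((n : ℝ) + 1)| := by
  obtain ⟨C, hC, h⟩ := hx.bound m
  have key : ∀ n i k : ℕ, i ≤ k → k ≤ (n + 1) * m →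
      |x n k - x n i| ≤ C * |(k : ℝ) / ((n : ℝ) + 1) - (i : ℝ) / ((n : ℝ) + 1)| := by
    intro n i k hik hk
    have h1 := abs_sub_sub_le_of_steps (x := x n) (a := 0) (e := C / ((n : ℝ) + 1)) hik
      fun j _ hj => by simpa using h n j (hj.trans_le hk)
    have h2 : (i : ℝ) ≤ k := Nat.cast_le.2 hik
    rw [mul_zero, sub_zero] at h1
    rw [← sub_div, abs_of_nonneg (div_nonneg (sub_nonneg.2 h2) (by positivity))]
    refine h1.trans (le_of_eq ?_)
    ring
  refine ⟨C, hC, fun n i k hi hk => ?_⟩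
  rcases le_total i k with hik | hik
  · exact key n i k hik hk
  · rw [abs_sub_comm, abs_sub_comm ((k : ℝ) / _)]
    exact key n k i hik hi

/-- The values stay in a compact interval, on which every ultrafilter converges; no subsequence is
chosen. -/
theorem tendsto_stepLimit (hx : IsEquiLipschitz x) (t : ℝ) :
    Tendsto (fun n => x n ⌊t * ((n : ℝ) + 1)⌋₊) (hyperfilter ℕ) (𝓝 (stepLimit x t)) := by
  obtain ⟨m, hm⟩ := exists_nat_ge t
  obtain ⟨C, hC, h⟩ := hx.exists_abs_sub_le m
  have hb : ∀ n, x n ⌊t * ((n : ℝ) + 1)⌋₊ ∈ Set.Icc (x 0 0 - C * m) (x 0 0 + C * m) := by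
    intro n
    have h1 := h n 0 _ (Nat.zero_le _) (floor_mul_le (n := n) hm)
    rw [hx.zero_eq] at h1
    have h2 : (⌊t * ((n : ℝ) + 1)⌋₊ : ℝ) / ((n : ℝ) + 1) ≤ m := by
      rw [div_le_iff₀ (by positivity)]
      have := floor_mul_le (n := n) hm
      have h3 : (⌊t * ((n : ℝ) + 1)⌋₊ : ℝ) ≤ (((n + 1) * m : ℕ) : ℝ) := Nat.cast_le.2 this
      push_cast at h3
      linarith
    have hnn : 0 ≤ (⌊t * ((n : ℝ) + 1)⌋₊ : ℝ) / ((n : ℝ) + 1) := by positivity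
    rw [Nat.cast_zero, zero_div, sub_zero, abs_of_nonneg hnn] at h1
    have h3 := h1.trans (mul_le_mul_of_nonneg_left h2 hC)
    rw [abs_le] at h3
    constructor <;> linarith
  obtain ⟨y, -, hy⟩ := (isCompact_Icc (a := x 0 0 - C * m) (b := x 0 0 + C * m)).ultrafilter_le_nhds
    ((hyperfilter ℕ).map fun n => x n ⌊t * ((n : ℝ) + 1)⌋₊)
    (le_principal_iff.2 (Filter.mem_map.2 (Filter.univ_mem' hb)))
  exact tendsto_nhds_limUnder ⟨y, hy⟩

theorem exists_abs_stepLimit_sub_le (hx : IsEquiLipschitz x) (m : ℕ) : ∃ C : ℝ, 0 ≤ C ∧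
    ∀ s ∈ Set.Icc (0 : ℝ) m, ∀ t ∈ Set.Icc (0 : ℝ) m,
      |stepLimit x s - stepLimit x t| ≤ C * |s - t| := by
  obtain ⟨C, hC, h⟩ := hx.exists_abs_sub_le m
  refine ⟨C, hC, fun s hs t ht => ?_⟩
  refine le_of_tendsto_of_tendsto
    ((hx.tendsto_stepLimit s).sub (hx.tendsto_stepLimit t)).abs
    (((tendsto_floor_div_hyperfilter hs.1).sub (tendsto_floor_div_hyperfilter ht.1)).abs.const_mul
      C) (Eventually.of_forall fun n => ?_)
  exact h n _ _ (floor_mul_le ht.2) (floor_mul_le hs.2)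

theorem absolutelyContinuous (hx : IsEquiLipschitz x) {T : ℝ} (hT : 0 ≤ T) :
    AbsolutelyContinuousOnInterval (stepLimit x) 0 T := by
  obtain ⟨m, hm⟩ := exists_nat_ge T
  obtain ⟨C, hC, h⟩ := hx.exists_abs_stepLimit_sub_le m
  refine LipschitzOnWith.absolutelyContinuousOnInterval (K := ⟨C, hC⟩) ?_
  rw [Set.uIcc_of_le hT]
  refine LipschitzOnWith.of_dist_le_mul fun s hs t ht => ?_
  exact h s ⟨hs.1, hs.2.trans hm⟩ t ⟨ht.1, ht.2.trans hm⟩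

theorem ae_differentiableAt (hx : IsEquiLipschitz x) :
    ∀ᵐ t, 0 < t → DifferentiableAt ℝ (stepLimit x) t := by
  have h : ∀ᵐ t, ∀ m : ℕ, t ∈ Set.uIcc (0 : ℝ) m → DifferentiableAt ℝ (stepLimit x) t :=
    ae_all_iff.2 fun m => (hx.absolutelyContinuous (Nat.cast_nonneg m)).ae_differentiableAt
  filter_upwards [h] with t ht ht0
  obtain ⟨m, hm⟩ := exists_nat_ge t
  exact ht m (by rw [Set.uIcc_of_le (Nat.cast_nonneg m)]; exact ⟨ht0.le, hm⟩)

/-- Locally uniform convergence. -/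
theorem tendsto_gridFilter (hx : IsEquiLipschitz x) {t : ℝ} (ht : 0 ≤ t) :
    Tendsto (fun p : ℕ × ℕ => x p.1 p.2) (gridFilter t) (𝓝 (stepLimit x t)) := by
  obtain ⟨m, hm⟩ := exists_nat_gt t
  obtain ⟨C, hC, h⟩ := hx.exists_abs_sub_le m
  have h1 := (hx.tendsto_stepLimit t).comp (gridFilter_tendsto_fst t)
  have h2 : Tendsto (fun p : ℕ × ℕ => x p.1 p.2 - x p.1 ⌊t * ((p.1 : ℝ) + 1)⌋₊) (gridFilter t)
      (𝓝 0) := by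
    refine squeeze_zero_norm' (a := fun p : ℕ × ℕ => C * |(p.2 : ℝ) / ((p.1 : ℝ) + 1) -
      (⌊t * ((p.1 : ℝ) + 1)⌋₊ : ℝ) / ((p.1 : ℝ) + 1)|) ?_ ?_
    · filter_upwards [(gridFilter_tendsto_time t).eventually (gt_mem_nhds hm)] with p hp
      refine h _ _ _ (floor_mul_le hm.le) ?_
      rw [div_lt_iff₀ (by positivity)] at hp
      have : (p.2 : ℝ) ≤ (((p.1 + 1) * m : ℕ) : ℝ) := by
        push_cast
        linarith
      exact_mod_cast this
    · have h3 := (((gridFilter_tendsto_time t).sub ((tendsto_floor_div_hyperfilter ht).comp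
        (gridFilter_tendsto_fst t))).abs).const_mul C
      simpa using h3
  have h4 := h2.add h1
  rw [zero_add] at h4
  refine h4.congr fun p => ?_
  simp

/-- All difference quotients on grid points near `t` are within `e` of `a`; summing them between two
times and passing to the limit bounds the increments of the limit. -/
theorem hasDerivAt (hx : IsEquiLipschitz x) {t a : ℝ} (ht : 0 < t)
    (h : Tendsto (fun p : ℕ × ℕ => ((p.1 : ℝ) + 1) * (x p.1 (p.2 + 1) - x p.1 p.2)) (gridFilter t)
      (𝓝 a)) : HasDerivAt (stepLimit x) a t := by
  rw [hasDerivAt_iff_isLittleO, Asymptotics.isLittleO_iff]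
  intro e he
  obtain ⟨r, hr, hev⟩ := eventually_gridFilter (h.eventually (Metric.closedBall_mem_nhds a he))
  have key : ∀ s₁ s₂ : ℝ, 0 < s₁ → s₁ ≤ s₂ → |s₁ - t| < r / 2 → |s₂ - t| < r / 2 →
      |stepLimit x s₂ - stepLimit x s₁ - (s₂ - s₁) * a| ≤ (s₂ - s₁) * e := by
    intro s₁ s₂ h0 h12 h1 h2
    have hd := (tendsto_floor_div_hyperfilter (h0.le.trans h12)).sub
      (tendsto_floor_div_hyperfilter h0.le)
    refine le_of_tendsto_of_tendsto (((hx.tendsto_stepLimit s₂).sub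
      (hx.tendsto_stepLimit s₁)).sub (hd.mul_const a)).abs (hd.mul_const e) ?_
    filter_upwards [hev, tendsto_one_div_hyperfilter.eventually (gt_mem_nhds (half_pos hr))]
      with n hn hnr
    have hN : (0 : ℝ) < (n : ℝ) + 1 := by positivity
    have hle : ⌊s₁ * ((n : ℝ) + 1)⌋₊ ≤ ⌊s₂ * ((n : ℝ) + 1)⌋₊ := by gcongr
    have h3 := abs_sub_sub_le_of_steps (x := x n) (a := a / ((n : ℝ) + 1))
      (e := e / ((n : ℝ) + 1)) hle fun j hj hj' => by
        have h4 : |(j : ℝ) / ((n : ℝ) + 1) - t| < r := by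
          -- Rounding down can place a grid point before `s₁`, but by less than one mesh.
          have h5 : s₁ - 1 / ((n : ℝ) + 1) < (j : ℝ) / ((n : ℝ) + 1) := by
            rw [lt_div_iff₀ hN, sub_mul, one_div_mul_cancel hN.ne']
            have h6 := Nat.lt_floor_add_one (s₁ * ((n : ℝ) + 1))
            have h7 : (⌊s₁ * ((n : ℝ) + 1)⌋₊ : ℝ) ≤ j := Nat.cast_le.2 hj
            linarith
          have h6 : (j : ℝ) / ((n : ℝ) + 1) ≤ s₂ := by
            rw [div_le_iff₀ hN]
            have h7 : (j : ℝ) ≤ (⌊s₂ * ((n : ℝ) + 1)⌋₊ : ℝ) := Nat.cast_le.2 hj'.le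
            exact h7.trans (Nat.floor_le (mul_nonneg (h0.le.trans h12) hN.le))
          rw [abs_lt] at h1 h2 ⊢
          constructor <;> linarith
        have h5 := hn j h4
        rw [Real.dist_eq] at h5
        have h6 : x n (j + 1) - x n j - a / ((n : ℝ) + 1) =
            (((n : ℝ) + 1) * (x n (j + 1) - x n j) - a) / ((n : ℝ) + 1) := by
          field_simp
        rw [h6, abs_div, abs_of_pos hN]
        gcongr
    refine (le_of_eq (congrArg abs ?_)).trans (h3.trans (le_of_eq ?_)) <;> ring
  have hnear : ∀ᶠ s in 𝓝 t, 0 < s ∧ |s - t| < r / 2 :=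
    (lt_mem_nhds ht).and (Metric.ball_mem_nhds t (half_pos hr))
  have htt : |t - t| < r / 2 := by simpa using hr
  filter_upwards [hnear] with s hs
  rw [smul_eq_mul, Real.norm_eq_abs, Real.norm_eq_abs]
  rcases le_total t s with hts | hts
  · rw [abs_of_nonneg (sub_nonneg.2 hts), mul_comm e]
    exact key t s ht hts htt hs.2
  · have h1 := key s t hs.1 hts hs.2 htt
    rw [abs_of_nonpos (sub_nonpos.2 hts), mul_comm e, neg_sub, ← abs_neg]
    refine (le_of_eq (congrArg abs ?_)).trans h1
    ring

end IsEquiLipschitz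

end StepFunctions

/-! ## Existence of trajectories -/

namespace MarkedDAG

variable {X V : Type*} [Fintype V] {M : MarkedDAG X V} {κ : ℝ}

/-- The rate of the dynamics on an arc. -/
def rate (M : MarkedDAG X V) (κ : ℝ) (u v : V) : ℝ := κ * (M.η u v / M.len u v)

theorem rate_pos (hκ : 0 < κ) {u v : V} (h : M.Adj u v) : 0 < M.rate κ u v :=
  mul_pos hκ (div_pos (η_pos h) (M.len_pos u v h))

/-- The transition probabilities with dual coordinates `z`. -/
def primal (M : MarkedDAG X V) (κ : ℝ) (z : V → V → ℝ) (u v : V) : ℝ :=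
  if M.Adj u v then M.δ u v * (Real.exp (M.rate κ u v * z u v) - 1) else 0

/-- The dual coordinates of transition probabilities. -/
def dual (M : MarkedDAG X V) (κ : ℝ) (q : V → V → ℝ) (u v : V) : ℝ :=
  if M.Adj u v then Real.log ((q u v + M.δ u v) / M.δ u v) / M.rate κ u v else 0

theorem primal_of_adj {z : V → V → ℝ} {u v : V} (h : M.Adj u v) :
    M.primal κ z u v = M.δ u v * (Real.exp (M.rate κ u v * z u v) - 1) := if_pos h

theorem primal_dual (hκ : 0 < κ) {q : V → V → ℝ} (hq : M.IsTransition q) :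
    M.primal κ (M.dual κ q) = q := by
  funext u v
  by_cases h : M.Adj u v
  · have hδ := δ_pos h
    have hq0 := hq.nonneg u v
    rw [primal_of_adj h, dual, if_pos h, mul_div_cancel₀ _ (rate_pos hκ h).ne',
      Real.exp_log (by positivity)]
    field_simp
    ring
  · rw [primal, if_neg h, hq.support u v h]

/-- `z` are the dual coordinates of transition probabilities. -/
structure IsDual (M : MarkedDAG X V) (κ : ℝ) (z : V → V → ℝ) : Prop where
  nonneg : ∀ u v, 0 ≤ z u v
  sum_eq_one : ∀ u, u ∉ Set.range M.sink → ∑ v ∈ M.succs u, M.primal κ z u v = 1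

theorem IsDual.isTransition (hκ : 0 < κ) {z : V → V → ℝ} (hz : M.IsDual κ z) :
    M.IsTransition (M.primal κ z) where
  support u v h := if_neg h
  nonneg u v := by
    rw [primal]
    split_ifs with h
    · refine mul_nonneg (δ_pos h).le (sub_nonneg.2 (Real.one_le_exp ?_))
      exact mul_nonneg (rate_pos hκ h).le (hz.nonneg u v)
    · exact le_rfl
  sum_eq_one := hz.sum_eq_one

theorem isDual_dual (hκ : 0 < κ) {q : V → V → ℝ} (hq : M.IsTransition q) :
    M.IsDual κ (M.dual κ q) where
  nonneg u v := by
    rw [dual]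
    split_ifs with h
    · refine div_nonneg (Real.log_nonneg ?_) (rate_pos hκ h).le
      rw [le_div_iff₀ (δ_pos h)]
      linarith [hq.nonneg u v]
    · exact le_rfl
  sum_eq_one u hu := by
    rw [primal_dual hκ hq]
    exact hq.sum_succs hu

theorem continuous_primal : Continuous (M.primal κ) := by
  refine continuous_pi fun u => continuous_pi fun v => ?_
  simp only [primal]
  split_ifs
  · fun_prop
  · exact continuous_const

/-- One step of the projected scheme: after subtracting the costs `e` and truncating at `0`, the
dual coordinates can be shifted so that the probabilities add up to `1` again. -/
theorem IsDual.exists_shift (hκ : 0 < κ) {z e : V → V → ℝ} (hz : M.IsDual κ z) {E : ℝ}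
    (he : ∀ u v, 0 ≤ e u v ∧ e u v ≤ E) : ∃ b : V → ℝ, (∀ u, 0 ≤ b u ∧ b u ≤ E) ∧
      M.IsDual κ fun u v => max 0 (z u v + b u - e u v) := by
  have key : ∀ u, ∃ b, (0 ≤ b ∧ b ≤ E) ∧ (u ∉ Set.range M.sink →
      ∑ v ∈ M.succs u, M.δ u v *
        (Real.exp (M.rate κ u v * max 0 (z u v + b - e u v)) - 1) = 1) := by
    intro u
    have hE : 0 ≤ E := (he u u).1.trans (he u u).2
    by_cases hu : u ∈ Set.range M.sink
    · exact ⟨0, ⟨le_rfl, hE⟩, fun h => absurd hu h⟩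
    let φ : ℝ → ℝ := fun b => ∑ v ∈ M.succs u, M.δ u v *
      (Real.exp (M.rate κ u v * max 0 (z u v + b - e u v)) - 1)
    have hφ : Continuous φ := by fun_prop
    have hsum := hz.sum_eq_one u hu
    have h0 : φ 0 ≤ 1 := by
      rw [← hsum]
      refine Finset.sum_le_sum fun v hv => ?_
      have h := M.mem_succs.1 hv
      have hr := rate_pos hκ h
      have hδ := δ_pos h
      rw [primal_of_adj h]
      gcongr
      exact max_le (hz.nonneg u v) (by linarith [(he u v).1])
    have h1 : 1 ≤ φ E := by
      rw [← hsum]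
      refine Finset.sum_le_sum fun v hv => ?_
      have h := M.mem_succs.1 hv
      have hr := rate_pos hκ h
      have hδ := δ_pos h
      rw [primal_of_adj h]
      gcongr
      exact le_max_of_le_right (by linarith [(he u v).2])
    -- With shift 0 no coordinate increases and with shift `E` none decreases, so the total
    -- probability passes through 1.
    obtain ⟨b, hb, hb1⟩ := intermediate_value_Icc hE hφ.continuousOn ⟨h0, h1⟩
    exact ⟨b, hb, fun _ => hb1⟩
  choose b hb hb1 using key
  refine ⟨b, hb, fun u v => le_max_left _ _, fun u hu => ?_⟩
  rw [← hb1 u hu]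
  exact Finset.sum_congr rfl fun v hv => primal_of_adj (M.mem_succs.1 hv)

/-- The expected costs of the vertices in the state with dual coordinates `z`. -/
def dualCost (M : MarkedDAG X V) (κ : ℝ) (c : X → ℝ≥0) (z : V → V → ℝ) : V → ℝ :=
  M.value (M.primal κ z) 0 fun x => (c x : ℝ)

/-- The shift in a step of length `h` of the projected scheme. -/
def shift [Fintype X] (M : MarkedDAG X V) (κ h : ℝ) (c : X → ℝ≥0) (z : V → V → ℝ) : V → ℝ :=
  if H : ∃ b : V → ℝ, (∀ u, 0 ≤ b u ∧ b u ≤ h * ∑ x, (c x : ℝ)) ∧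
    M.IsDual κ fun u v => max 0 (z u v + b u - h * M.dualCost κ c z v) then H.choose else 0

variable [Fintype X]

/-- The projected scheme with step length `1 / (n + 1)`. -/
def scheme (M : MarkedDAG X V) (κ : ℝ) (q₀ : V → V → ℝ) (c : CostSeq X) (n : ℕ) : ℕ → V → V → ℝ
  | 0 => M.dual κ q₀
  | k + 1 => fun u v =>
      max 0 (scheme M κ q₀ c n k u v +
        M.shift κ (1 / ((n : ℝ) + 1)) (c (k / (n + 1))) (scheme M κ q₀ c n k) u -
        1 / ((n : ℝ) + 1) * M.dualCost κ (c (k / (n + 1))) (scheme M κ q₀ c n k) v)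

/-- The scheme only uses the costs that have already arrived. -/
theorem scheme_congr (q₀ : V → V → ℝ) {c c' : CostSeq X} {t n : ℕ} (h : ∀ i < t, c i = c' i)
    {k : ℕ} (hk : k ≤ t * (n + 1)) : M.scheme κ q₀ c n k = M.scheme κ q₀ c' n k := by
  induction k with
  | zero => rfl
  | succ k ih =>
    rw [scheme, scheme, ih (by omega), h _ (Nat.div_lt_of_lt_mul (by rw [mul_comm]; omega))]

theorem dualCost_mem (hκ : 0 < κ) (c : X → ℝ≥0) {z : V → V → ℝ} (hz : M.IsDual κ z) (v : V) :
    0 ≤ M.dualCost κ c z v ∧ M.dualCost κ c z v ≤ ∑ x, (c x : ℝ) := by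
  have hq := hz.isTransition hκ
  refine ⟨DAGOver.value_nonneg hq.nonneg (fun _ _ => le_rfl) (fun x => (c x).coe_nonneg) v,
    DAGOver.value_le_of_reachable hq fun x _ => ?_⟩
  exact Finset.single_le_sum (f := fun x => (c x : ℝ)) (fun x _ => (c x).coe_nonneg)
    (Finset.mem_univ x)

theorem shift_spec (hκ : 0 < κ) {h : ℝ} (hh : 0 ≤ h) (c : X → ℝ≥0) {z : V → V → ℝ}
    (hz : M.IsDual κ z) : (∀ u, 0 ≤ M.shift κ h c z u ∧ M.shift κ h c z u ≤ h * ∑ x, (c x : ℝ)) ∧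
    M.IsDual κ fun u v => max 0 (z u v + M.shift κ h c z u - h * M.dualCost κ c z v) := by
  have H := hz.exists_shift hκ (e := fun _ v => h * M.dualCost κ c z v)
    (E := h * ∑ x, (c x : ℝ)) fun u v => by
      have h1 := dualCost_mem hκ c hz v
      exact ⟨mul_nonneg hh h1.1, mul_le_mul_of_nonneg_left h1.2 hh⟩
  rw [shift, dif_pos H]
  exact H.choose_spec

/-! ### Uniform estimates for the projected scheme -/

section Scheme

variable (hκ : 0 < κ) {q₀ : V → V → ℝ} (hq₀ : M.IsTransition q₀) (c : CostSeq X)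

/-- The accumulated shifts of the scheme. -/
def schemeShift (M : MarkedDAG X V) (κ : ℝ) (q₀ : V → V → ℝ) (c : CostSeq X) (u : V) (n k : ℕ) :
    ℝ :=
  ∑ j ∈ Finset.range k,
    M.shift κ (1 / ((n : ℝ) + 1)) (c (j / (n + 1))) (M.scheme κ q₀ c n j) u

/-- The accumulated expected costs of the scheme. -/
def schemeCost (M : MarkedDAG X V) (κ : ℝ) (q₀ : V → V → ℝ) (c : CostSeq X) (v : V) (n k : ℕ) :
    ℝ :=
  ∑ j ∈ Finset.range k,
    1 / ((n : ℝ) + 1) * M.dualCost κ (c (j / (n + 1))) (M.scheme κ q₀ c n j) v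

/-- The accumulated truncations of the scheme. -/
def schemeReflection (M : MarkedDAG X V) (κ : ℝ) (q₀ : V → V → ℝ) (c : CostSeq X) (u v : V)
    (n k : ℕ) : ℝ :=
  M.scheme κ q₀ c n k u v - M.dual κ q₀ u v - M.schemeShift κ q₀ c u n k +
    M.schemeCost κ q₀ c v n k

include hκ hq₀

theorem isDual_scheme (n k : ℕ) : M.IsDual κ (M.scheme κ q₀ c n k) := by
  induction k with
  | zero => exact isDual_dual hκ hq₀
  | succ k ih => exact (shift_spec hκ (by positivity) _ ih).2

/-- Steps before time `m` involve only the first `m` cost functions, whose total is a bound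
independent of the mesh. -/
theorem scheme_increments (m : ℕ) : ∃ C : ℝ, 0 ≤ C ∧ ∀ n j : ℕ, j < (n + 1) * m →
    ∀ u v, (0 ≤ M.shift κ (1 / ((n : ℝ) + 1)) (c (j / (n + 1))) (M.scheme κ q₀ c n j) u ∧
      M.shift κ (1 / ((n : ℝ) + 1)) (c (j / (n + 1))) (M.scheme κ q₀ c n j) u ≤
        C / ((n : ℝ) + 1)) ∧
      0 ≤ 1 / ((n : ℝ) + 1) * M.dualCost κ (c (j / (n + 1))) (M.scheme κ q₀ c n j) v ∧
      1 / ((n : ℝ) + 1) * M.dualCost κ (c (j / (n + 1))) (M.scheme κ q₀ c n j) v ≤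
        C / ((n : ℝ) + 1) := by
  refine ⟨∑ i ∈ Finset.range m, ∑ x, (c i x : ℝ), by positivity, fun n j hj u v => ?_⟩
  have hz := isDual_scheme hκ hq₀ c n j
  have hh : 0 ≤ 1 / ((n : ℝ) + 1) := by positivity
  have h1 := (shift_spec hκ hh (c (j / (n + 1))) hz).1 u
  have h2 := dualCost_mem hκ (c (j / (n + 1))) hz v
  have h3 : ∑ x, (c (j / (n + 1)) x : ℝ) ≤ ∑ i ∈ Finset.range m, ∑ x, (c i x : ℝ) :=
    Finset.single_le_sum (f := fun i => ∑ x, (c i x : ℝ)) (fun i _ => by positivity)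
      (Finset.mem_range.2 (Nat.div_lt_of_lt_mul hj))
  have h4 := mul_le_mul_of_nonneg_left h3 hh
  have h5 := mul_le_mul_of_nonneg_left h2.2 hh
  have hC : (∑ i ∈ Finset.range m, ∑ x, (c i x : ℝ)) / ((n : ℝ) + 1) =
      1 / ((n : ℝ) + 1) * ∑ i ∈ Finset.range m, ∑ x, (c i x : ℝ) := by ring
  rw [hC]
  exact ⟨⟨h1.1, h1.2.trans h4⟩, mul_nonneg hh h2.1, h5.trans h4⟩

theorem isEquiLipschitz_shift (u : V) : IsEquiLipschitz (M.schemeShift κ q₀ c u) where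
  zero_eq n := by simp [schemeShift]
  bound m := by
    obtain ⟨C, hC, h⟩ := scheme_increments hκ hq₀ c m
    refine ⟨C, hC, fun n j hj => ?_⟩
    obtain ⟨h1, -⟩ := h n j hj u u
    rw [schemeShift, schemeShift, Finset.sum_range_succ, add_sub_cancel_left, abs_of_nonneg h1.1]
    exact h1.2

theorem isEquiLipschitz_cost (v : V) : IsEquiLipschitz (M.schemeCost κ q₀ c v) where
  zero_eq n := by simp [schemeCost]
  bound m := by
    obtain ⟨C, hC, h⟩ := scheme_increments hκ hq₀ c m
    refine ⟨C, hC, fun n j hj => ?_⟩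
    obtain ⟨-, h1⟩ := h n j hj v v
    rw [schemeCost, schemeCost, Finset.sum_range_succ, add_sub_cancel_left, abs_of_nonneg h1.1]
    exact h1.2

/-- Truncation does not increase the speed: a coordinate that is truncated was nonnegative and at
most one cost increment. -/
theorem isEquiLipschitz_scheme (u v : V) :
    IsEquiLipschitz fun n k => M.scheme κ q₀ c n k u v where
  zero_eq n := rfl
  bound m := by
    obtain ⟨C, hC, h⟩ := scheme_increments hκ hq₀ c m
    refine ⟨C, hC, fun n j hj => ?_⟩
    obtain ⟨h1, h2⟩ := h n j hj u v
    have h3 := (isDual_scheme hκ hq₀ c n j).nonneg u v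
    have h4 : 0 ≤ C / ((n : ℝ) + 1) := by positivity
    rw [scheme, abs_le]
    beta_reduce
    rcases max_choice 0 (M.scheme κ q₀ c n j u v +
      M.shift κ (1 / ((n : ℝ) + 1)) (c (j / (n + 1))) (M.scheme κ q₀ c n j) u -
      1 / ((n : ℝ) + 1) * M.dualCost κ (c (j / (n + 1))) (M.scheme κ q₀ c n j) v) with h5 | h5
    · have h6 := max_eq_left_iff.1 h5
      rw [h5]
      constructor <;> linarith
    · rw [h5]
      constructor <;> linarith

theorem isEquiLipschitz_reflection (u v : V) :
    IsEquiLipschitz (M.schemeReflection κ q₀ c u v) where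
  zero_eq n := by simp [schemeReflection, scheme, schemeShift, schemeCost]
  bound m := by
    obtain ⟨C₁, hC₁, h₁⟩ := (isEquiLipschitz_scheme hκ hq₀ c u v).bound m
    obtain ⟨C₂, hC₂, h₂⟩ := (isEquiLipschitz_shift hκ hq₀ c u).bound m
    obtain ⟨C₃, hC₃, h₃⟩ := (isEquiLipschitz_cost hκ hq₀ c v).bound m
    refine ⟨C₁ + C₂ + C₃, by positivity, fun n j hj => ?_⟩
    have e₁ := h₁ n j hj
    have e₂ := h₂ n j hj
    have e₃ := h₃ n j hj
    rw [abs_le] at *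
    rw [add_div, add_div, schemeReflection, schemeReflection]
    constructor <;> linarith

omit hκ hq₀ in
theorem schemeReflection_succ (u v : V) (n k : ℕ) :
    M.schemeReflection κ q₀ c u v n (k + 1) - M.schemeReflection κ q₀ c u v n k =
      M.scheme κ q₀ c n (k + 1) u v - (M.scheme κ q₀ c n k u v +
        M.shift κ (1 / ((n : ℝ) + 1)) (c (k / (n + 1))) (M.scheme κ q₀ c n k) u -
        1 / ((n : ℝ) + 1) * M.dualCost κ (c (k / (n + 1))) (M.scheme κ q₀ c n k) v) := by
  rw [schemeReflection, schemeReflection, schemeShift, schemeShift, schemeCost, schemeCost,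
    Finset.sum_range_succ, Finset.sum_range_succ]
  ring

omit hκ hq₀ in
theorem monotone_schemeReflection (u v : V) (n : ℕ) :
    Monotone (M.schemeReflection κ q₀ c u v n) := by
  refine monotone_nat_of_le_succ fun k => ?_
  have h1 := schemeReflection_succ (M := M) (κ := κ) (q₀ := q₀) c u v n k
  have h2 := le_max_right 0 (M.scheme κ q₀ c n k u v +
    M.shift κ (1 / ((n : ℝ) + 1)) (c (k / (n + 1))) (M.scheme κ q₀ c n k) u -
    1 / ((n : ℝ) + 1) * M.dualCost κ (c (k / (n + 1))) (M.scheme κ q₀ c n k) v)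
  rw [scheme] at h1
  linarith

-- The discrete complementary slackness: nothing was truncated in a step that ends at a positive
-- value.
omit hκ hq₀ in
theorem schemeReflection_succ_of_pos {u v : V} {n k : ℕ}
    (h : 0 < M.scheme κ q₀ c n (k + 1) u v) :
    M.schemeReflection κ q₀ c u v n (k + 1) - M.schemeReflection κ q₀ c u v n k = 0 := by
  rw [schemeReflection_succ, sub_eq_zero]
  rw [scheme] at h ⊢
  exact max_eq_right ((lt_max_iff.1 h).resolve_left (lt_irrefl 0)).le

/-! ### The limit of the scheme -/

omit hκ hq₀ in
/-- The dual coordinates of the limit of the scheme. -/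
def _root_.MTS.MarkedDAG.limitDual (M : MarkedDAG X V) (κ : ℝ) (q₀ : V → V → ℝ) (c : CostSeq X)
    (t : ℝ) (u v : V) : ℝ := stepLimit (fun n k => M.scheme κ q₀ c n k u v) t

theorem tendsto_scheme (t : ℝ) : Tendsto (fun n : ℕ => M.scheme κ q₀ c n ⌊t * ((n : ℝ) + 1)⌋₊)
    (hyperfilter ℕ) (𝓝 (M.limitDual κ q₀ c t)) :=
  tendsto_pi_nhds.2 fun u => tendsto_pi_nhds.2 fun v =>
    (isEquiLipschitz_scheme hκ hq₀ c u v).tendsto_stepLimit t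

theorem isDual_limitDual (t : ℝ) : M.IsDual κ (M.limitDual κ q₀ c t) where
  nonneg u v := ge_of_tendsto' ((isEquiLipschitz_scheme hκ hq₀ c u v).tendsto_stepLimit t)
    fun n => (isDual_scheme hκ hq₀ c n _).nonneg u v
  sum_eq_one u hu := by
    have h1 := (continuous_primal (M := M) (κ := κ)).continuousAt.tendsto.comp
      (tendsto_scheme hκ hq₀ c t)
    have h2 : Tendsto (fun n : ℕ => ∑ v ∈ M.succs u,
        M.primal κ (M.scheme κ q₀ c n ⌊t * ((n : ℝ) + 1)⌋₊) u v) (hyperfilter ℕ)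
        (𝓝 (∑ v ∈ M.succs u, M.primal κ (M.limitDual κ q₀ c t) u v)) :=
      tendsto_finsetSum _ fun v _ => tendsto_pi_nhds.1 (tendsto_pi_nhds.1 h1 u) v
    refine tendsto_nhds_unique h2 (tendsto_const_nhds.congr fun n => ?_)
    exact ((isDual_scheme hκ hq₀ c n _).sum_eq_one u hu).symm

theorem monotone_reflection (u v : V) :
    Monotone (stepLimit (M.schemeReflection κ q₀ c u v)) := fun s t hst => by
  have h := isEquiLipschitz_reflection hκ hq₀ c u v
  refine le_of_tendsto_of_tendsto' (h.tendsto_stepLimit s) (h.tendsto_stepLimit t) fun n => ?_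
  exact monotone_schemeReflection c u v n (by gcongr)

theorem reflection_eq (u v : V) (t : ℝ) : stepLimit (M.schemeReflection κ q₀ c u v) t =
    M.limitDual κ q₀ c t u v - M.dual κ q₀ u v - stepLimit (M.schemeShift κ q₀ c u) t +
      stepLimit (M.schemeCost κ q₀ c v) t :=
  tendsto_nhds_unique ((isEquiLipschitz_reflection hκ hq₀ c u v).tendsto_stepLimit t)
    (((((isEquiLipschitz_scheme hκ hq₀ c u v).tendsto_stepLimit t).sub tendsto_const_nhds).sub
      ((isEquiLipschitz_shift hκ hq₀ c u).tendsto_stepLimit t)).add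
      ((isEquiLipschitz_cost hκ hq₀ c v).tendsto_stepLimit t))

/-- Between integers the cost function is fixed, so the increments per unit of time are a continuous
function of the state, and the state converges along the grid. -/
theorem hasDerivAt_cost {t : ℝ} (ht : 0 < t) (hfl : (⌊t⌋₊ : ℝ) < t) (v : V) :
    HasDerivAt (stepLimit (M.schemeCost κ q₀ c v))
      (M.dualCost κ (c ⌊t⌋₊) (M.limitDual κ q₀ c t) v) t := by
  refine (isEquiLipschitz_cost hκ hq₀ c v).hasDerivAt ht ?_
  have h1 : Tendsto (fun p : ℕ × ℕ => M.scheme κ q₀ c p.1 p.2) (gridFilter t)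
      (𝓝 (M.limitDual κ q₀ c t)) :=
    tendsto_pi_nhds.2 fun u => tendsto_pi_nhds.2 fun w =>
      (isEquiLipschitz_scheme hκ hq₀ c u w).tendsto_gridFilter ht.le
  have h2 : ContinuousAt (fun z => M.dualCost κ (c ⌊t⌋₊) z v) (M.limitDual κ q₀ c t) :=
    DAGOver.value_continuousAt (h := fun _ => 0)
      (fun u w => ((continuous_apply w).comp ((continuous_apply u).comp
        continuous_primal)).continuousAt) (fun _ => continuousAt_const) v
  refine (h2.tendsto.comp h1).congr' ?_
  filter_upwards [(gridFilter_tendsto_time t).eventually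
    (Ioo_mem_nhds hfl (Nat.lt_floor_add_one t))] with p hp
  have hN : (0 : ℝ) < (p.1 : ℝ) + 1 := by positivity
  have h3 : p.2 / (p.1 + 1) = ⌊t⌋₊ := by
    rw [← Nat.floor_div_eq_div (K := ℝ), Nat.floor_eq_iff (by positivity)]
    push_cast
    exact ⟨hp.1.le, hp.2⟩
  simp only [Function.comp]
  rw [schemeCost, schemeCost, Finset.sum_range_succ, add_sub_cancel_left, h3, ← mul_assoc,
    mul_one_div_cancel hN.ne', one_mul]

theorem hasDerivAt_reflection_of_pos {t : ℝ} (ht : 0 < t) {u v : V}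
    (h : 0 < M.limitDual κ q₀ c t u v) :
    HasDerivAt (stepLimit (M.schemeReflection κ q₀ c u v)) 0 t := by
  refine (isEquiLipschitz_reflection hκ hq₀ c u v).hasDerivAt ht ?_
  have h1 := ((isEquiLipschitz_scheme hκ hq₀ c u v).tendsto_gridFilter ht.le).comp
    (gridFilter_tendsto_succ t)
  refine tendsto_const_nhds.congr' ?_
  filter_upwards [h1.eventually (lt_mem_nhds h)] with p hp
  rw [schemeReflection_succ_of_pos c hp, mul_zero]

/-- The limit of the scheme is a trajectory. -/
theorem isTrajectory_limit :
    M.IsTrajectory κ (costPath c) fun t => M.primal κ (M.limitDual κ q₀ c t) where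
  transition t _ := (isDual_limitDual hκ hq₀ c t).isTransition hκ
  absCont T hT u v := by
    by_cases h : M.Adj u v
    · simp_rw [primal_of_adj h]
      have hac := (isEquiLipschitz_scheme hκ hq₀ c u v).absolutelyContinuous hT.le
      obtain ⟨B, hB⟩ := hac.exists_bound
      obtain ⟨K, hK⟩ := (show ContDiffOn ℝ 1 (fun y => M.δ u v *
        (Real.exp (M.rate κ u v * y) - 1)) (Set.Icc (-B) B) from
          ContDiff.contDiffOn (by fun_prop)).exists_lipschitzOnWith (by decide)
            (convex_Icc _ _) isCompact_Icc
      exact hK.comp_absolutelyContinuousOnInterval hac fun t ht => abs_le.1 (hB t ht)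
    · simp only [primal, if_neg h]
      exact absolutelyContinuousOnInterval_const 0 0 T
  velocity := by
    rw [ae_restrict_iff' measurableSet_Ioi]
    have hz : ∀ᵐ t, ∀ u v, 0 < t →
        DifferentiableAt ℝ (stepLimit fun n k => M.scheme κ q₀ c n k u v) t :=
      ae_all_iff.2 fun u => ae_all_iff.2 fun v =>
        (isEquiLipschitz_scheme hκ hq₀ c u v).ae_differentiableAt
    have hb : ∀ᵐ t, ∀ u, 0 < t → DifferentiableAt ℝ (stepLimit (M.schemeShift κ q₀ c u)) t :=
      ae_all_iff.2 fun u => (isEquiLipschitz_shift hκ hq₀ c u).ae_differentiableAt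
    -- The cost path jumps only at integers, which form a null set.
    have hn : ∀ᵐ t : ℝ, t ∉ Set.range ((↑) : ℕ → ℝ) :=
      (Set.countable_range _).ae_notMem _
    filter_upwards [hz, hb, hn] with t hz hb hn ht
    have ht0 : 0 < t := ht
    have hfl : (⌊t⌋₊ : ℝ) < t := (Nat.floor_le ht0.le).lt_of_ne fun h => hn ⟨_, h⟩
    let z' : V → V → ℝ := fun u v => deriv (stepLimit fun n k => M.scheme κ q₀ c n k u v) t
    let β : V → ℝ := fun u => deriv (stepLimit (M.schemeShift κ q₀ c u)) t
    let chat : V → ℝ := M.dualCost κ (c ⌊t⌋₊) (M.limitDual κ q₀ c t)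
    -- The derivative of the accumulated truncations: nonnegative by monotonicity, and zero where
    -- the coordinate is positive.
    let α : V → V → ℝ := fun u v => z' u v - β u + chat v
    have hdz : ∀ u v, HasDerivAt (fun s => M.limitDual κ q₀ c s u v) (z' u v) t :=
      fun u v => (hz u v ht0).hasDerivAt
    have hdα : ∀ u v, HasDerivAt (stepLimit (M.schemeReflection κ q₀ c u v)) (α u v) t := by
      intro u v
      have h1 := (((hdz u v).sub_const (M.dual κ q₀ u v)).sub (hb u ht0).hasDerivAt).add
        (hasDerivAt_cost hκ hq₀ c ht0 hfl v)
      refine h1.congr_of_eventuallyEq (Eventually.of_forall fun s => ?_)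
      exact reflection_eq hκ hq₀ c u v s
    have hα0 : ∀ u v, 0 ≤ α u v := fun u v => by
      have h1 := (monotone_reflection hκ hq₀ c u v).monotoneOn (s := Set.univ)
      have h2 := h1.derivWithin_nonneg (x := t)
      rwa [derivWithin_univ, (hdα u v).deriv] at h2
    let q' : V → V → ℝ := fun u v => if M.Adj u v then
      M.rate κ u v * (M.primal κ (M.limitDual κ q₀ c t) u v + M.δ u v) * z' u v else 0
    have hdq : ∀ u v, HasDerivAt (fun s => M.primal κ (M.limitDual κ q₀ c s) u v) (q' u v) t := by
      intro u v
      by_cases h : M.Adj u v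
      · simp_rw [q', primal_of_adj h, if_pos h]
        have h1 := ((((hdz u v).const_mul (M.rate κ u v)).exp).sub_const 1).const_mul (M.δ u v)
        convert! h1 using 1
        ring
      · simp only [q', primal, if_neg h]
        exact hasDerivAt_const t 0
    refine ⟨q', hdq, chat, β, α, fun x => DAGOver.value_sink x, fun u hu => ?_,
      fun u v h => ⟨hα0 u v, ?_⟩, fun u => ?_, fun u v h => ?_⟩
    · simp only [chat, dualCost]
      rw [DAGOver.value_step hu, Pi.zero_apply, zero_add]
      rfl
    · rcases ((isDual_limitDual hκ hq₀ c t).nonneg u v).eq_or_lt with h0 | h0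
      · rw [primal_of_adj h, ← h0, mul_zero, Real.exp_zero, sub_self, mul_zero, mul_zero]
      · rw [(hdα u v).unique (hasDerivAt_reflection_of_pos hκ hq₀ c ht0 h0), zero_mul]
    · by_cases hu : u ∈ Set.range M.sink
      · obtain ⟨x, rfl⟩ := hu
        exact M.outflow_sink _ x
      · have h1 : HasDerivAt (fun s => ∑ v ∈ M.succs u, M.primal κ (M.limitDual κ q₀ c s) u v)
            (∑ v ∈ M.succs u, q' u v) t := HasDerivAt.fun_sum fun v _ => hdq u v
        have h2 : (fun s => ∑ v ∈ M.succs u, M.primal κ (M.limitDual κ q₀ c s) u v) =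
            fun _ => 1 := funext fun s => (isDual_limitDual hκ hq₀ c s).sum_eq_one u hu
        rw [h2] at h1
        exact h1.unique (hasDerivAt_const t 1)
    · simp only [q', if_pos h, α, rate]
      ring

theorem limitDual_zero : M.limitDual κ q₀ c 0 = M.dual κ q₀ := by
  funext u v
  refine tendsto_nhds_unique ((isEquiLipschitz_scheme hκ hq₀ c u v).tendsto_stepLimit 0) ?_
  simp [scheme]

-- The grid index at the integer time `t` is exactly `t * (n + 1)`, and a state with that index uses
-- only the costs of the first `t` rounds.
omit hκ hq₀ in
theorem limitDual_congr {c c' : CostSeq X} {t : ℕ} (h : ∀ i < t, c i = c' i) :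
    M.limitDual κ q₀ c t = M.limitDual κ q₀ c' t := by
  funext u v
  rw [limitDual, limitDual, stepLimit, stepLimit]
  congr 1
  funext n
  have h1 : ⌊(t : ℝ) * ((n : ℝ) + 1)⌋₊ = t * (n + 1) := by
    exact_mod_cast Nat.floor_natCast (R := ℝ) (t * (n + 1))
  rw [h1, scheme_congr q₀ h le_rfl]

/-- A mirror descent algorithm exists. -/
theorem exists_isMirrorDescentAlgorithm [Nontrivial X] :
    ∃ alg : OnlineAlgorithm X, M.IsMirrorDescentAlgorithm κ q₀ alg := by
  let q : CostSeq X → ℝ → V → V → ℝ := fun c t => M.primal κ (M.limitDual κ q₀ c t)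
  have hq : ∀ c t, M.IsTransition (q c t) := fun c t => (isDual_limitDual hκ hq₀ c t).isTransition hκ
  choose F hF using fun c t => (hq c t).exists_isInducedFlow
  -- The future costs are set to 0; by `limitDual_congr` this does not affect the state at time `t`.
  let ext : (t : ℕ) → (Fin t → X → ℝ≥0) → CostSeq X := fun t c i =>
    if h : i < t then c ⟨i, h⟩ else 0
  refine ⟨fun t c => ⟨fun x => M.inflow (F (ext t c) t) (M.sink x),
    fun x => (hF _ _).1.inflow_nonneg _, (hF _ _).1.sum_inflow_sink⟩, fun c => ?_⟩
  refine ⟨q c, ?_, isTrajectory_limit hκ hq₀ c, fun t => ?_⟩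
  · simp only [q]
    rw [limitDual_zero hκ hq₀, primal_dual hκ hq₀]
  · refine ⟨F (ext t fun i => c i) t, ?_, fun x => rfl⟩
    have h1 : q c t = q (ext t fun i => c i) t := by
      simp only [q]
      rw [limitDual_congr (c := c) (c' := ext t fun i => c i) fun i hi => by simp [ext, hi]]
    rw [h1]
    exact hF _ _

end Scheme

end MarkedDAG

end

end MTS

end

theorem theorem2p1 :
    ∃ C : ℝ, 0 < C ∧
      ∀ (X V : Type*) [Fintype X] [Nontrivial X] [MetricSpace X] [Fintype V]
        (M : MTS.MarkedDAG X V) (τ ε L : ℝ),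
        4 ≤ τ → 0 < ε → M.IsGeometric τ → M.IsExpanding ε → M.IsLipschitz L →
        ∀ q₀ : V → V → ℝ, M.IsTransition q₀ →
          (∃ alg : MTS.OnlineAlgorithm X, M.IsMirrorDescentAlgorithm (6 * L) q₀ alg) ∧
          ∀ alg : MTS.OnlineAlgorithm X, M.IsMirrorDescentAlgorithm (6 * L) q₀ alg →
            MTS.IsCompetitive alg 1
              (ENNReal.ofReal (C * (L / ε * ((M.combDepth : ℝ) + M.infoDepth)))) := by
  -- `84 = 14 * 6`: the coefficient of the service cost in the movement bound times `κ / L`.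
  refine ⟨84, by norm_num, ?_⟩
  intro X V _ _ _ _ M τ ε L hτ hε hM hMε hL q₀ hq₀
  have hL₀ : 0 < L := hε.trans_le (hL.expansion_le hε hMε)
  exact ⟨M.exists_isMirrorDescentAlgorithm (by positivity) hq₀,
    fun alg halg => halg.isCompetitive (hM.mono hτ) hε hMε hL hq₀⟩
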